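/- **Theorem 1 (asymptotic $\mu$W UDN spectral efficiency).** Let $\alpha_\mu>2$. Base stations (BSs) and users form two independent homogeneous Poisson point processes in $\mathbb R^2$ with densities $\lambda_\mu>0$ and $\lambda_u>0$; put $\hat\lambda_\mu=\lambda_\mu/\lambda_u$. Each user is associated with its nearest BS. A BS is active if it has at least one associated user, and is turned off otherwise; each active BS schedules one of its associated users uniformly at random, independently of the other BSs. A transmitter at distance $d$ with transmit power $p$ is received with power $p\,g\,d^{-\alpha_\mu}$, where the fading powers $g\sim\exp(1)$ are i.i.d. and independent of the locations and of the scheduling. All BSs transmit with power $P_{\mu.d}>0$ in the downlink, and all scheduled users with power $P_{\mu.u}>0$ in the uplink. Noise is neglected. *Downlink.* Add a typical user at the origin. Let $$\mathsf{SIR}_{\mu.d}=\frac{P_{\mu.d}\,g\,r^{-\alpha_\mu}}{\sum_i P_{\mu.d}\,g_i\,r_i^{-\alpha_\mu}},$$ where $r$ is the distance to its nearest BS and $r_i$ are the distances to the other active BSs, and let $\gamma_{\mu.d}=\mathsf E\log(1+\mathsf{SIR}_{\mu.d})$. *Uplink.* Add a typical BS at the origin. Let $$\mathsf{SIR}_{\mu.u}=\frac{P_{\mu.u}\,g\,r^{-\alpha_\mu}}{\sum_i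 P_{\mu.u}\,g_i\,r_i^{-\alpha_\mu}},$$ where $r$ is the distance to the user that it schedules and $r_i$ are the distances to the users scheduled by the other BSs, and let $\gamma_{\mu.u}=\mathsf E[\log(1+\mathsf{SIR}_{\mu.u})\mid \text{the typical BS is active}]$. Then, as $\hat\lambda_\mu\to\infty$ (in whatever way $\lambda_\mu$, $\lambda_u$ and the powers vary), the downlink and the uplink spectral efficiencies are both asymptotically equal to $\gamma_\mu=\frac{\alpha_\mu}{2}\log\hat\lambda_\mu$, and hence to each other: $$\lim_{\hat\lambda_\mu\to\infty}\frac{\gamma_{\mu.d}}{\frac{\alpha_\mu}{2}\log\hat\lambda_\mu}=\lim_{\hat\lambda_\mu\to\infty}\frac{\gamma_{\mu.u}}{\frac{\alpha_\mu}{2}\log\hat\lambda_\mu}=\lim_{\hat\lambda_\mu\to\infty}\frac{\gamma_{\mu.u}}{\gamma_{\mu.d}}=1 .$$ -/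

import Mathlib

open MeasureTheory ProbabilityTheory Filter Topology
open scoped ENNReal NNReal

noncomputable section

namespace CellularNetwork

/-- The Euclidean plane. -/
abbrev Plane : Type := EuclideanSpace ℝ (Fin 2)

/-- The number of points, counted with multiplicity, that the random point sequence `X` has
in the set `A`. -/
def pointCount {Ω : Type*} (X : ℕ → Ω → Plane) (A : Set Plane) (ω : Ω) : ℕ∞ :=
  {n : ℕ | X n ω ∈ A}.encard

/-- `X` enumerates (in an arbitrary, possibly random, order) the points of a homogeneous Poisson
point process of density `lam` in the plane: the number of points in a Borel set `A` of finite
area is Poisson distributed with mean `lam * area A`, and the numbers of points in finitely many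
pairwise disjoint such sets are independent. -/
structure IsPoissonProcess {Ω : Type*} [MeasurableSpace Ω] (P : Measure Ω) (lam : ℝ)
    (X : ℕ → Ω → Plane) : Prop where
  measurable : ∀ n, Measurable (X n)
  count_law : ∀ A : Set Plane, MeasurableSet A → volume A ≠ ∞ →
    HasLaw (pointCount X A)
      ((poissonMeasure (ENNReal.ofReal lam * volume A).toNNReal).map
        (Nat.cast : ℕ → ℕ∞)) P
  count_indep : ∀ (k : ℕ) (A : Fin k → Set Plane), (∀ i, MeasurableSet (A i)) →
    (∀ i, volume (A i) ≠ ∞) → Pairwise (fun i j => Disjoint (A i) (A j)) →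
    iIndepFun (fun i => pointCount X (A i)) P

/-- The random elements of a microwave cellular network with base station density `lamB`
and user density `lamU`, on the probability space `(Ω, P)`. The receiver under consideration
(the typical user in the downlink, the typical base station in the uplink) sits at the origin
and is not one of the points below.

The random scheduler is encoded by independent uniform priorities: each base station
selects, among its associated users, the one of smallest priority. Given the locations, this is a
uniformly random choice, independent from one base station to another. -/
structure Network {Ω : Type*} [MeasurableSpace Ω] (P : Measure Ω) (lamB lamU : ℝ) where
  /-- locations of the base stations -/
  bs : ℕ → Ω → Plane
  /-- locations of the users -/
  user : ℕ → Ω → Plane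
  /-- fading power from the `n`-th base station to the receiver at the origin -/
  bsFading : ℕ → Ω → ℝ
  /-- fading power from the `m`-th user to the receiver at the origin -/
  userFading : ℕ → Ω → ℝ
  /-- scheduling priority of the `m`-th user -/
  priority : ℕ → Ω → ℝ
  bs_poisson : IsPoissonProcess P lamB bs
  user_poisson : IsPoissonProcess P lamU user
  measurable_bsFading : ∀ n, Measurable (bsFading n)
  measurable_userFading : ∀ m, Measurable (userFading m)
  measurable_priority : ∀ m, Measurable (priority m)
  bsFading_law : ∀ n, HasLaw (bsFading n) (expMeasure 1) P
  userFading_law : ∀ m, HasLaw (userFading m) (expMeasure 1) P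
  priority_law : ∀ m, HasLaw (priority m) ((volume : Measure ℝ).restrict (Set.Icc 0 1)) P
  indep_bs_user : IndepFun (fun ω n => bs n ω) (fun ω m => user m ω) P
  indep_marks : iIndepFun (Sum.elim bsFading (Sum.elim userFading priority)) P
  indep_locations_marks :
    IndepFun (fun ω => ((fun n => bs n ω), (fun m => user m ω)))
      (fun ω i => Sum.elim bsFading (Sum.elim userFading priority) i ω) P

/-- A user at `y` is associated with the `i`-th of the base stations at `x`, i.e. with the
nearest one. As all base stations (and all users) have equal transmit powers, it is the one of
maximal mean received power. -/
def Associated {ι : Type*} (x : ι → Plane) (y : Plane) (i : ι) : Prop :=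
  ∀ j, dist y (x i) ≤ dist y (x j)

/-- Among the users at `y` with priorities `u`, the `m`-th is the one scheduled by the `i`-th
of the base stations at `x`. -/
def Scheduled {ι : Type*} (x : ι → Plane) (y : ℕ → Plane) (u : ℕ → ℝ) (i : ι) (m : ℕ) : Prop :=
  Associated x (y m) i ∧ ∀ m', Associated x (y m') i → u m ≤ u m'

/-- Power received at the origin from a transmitter at `z` with transmit power `p` and
fading power `g`, under path loss exponent `α`: the product `p * g * |z| ^ (-α)`. -/
def receivedPower (α p g : ℝ) (z : Plane) : ℝ≥0∞ :=
  ENNReal.ofReal p * ENNReal.ofReal g * edist z 0 ^ (-α)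

/-- Instantaneous capacity `log (1 + sir)` in nats, as an extended nonnegative number. -/
def capacity (sir : ℝ≥0∞) : ℝ≥0∞ := (ENNReal.log (1 + sir)).toENNReal

namespace Network

variable {Ω : Type*} [MeasurableSpace Ω] {P : Measure Ω} {lamB lamU : ℝ}

/-! Downlink: a typical user at the origin, in addition to the users of the process. -/

/-- Power that the typical user receives from its base station. The index set is almost
surely a singleton. -/
def dlSignal (N : Network P lamB lamU) (α pD : ℝ) (ω : Ω) : ℝ≥0∞ :=
  ∑' n : {n : ℕ | Associated (fun k => N.bs k ω) 0 n},
    receivedPower α pD (N.bsFading n ω) (N.bs n ω)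

/-- Power that the typical user receives from the other active base stations. A base station
is active if it has an associated user; otherwise it is turned off. -/
def dlInterference (N : Network P lamB lamU) (α pD : ℝ) (ω : Ω) : ℝ≥0∞ :=
  ∑' n : {n : ℕ | ¬ Associated (fun k => N.bs k ω) 0 n ∧
      ∃ m, Associated (fun k => N.bs k ω) (N.user m ω) n},
    receivedPower α pD (N.bsFading n ω) (N.bs n ω)

/-- Downlink spectral efficiency: the ergodic capacity of the typical user when it is served,
with transmit power `pD` of the base stations, and without noise. -/
def dlSE (N : Network P lamB lamU) (α pD : ℝ) : ℝ≥0∞ :=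
  ∫⁻ ω, capacity (N.dlSignal α pD ω / N.dlInterference α pD ω) ∂P

/-! Uplink: a typical base station at the origin, in addition to those of the process. -/

/-- Locations of all base stations in the uplink: `none` is the typical one. -/
def ulBs (N : Network P lamB lamU) (ω : Ω) : Option ℕ → Plane
  | none => 0
  | some n => N.bs n ω

/-- The user indices scheduled by the base station `i` in the uplink. -/
def ulScheduled (N : Network P lamB lamU) (ω : Ω) (i : Option ℕ) (m : ℕ) : Prop :=
  Scheduled (N.ulBs ω) (fun k => N.user k ω) (fun k => N.priority k ω) i m

/-- The event that the typical base station is active, i.e. has an associated user. -/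
def ulActive (N : Network P lamB lamU) : Set Ω :=
  {ω | ∃ m, Associated (N.ulBs ω) (N.user m ω) none}

/-- Power that the typical base station receives from its scheduled user. The index set is
almost surely a singleton on the event that the typical base station is active. -/
def ulSignal (N : Network P lamB lamU) (α pU : ℝ) (ω : Ω) : ℝ≥0∞ :=
  ∑' m : {m : ℕ | N.ulScheduled ω none m},
    receivedPower α pU (N.userFading m ω) (N.user m ω)

/-- Power that the typical base station receives from the users scheduled by the other base
stations. -/
def ulInterference (N : Network P lamB lamU) (α pU : ℝ) (ω : Ω) : ℝ≥0∞ :=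
  ∑' m : {m : ℕ | ∃ n : ℕ, N.ulScheduled ω (some n) m},
    receivedPower α pU (N.userFading m ω) (N.user m ω)

/-- Uplink spectral efficiency: the ergodic capacity at the typical base station, given that
it is active, with transmit power `pU` of the users, and without noise. -/
def ulSE (N : Network P lamB lamU) (α pU : ℝ) : ℝ≥0∞ :=
  ∫⁻ ω, capacity (N.ulSignal α pU ω / N.ulInterference α pU ω)
    ∂(ProbabilityTheory.cond P N.ulActive)

end Network

end CellularNetwork

end

/-!
Write `ρ = lamB / lamU`. Both directions rest on one observation. A receiver and its own transmitter
are at a distance of order `lamB ^ (-1/2)`, the typical distance between base stations. When `ρ` is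
large, most base stations have no user and are turned off, so that the active base stations (and
the scheduled users) are as sparse as the users, and the nearest interferer is at a distance of
order `lamU ^ (-1/2)`. Hence, with `S` and `J` the received powers of signal and interference after
rescaling the plane by `√lamB` and by `√lamU` respectively, the signal-to-interference ratio is
`ρ ^ (α / 2) * S / J`, where `S` and `J` are of order one. What has to be shown is that `S` and `J`
only contribute `o(log ρ)` to the mean capacity.

*Upper bounds* (`Network.dlSE_le`, `Network.ulSE_le`). By `capacity_mul_le`, the capacity is at
most `capacity (ρ ^ (α / 2)) + capacity S + capacity J⁻¹`. The mean of `capacity S` is bounded by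
summing over *all* transmitters, served or not, and applying Campbell's formula
(`tsum_lintegral_capacity`); in the uplink, the sum is of order `ρ⁻¹`, as is the probability
that the typical base station is active (`Network.le_measure_ulActive`), so that conditioning costs
a constant factor. For `capacity J⁻¹`, one exhibits an interferer within scaled distance
`6 * k` outside an event of probability `O(exp (-2 * k))`, chosen by the locations and priorities
alone, so that its fading is still exponential (`setLIntegral_le_of_selection`). Summing over `k`
from a cutoff `k₀` on gives `setLIntegral_capacity_inv_le`. The cutoff is of order `log ρ`, which
makes the error `exp (-k₀)` small even compared to the probability of activity, at the price of a
term of order `√k₀ = O(√(log ρ))`.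

*Lower bounds* (`Network.le_dlSE`, `Network.le_ulSE`). For a parameter `K`, in the end `log ρ`, one
has `S ≥ K ^ (-(1 + α))` and `J ≤ K ^ (3 + 2 * α)` outside an exceptional event, whose probability
is `O(1 / K)` in the downlink and `O(1 / (K * ρ))` in the uplink. The interference is controlled by
Markov's inequality after excluding interferers at an untypically small distance. In the downlink
this uses that users are close to their base stations (`Network.farUser`), and that the
expected number of base stations nearest to a given location, counted with multiplicity, is at
most two (`IsPoissonProcess.tsum_measure_associated_le`).

The two bounds give the limit by `tendsto_div_log_of_bounds`.

A Poisson process enters only through its void probabilities and through Campbell's formula, both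
unrestricted (`IsPoissonProcess.tsum_lintegral`) and on an event that depends on the number of
points in a set disjoint from the support of the integrand
(`IsPoissonProcess.tsum_setLIntegral_compl`).
-/

noncomputable section

namespace CellularNetwork

/-! ### Poisson point processes in the plane -/

lemma toENNReal_pointCount {Ω : Type*} (X : ℕ → Ω → Plane) (A : Set Plane) (ω : Ω) :
    ((pointCount X A ω : ℕ∞) : ℝ≥0∞) = ∑' n, A.indicator 1 (X n ω) := by
  rw [pointCount, ← ENNReal.tsum_set_one,
    tsum_subtype {n | X n ω ∈ A} (fun _ => (1 : ℝ≥0∞))]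
  rfl

lemma lintegral_id_poissonMeasure (r : ℝ≥0) : ∫⁻ k, (k : ℝ≥0∞) ∂(poissonMeasure r) = r := by
  rw [lintegral_countable', tsum_eq_zero_add' ENNReal.summable]
  have h (k : ℕ) : ((k + 1 : ℕ) : ℝ≥0∞) * poissonMeasure r {k + 1}
      = r * poissonMeasure r {k} := by
    rw [poissonMeasure_singleton, poissonMeasure_singleton, ← ENNReal.ofReal_coe_nnreal,
      ← ENNReal.ofReal_natCast, ← ENNReal.ofReal_mul (by positivity),
      ← ENNReal.ofReal_mul (by positivity)]
    congr 1
    rw [Nat.factorial_succ]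
    push_cast
    have : (k.factorial : ℝ) ≠ 0 := by positivity
    field_simp
    ring
  simp_rw [h]
  have := measure_univ (μ := poissonMeasure r)
  rw [ENNReal.tsum_mul_left]
  have h2 : ∑' k, poissonMeasure r {k} = 1 := by
    have := lintegral_countable' (μ := poissonMeasure r) (fun _ => 1)
    simpa using this.symm
  simp [h2]

/-- Two measures on a set `D` agree if they agree on the subsets of `D` of finite volume. -/
lemma restrict_eq_of_forall_finite_volume {μ ν : Measure Plane} {D : Set Plane}
    (hD : MeasurableSet D)
    (h : ∀ A ⊆ D, MeasurableSet A → volume A ≠ ∞ → μ A = ν A) :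
    μ.restrict D = ν.restrict D := by
  rw [← sum_restrict_disjointed_spanningSets (μ.restrict D) volume,
    ← sum_restrict_disjointed_spanningSets (ν.restrict D) volume]
  congr 1
  ext n A hA
  have hm : MeasurableSet (disjointed (spanningSets (volume : Measure Plane)) n) :=
    .disjointed (measurableSet_spanningSets _) n
  rw [Measure.restrict_apply hA, Measure.restrict_apply hA, Measure.restrict_apply (hA.inter hm),
    Measure.restrict_apply (hA.inter hm)]
  refine h _ Set.inter_subset_right ((hA.inter hm).inter hD) (ne_top_of_le_ne_top
    (measure_spanningSets_lt_top volume n).ne (measure_mono ?_))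
  exact (Set.inter_subset_left.trans Set.inter_subset_right).trans (disjointed_subset _ _)

lemma pointCount_preimage_zero {Ω : Type*} (X : ℕ → Ω → Plane) (A : Set Plane) :
    pointCount X A ⁻¹' {0} = {ω | ∀ n, X n ω ∉ A} := by
  ext ω
  simp [pointCount, Set.encard_eq_zero, Set.eq_empty_iff_forall_notMem]

namespace IsPoissonProcess

variable {Ω : Type*} [MeasurableSpace Ω] {P : Measure Ω} {lam : ℝ} {X : ℕ → Ω → Plane}

lemma measurable_pointCount (hX : IsPoissonProcess P lam X) {A : Set Plane}
    (hA : MeasurableSet A) : Measurable (pointCount X A) := by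
  refine measurable_to_countable' fun k => ?_
  have : pointCount X A ⁻¹' {k} = {ω | ∑' n, A.indicator 1 (X n ω) = (k : ℝ≥0∞)} := by
    ext ω
    simp [← toENNReal_pointCount]
  rw [this]
  refine measurableSet_eq_fun (Measurable.tsum fun n => ?_) measurable_const
  exact (measurable_one.indicator hA).comp (hX.measurable n)

lemma lintegral_pointCount (hX : IsPoissonProcess P lam X) {A : Set Plane}
    (hA : MeasurableSet A) (hA' : volume A ≠ ∞) :
    ∫⁻ ω, (pointCount X A ω : ℝ≥0∞) ∂P = ENNReal.ofReal lam * volume A := by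
  have h := (hX.count_law A hA hA').lintegral_comp
    (f := fun k : ℕ∞ => (k : ℝ≥0∞)) (Measurable.of_discrete).aemeasurable
  rw [h, lintegral_map Measurable.of_discrete Measurable.of_discrete]
  simp only [ENat.toENNReal_coe]
  rw [lintegral_id_poissonMeasure, ENNReal.coe_toNNReal]
  exact ENNReal.mul_ne_top ENNReal.ofReal_ne_top hA'

/-- **Campbell's formula**, on the event that the number of points in `A` lies in `T`: the points
outside `A` have the same intensity as without this restriction. -/
lemma tsum_setLIntegral_compl (hX : IsPoissonProcess P lam X) {A : Set Plane}
    (hA : MeasurableSet A) (hA' : volume A ≠ ∞) (T : Set ℕ∞) {f : Plane → ℝ≥0∞}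
    (hf : Measurable f) (hfA : ∀ x ∈ A, f x = 0) :
    ∑' n, ∫⁻ ω in pointCount X A ⁻¹' T, f (X n ω) ∂P
      = P (pointCount X A ⁻¹' T) * ENNReal.ofReal lam * ∫⁻ x, f x := by
  set H := pointCount X A ⁻¹' T
  have hH : MeasurableSet H := hX.measurable_pointCount hA trivial
  have key : (Measure.sum fun n => (P.restrict H).map (X n)).restrict Aᶜ
      = ((P H * ENNReal.ofReal lam) • (volume : Measure Plane)).restrict Aᶜ := by
    refine restrict_eq_of_forall_finite_volume hA.compl fun B hBA hB hB' => ?_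
    have hind : IndepFun (pointCount X B) (pointCount X A) P := by
      have := hX.count_indep 2 ![B, A] (by simp [Fin.forall_fin_two, hA, hB])
        (by simp [Fin.forall_fin_two, hA', hB']) (by
          intro i j hij
          fin_cases i <;> fin_cases j <;> simp at hij ⊢
          · exact Set.disjoint_left.2 fun x hx hx' => hBA hx hx'
          · exact Set.disjoint_left.2 fun x hx hx' => hBA hx' hx)
      exact this.indepFun (i := 0) (j := 1) (by simp)
    have hprod := lintegral_mul_eq_lintegral_mul_lintegral_of_indepFun
      (f := (fun k : ℕ∞ => (k : ℝ≥0∞)) ∘ pointCount X B)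
      (g := (T.indicator 1 : ℕ∞ → ℝ≥0∞) ∘ pointCount X A)
      (Measurable.of_discrete.comp (hX.measurable_pointCount hB))
      (Measurable.of_discrete.comp (hX.measurable_pointCount hA))
      (hind.comp Measurable.of_discrete Measurable.of_discrete)
    have h1 : ∫⁻ ω, ((T.indicator 1 : ℕ∞ → ℝ≥0∞) ∘ pointCount X A) ω ∂P = P H := by
      rw [← lintegral_indicator_one hH]
      rfl
    have h2 : ∫⁻ ω, ((fun k : ℕ∞ => (k : ℝ≥0∞)) ∘ pointCount X B) ω ∂P
        = ENNReal.ofReal lam * volume B := hX.lintegral_pointCount hB hB'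
    have h3 : ∫⁻ ω, (((fun k : ℕ∞ => (k : ℝ≥0∞)) ∘ pointCount X B)
          * ((T.indicator 1 : ℕ∞ → ℝ≥0∞) ∘ pointCount X A)) ω ∂P
        = ∫⁻ ω in H, (pointCount X B ω : ℝ≥0∞) ∂P := by
      rw [← lintegral_indicator hH]
      refine lintegral_congr fun ω => ?_
      by_cases hω : pointCount X A ω ∈ T
      · have : ω ∈ H := hω
        simp [hω, this]
      · have : ω ∉ H := hω
        simp [hω, this]
    rw [Measure.sum_apply _ hB, Measure.smul_apply, smul_eq_mul]
    have h4 : ∀ n, (P.restrict H).map (X n) B = ∫⁻ ω in H, B.indicator 1 (X n ω) ∂P := by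
      intro n
      rw [Measure.map_apply (hX.measurable n) hB, ← lintegral_indicator_one
        (hX.measurable n hB)]
      rfl
    simp_rw [h4]
    rw [← lintegral_tsum (f := fun n ω => B.indicator 1 (X n ω)) fun n =>
      ((measurable_one.indicator hB).comp (hX.measurable n)).aemeasurable]
    simp_rw [← toENNReal_pointCount]
    rw [← h3, hprod, h1, h2]
    ring
  have hsupp : f.support ⊆ Aᶜ := fun x hx hxA => hx (hfA x hxA)
  calc ∑' n, ∫⁻ ω in H, f (X n ω) ∂P
      = ∫⁻ x, f x ∂(Measure.sum fun n => (P.restrict H).map (X n)) := by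
        rw [lintegral_sum_measure]
        exact tsum_congr fun n => (lintegral_map hf (hX.measurable n)).symm
    _ = ∫⁻ x in Aᶜ, f x ∂(Measure.sum fun n => (P.restrict H).map (X n)) :=
        (setLIntegral_eq_of_support_subset hsupp).symm
    _ = ∫⁻ x in Aᶜ, f x ∂((P H * ENNReal.ofReal lam) • (volume : Measure Plane)) := by rw [key]
    _ = ∫⁻ x, f x ∂((P H * ENNReal.ofReal lam) • (volume : Measure Plane)) :=
        setLIntegral_eq_of_support_subset hsupp
    _ = _ := by rw [lintegral_smul_measure, smul_eq_mul]

/-- **Campbell's formula.** -/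
lemma tsum_lintegral [IsProbabilityMeasure P] (hX : IsPoissonProcess P lam X)
    {f : Plane → ℝ≥0∞} (hf : Measurable f) :
    ∑' n, ∫⁻ ω, f (X n ω) ∂P = ENNReal.ofReal lam * ∫⁻ x, f x := by
  simpa using hX.tsum_setLIntegral_compl MeasurableSet.empty (by simp) Set.univ hf (by simp)

lemma tsum_measure_mem [IsProbabilityMeasure P] (hX : IsPoissonProcess P lam X)
    {A : Set Plane} (hA : MeasurableSet A) :
    ∑' n, P {ω | X n ω ∈ A} = ENNReal.ofReal lam * volume A := by
  have := hX.tsum_lintegral (f := A.indicator 1) (measurable_one.indicator hA)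
  rw [lintegral_indicator_one hA] at this
  rw [← this]
  refine tsum_congr fun n => ?_
  exact (lintegral_indicator_one (hX.measurable n hA : MeasurableSet {ω | X n ω ∈ A})).symm

lemma measure_exists_mem_le [IsProbabilityMeasure P] (hX : IsPoissonProcess P lam X)
    {A : Set Plane} (hA : MeasurableSet A) :
    P {ω | ∃ n, X n ω ∈ A} ≤ ENNReal.ofReal lam * volume A := by
  rw [Set.ofPred_exists, ← hX.tsum_measure_mem hA]
  exact measure_iUnion_le _

lemma measure_pointCount_eq (hX : IsPoissonProcess P lam X)
    {A : Set Plane} (hA : MeasurableSet A) (hA' : volume A ≠ ∞) (k : ℕ) :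
    P (pointCount X A ⁻¹' {(k : ℕ∞)})
      = poissonMeasure (ENNReal.ofReal lam * volume A).toNNReal {k} := by
  have h := hX.count_law A hA hA'
  rw [← Measure.map_apply_of_aemeasurable h.aemeasurable trivial, h.map_eq,
    Measure.map_apply Measurable.of_discrete (.of_discrete)]
  congr 1
  ext j
  simp

/-- Void probabilities. -/
lemma measure_forall_notMem (hX : IsPoissonProcess P lam X) (hlam : 0 ≤ lam)
    {A : Set Plane} (hA : MeasurableSet A) (hA' : volume A ≠ ∞) :
    P {ω | ∀ n, X n ω ∉ A} = ENNReal.ofReal (Real.exp (-(lam * (volume A).toReal))) := by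
  have := hX.measure_pointCount_eq hA hA' 0
  rw [Nat.cast_zero, pointCount_preimage_zero] at this
  rw [this, poissonMeasure_singleton]
  simp [ENNReal.toReal_ofReal hlam, ENNReal.coe_toNNReal_eq_toReal]

lemma measure_two_mem_le [IsProbabilityMeasure P] (hX : IsPoissonProcess P lam X)
    {A : Set Plane} (hA : MeasurableSet A) (hA' : volume A ≠ ∞) :
    P {ω | ∃ m n, m ≠ n ∧ X m ω ∈ A ∧ X n ω ∈ A} ≤ (ENNReal.ofReal lam * volume A) ^ 2 := by
  set r := (ENNReal.ofReal lam * volume A).toNNReal with hr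
  have hr' : ENNReal.ofReal lam * volume A = ENNReal.ofReal r := by
    rw [ENNReal.ofReal_coe_nnreal, hr, ENNReal.coe_toNNReal]
    exact ENNReal.mul_ne_top ENNReal.ofReal_ne_top hA'
  have hm := hX.measurable_pointCount hA
  have hsub : {ω | ∃ m n, m ≠ n ∧ X m ω ∈ A ∧ X n ω ∈ A}
      ⊆ (pointCount X A ⁻¹' {((0 : ℕ) : ℕ∞)} ∪ pointCount X A ⁻¹' {((1 : ℕ) : ℕ∞)})ᶜ := by
    rintro ω ⟨m, n, hmn, h1, h2⟩ hω
    have : (2 : ℕ∞) ≤ pointCount X A ω := by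
      rw [← Set.encard_pair hmn]
      exact Set.encard_le_encard (by rintro k (rfl | rfl) <;> assumption)
    rcases hω with h | h <;> rw [Set.mem_preimage, Set.mem_singleton_iff] at h <;>
      rw [h] at this <;>
      exact absurd this (by decide)
  refine (measure_mono hsub).trans ?_
  rw [prob_compl_eq_one_sub ((hm trivial).union (hm trivial)), measure_union _ (hm trivial),
    hX.measure_pointCount_eq hA hA', hX.measure_pointCount_eq hA hA', poissonMeasure_singleton,
    poissonMeasure_singleton, ← hr, hr', ← ENNReal.ofReal_add (by positivity) (by positivity),
    ← ENNReal.ofReal_one, ← ENNReal.ofReal_sub _ (by positivity),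
    ← ENNReal.ofReal_pow (by positivity)]
  · refine ENNReal.ofReal_le_ofReal ?_
    have h1 : 1 - (r : ℝ) ≤ Real.exp (-r) := by linarith [Real.add_one_le_exp (-(r : ℝ))]
    have h2 : (0 : ℝ) ≤ r := r.2
    simp
    nlinarith
  · exact (Set.disjoint_singleton.2 (by decide)).preimage _

/-- A Poisson process is almost surely locally finite. -/
lemma ae_finite_closedBall (hX : IsPoissonProcess P lam X) :
    ∀ᵐ ω ∂P, ∀ R : ℝ, {n | X n ω ∈ Metric.closedBall 0 R}.Finite := by
  have h : ∀ᵐ ω ∂P, ∀ k : ℕ, {n | X n ω ∈ Metric.closedBall 0 (k : ℝ)}.Finite := by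
    refine ae_all_iff.2 fun k => ?_
    have h1 := hX.lintegral_pointCount (A := Metric.closedBall 0 (k : ℝ))
      Metric.isClosed_closedBall.measurableSet measure_closedBall_lt_top.ne
    have h2 := ae_lt_top (Measurable.of_discrete.comp (hX.measurable_pointCount
      (A := Metric.closedBall 0 (k : ℝ)) Metric.isClosed_closedBall.measurableSet))
      (f := (fun k : ℕ∞ => (k : ℝ≥0∞)) ∘ pointCount X (Metric.closedBall 0 (k : ℝ))) (μ := P)
      (by
        change ∫⁻ ω, (pointCount X (Metric.closedBall 0 (k : ℝ)) ω : ℝ≥0∞) ∂P ≠ ∞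
        rw [h1]
        exact ENNReal.mul_ne_top ENNReal.ofReal_ne_top measure_closedBall_lt_top.ne)
    filter_upwards [h2] with ω hω
    rw [← Set.encard_lt_top_iff]
    simpa [pointCount] using hω
  filter_upwards [h] with ω hω R
  obtain ⟨k, hk⟩ := exists_nat_ge R
  exact (hω k).subset fun n hn => Metric.closedBall_subset_closedBall hk hn

end IsPoissonProcess

/-! ### Nearest points -/

lemma volume_ball (x : Plane) {r : ℝ} (hr : 0 ≤ r) :
    volume (Metric.ball x r) = ENNReal.ofReal (Real.pi * r ^ 2) := by
  rw [EuclideanSpace.volume_ball_fin_two, ← ENNReal.ofReal_pow hr, mul_comm,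
    ENNReal.ofReal_mul Real.pi_pos.le]

/-- In a locally finite family, every point has a nearest member. -/
lemma exists_associated {ι : Type*} {x : ι → Plane}
    (hx : ∀ R : ℝ, {n | x n ∈ Metric.closedBall 0 R}.Finite) (y : Plane) (i : ι) :
    ∃ n, Associated x y n := by
  have hfin : {n | dist y (x n) ≤ dist y (x i)}.Finite := by
    refine (hx (dist y (x i) + dist y 0)).subset fun n hn => ?_
    rw [Set.mem_ofPred_eq, Metric.mem_closedBall]
    have h1 : dist y (x n) ≤ dist y (x i) := hn
    linarith [dist_triangle_left (x n) 0 y]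
  obtain ⟨n, hn, hmin⟩ := Set.exists_min_image _ (fun n => dist y (x n)) hfin
    ⟨i, le_refl (dist y (x i))⟩
  refine ⟨n, fun j => ?_⟩
  by_cases hj : dist y (x j) ≤ dist y (x i)
  · exact hmin j hj
  · have h1 : dist y (x n) ≤ dist y (x i) := hn
    linarith

lemma IsPoissonProcess.measure_forall_le_dist {Ω : Type*} [MeasurableSpace Ω] {P : Measure Ω}
    {lam : ℝ} {X : ℕ → Ω → Plane} (hX : IsPoissonProcess P lam X) (hlam : 0 ≤ lam) (y : Plane)
    {r : ℝ} (hr : 0 ≤ r) :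
    P {ω | ∀ n, r ≤ dist y (X n ω)} = ENNReal.ofReal (Real.exp (-(lam * (Real.pi * r ^ 2)))) := by
  have h := hX.measure_forall_notMem hlam (A := Metric.ball y r) Metric.isOpen_ball.measurableSet
    measure_ball_lt_top.ne
  simp only [Metric.mem_ball, not_lt, dist_comm _ y] at h
  rw [h, volume_ball y hr, ENNReal.toReal_ofReal (by positivity)]

lemma tsum_ofReal_exp_neg_le : ∑' k : ℕ, ENNReal.ofReal (Real.exp (-k)) ≤ 2 := by
  have h (k : ℕ) : ENNReal.ofReal (Real.exp (-k)) ≤ 2⁻¹ ^ k := by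
    have h1 : Real.exp (-k) = (Real.exp 1)⁻¹ ^ k := by
      rw [← Real.exp_neg, ← Real.exp_nat_mul]
      ring_nf
    have h2 : (Real.exp 1)⁻¹ ≤ 2⁻¹ :=
      inv_anti₀ (by norm_num) (by linarith [Real.add_one_le_exp (1 : ℝ)])
    have h3 : ENNReal.ofReal (2⁻¹) = 2⁻¹ := by
      rw [ENNReal.ofReal_inv_of_pos two_pos]
      simp
    rw [h1, ENNReal.ofReal_pow (by positivity), ← h3]
    gcongr
  refine (ENNReal.tsum_le_tsum h).trans ?_
  rw [ENNReal.tsum_geometric, ENNReal.one_sub_inv_two, inv_inv]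

/-- The expected number of points of a Poisson process that are nearest to a given location is
bounded (in fact it is one). A nearest point lies in one of the annuli of area `1 / lam` around
the location, the disk inside this annulus is void, and the numbers of points in the two are
independent. -/
lemma IsPoissonProcess.tsum_measure_associated_le {Ω : Type*} [MeasurableSpace Ω] {P : Measure Ω}
    [IsProbabilityMeasure P] {lam : ℝ} {X : ℕ → Ω → Plane} (hX : IsPoissonProcess P lam X)
    (hlam : 0 < lam) (y : Plane) :
    ∑' n, P {ω | Associated (fun k => X k ω) y n} ≤ 2 := by
  set c : ℝ := 1 / (Real.pi * lam) with hc
  have hc0 : 0 < c := by positivity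
  set r : ℕ → ℝ := fun k => √(k * c) with hr
  have hr0 : ∀ k, 0 ≤ r k := fun k => Real.sqrt_nonneg _
  have hr2 : ∀ k, r k ^ 2 = k * c := fun k => Real.sq_sqrt (by positivity)
  have hrmono : ∀ k, r k ≤ r (k + 1) := fun k => Real.sqrt_le_sqrt (by push_cast; nlinarith)
  set D : ℕ → Set Plane := fun k => Metric.ball y (r (k + 1)) \ Metric.ball y (r k) with hD
  have hDm : ∀ k, MeasurableSet (D k) := fun k =>
    Metric.isOpen_ball.measurableSet.diff Metric.isOpen_ball.measurableSet
  have hDvol : ∀ k, volume (D k) = ENNReal.ofReal (1 / lam) := by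
    intro k
    rw [hD, measure_sdiff (Metric.ball_subset_ball (hrmono k))
      Metric.isOpen_ball.measurableSet.nullMeasurableSet measure_ball_lt_top.ne,
      volume_ball y (hr0 _), volume_ball y (hr0 _),
      ← ENNReal.ofReal_sub _ (by have := hr0 k; positivity), hr2, hr2]
    congr 1
    rw [hc]
    have := Real.pi_pos
    push_cast
    field_simp
    ring
  have hsub : ∀ n, {ω | Associated (fun k => X k ω) y n}
      ⊆ ⋃ k, {ω | X n ω ∈ D k} ∩ pointCount X (Metric.ball y (r k)) ⁻¹' {0} := by
    intro n ω hω
    have hω' : ∀ j, dist y (X n ω) ≤ dist y (X j ω) := hω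
    set d := dist y (X n ω)
    have hd : 0 ≤ d := dist_nonneg
    refine Set.mem_iUnion.2 ⟨⌊d ^ 2 / c⌋₊, ?_⟩
    have h1 : (⌊d ^ 2 / c⌋₊ : ℝ) * c ≤ d ^ 2 := by
      rw [← le_div_iff₀ hc0]
      exact Nat.floor_le (by positivity)
    have h2 : d ^ 2 < ((⌊d ^ 2 / c⌋₊ + 1 : ℕ) : ℝ) * c := by
      rw [← div_lt_iff₀ hc0]
      push_cast
      exact Nat.lt_floor_add_one _
    have h3 : r ⌊d ^ 2 / c⌋₊ ≤ d := Real.sqrt_le_iff.2 ⟨hd, h1⟩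
    refine ⟨⟨?_, ?_⟩, ?_⟩
    · rw [Metric.mem_ball, dist_comm]
      exact (Real.lt_sqrt hd).2 h2
    · rw [Metric.mem_ball, dist_comm, not_lt]
      exact h3
    · rw [pointCount_preimage_zero]
      intro j
      rw [Metric.mem_ball, dist_comm, not_lt]
      exact h3.trans (hω' j)
  calc ∑' n, P {ω | Associated (fun k => X k ω) y n}
      ≤ ∑' n, ∑' k, P ({ω | X n ω ∈ D k} ∩ pointCount X (Metric.ball y (r k)) ⁻¹' {0}) :=
        ENNReal.tsum_le_tsum fun n => (measure_mono (hsub n)).trans (measure_iUnion_le _)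
    _ = ∑' k, ∑' n, P ({ω | X n ω ∈ D k} ∩ pointCount X (Metric.ball y (r k)) ⁻¹' {0}) :=
        ENNReal.tsum_comm
    _ = ∑' k : ℕ, ENNReal.ofReal (Real.exp (-k)) := by
        refine tsum_congr fun k => ?_
        have h := hX.tsum_setLIntegral_compl (A := Metric.ball y (r k))
          Metric.isOpen_ball.measurableSet measure_ball_lt_top.ne {0}
          (f := (D k).indicator 1) (measurable_one.indicator (hDm k))
          (fun x hx => Set.indicator_of_notMem (fun h => h.2 hx) _)
        rw [lintegral_indicator_one (hDm k), hDvol, mul_assoc, ← ENNReal.ofReal_mul hlam.le,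
          mul_one_div_cancel hlam.ne', ENNReal.ofReal_one, mul_one, pointCount_preimage_zero,
          hX.measure_forall_notMem hlam.le Metric.isOpen_ball.measurableSet
            measure_ball_lt_top.ne, volume_ball y (hr0 k),
          ENNReal.toReal_ofReal (by have := hr0 k; positivity), hr2] at h
        have hk : lam * (Real.pi * (k * c)) = k := by
          rw [hc]
          have := Real.pi_pos
          field_simp
        rw [hk] at h
        rw [← h]
        refine tsum_congr fun n => ?_
        rw [← pointCount_preimage_zero, ← Measure.restrict_apply' (hX.measurable_pointCount
          Metric.isOpen_ball.measurableSet (.of_discrete))]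
        exact (lintegral_indicator_one (hX.measurable n (hDm k) :
          MeasurableSet {ω | X n ω ∈ D k})).symm
    _ ≤ 2 := tsum_ofReal_exp_neg_le

/-! ### Marked point processes and independence -/

section Independence

variable {Ω : Type*} [MeasurableSpace Ω] {P : Measure Ω} [IsProbabilityMeasure P]

/-- The expectation of a function of two independent variables. -/
lemma lintegral_indepFun {E F : Type*} [MeasurableSpace E] [MeasurableSpace F] {U : Ω → E}
    {V : Ω → F} (hU : Measurable U) (hV : Measurable V) (h : IndepFun U V P)
    {f : E × F → ℝ≥0∞} (hf : Measurable f) :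
    ∫⁻ ω, f (U ω, V ω) ∂P = ∫⁻ x, ∫⁻ ω, f (x, V ω) ∂P ∂(P.map U) := by
  have : IsProbabilityMeasure (P.map V) := Measure.isProbabilityMeasure_map hV.aemeasurable
  have h1 := (indepFun_iff_map_prod_eq_prod_map_map hU.aemeasurable hV.aemeasurable).1 h
  rw [← lintegral_map hf (hU.prodMk hV), h1, lintegral_prod _ hf.aemeasurable]
  exact lintegral_congr fun x => lintegral_map (hf.comp measurable_prodMk_left) hV

/-- Campbell's formula for a function of a point and of an independent variable. -/
lemma IsPoissonProcess.tsum_lintegral_indepFun {lam : ℝ} {Y : ℕ → Ω → Plane}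
    (hY : IsPoissonProcess P lam Y) {F : Type*} [MeasurableSpace F] {V : Ω → F}
    (hV : Measurable V) (h : ∀ m, IndepFun (Y m) V P) {f : Plane × F → ℝ≥0∞}
    (hf : Measurable f) :
    ∑' m, ∫⁻ ω, f (Y m ω, V ω) ∂P
      = ENNReal.ofReal lam * ∫⁻ y, ∫⁻ ω, f (y, V ω) ∂P := by
  have hm : Measurable fun y => ∫⁻ ω, f (y, V ω) ∂P :=
    Measurable.lintegral_prod_right' (f := fun p : Plane × Ω => f (p.1, V p.2))
      (hf.comp (measurable_fst.prodMk (hV.comp measurable_snd)))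
  rw [← hY.tsum_lintegral hm]
  refine tsum_congr fun m => ?_
  rw [lintegral_indepFun (hY.measurable m) hV (h m) hf, lintegral_map hm (hY.measurable m)]

/-- If `U` is independent of the pair of the independent variables `V` and `W`, then the pair of
`U` and `V` is independent of `W`. -/
lemma indepFun_prodMk_of_indepFun {E F G : Type*} [MeasurableSpace E] [MeasurableSpace F]
    [MeasurableSpace G] {U : Ω → E} {V : Ω → F} {W : Ω → G} (hU : Measurable U)
    (hV : Measurable V) (hW : Measurable W) (h : IndepFun U (fun ω => (V ω, W ω)) P)
    (hVW : IndepFun V W P) : IndepFun (fun ω => (U ω, V ω)) W P := by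
  have : IsProbabilityMeasure (P.map U) := Measure.isProbabilityMeasure_map hU.aemeasurable
  have : IsProbabilityMeasure (P.map V) := Measure.isProbabilityMeasure_map hV.aemeasurable
  have : IsProbabilityMeasure (P.map W) := Measure.isProbabilityMeasure_map hW.aemeasurable
  have hUV : IndepFun U V P := h.comp measurable_id measurable_fst
  rw [indepFun_iff_map_prod_eq_prod_map_map (hU.prodMk hV).aemeasurable hW.aemeasurable,
    (indepFun_iff_map_prod_eq_prod_map_map hU.aemeasurable hV.aemeasurable).1 hUV]
  have h1 := (indepFun_iff_map_prod_eq_prod_map_map hU.aemeasurable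
    (hV.prodMk hW).aemeasurable).1 h
  rw [(indepFun_iff_map_prod_eq_prod_map_map hV.aemeasurable hW.aemeasurable).1 hVW] at h1
  have h2 : Measurable fun ω => (U ω, V ω, W ω) := hU.prodMk (hV.prodMk hW)
  have h3 := congrArg (Measure.map MeasurableEquiv.prodAssoc.symm) h1
  rw [Measure.map_map MeasurableEquiv.prodAssoc.symm.measurable h2] at h3
  have h4 := (measurePreserving_prodAssoc (P.map U) (P.map V) (P.map W)).symm.map_eq
  rw [← h4, ← h3]
  rfl

omit [IsProbabilityMeasure P] in
/-- The mean of a function of an independent mark over an event. -/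
lemma setLIntegral_preimage_indepFun {E F : Type*} [MeasurableSpace E] [MeasurableSpace F]
    {L : Ω → E} {g : Ω → F} (hL : Measurable L) (hg : Measurable g) (h : IndepFun L g P)
    {C : Set E} (hC : MeasurableSet C) {φ : F → ℝ≥0∞} (hφ : Measurable φ) :
    ∫⁻ ω in L ⁻¹' C, φ (g ω) ∂P = P (L ⁻¹' C) * ∫⁻ ω, φ (g ω) ∂P := by
  have := lintegral_mul_eq_lintegral_mul_lintegral_of_indepFun
    (f := (C.indicator 1 : E → ℝ≥0∞) ∘ L) (g := φ ∘ g)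
    ((measurable_one.indicator hC).comp hL) (hφ.comp hg)
    (h.comp (measurable_one.indicator hC) hφ)
  have h1 : ∫⁻ ω, ((C.indicator 1 : E → ℝ≥0∞) ∘ L) ω ∂P = P (L ⁻¹' C) :=
    lintegral_indicator_one (hL hC)
  rw [h1] at this
  rw [← lintegral_indicator (hL hC)]
  refine Eq.trans (lintegral_congr fun ω => ?_) this
  by_cases hω : L ω ∈ C
  · simp [hω]
  · simp [hω]

omit [IsProbabilityMeasure P] in
/-- Suppose that the events `L ⁻¹' C n` do not depend on the marks `g n`, and that `Ψ` is bounded by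
`φ (g n)` whenever `L ⁻¹' C n` occurs. Then the integral of `Ψ` over the union of these events
is bounded as if the first `n` for which `L ⁻¹' C n` occurs were deterministic. -/
lemma setLIntegral_le_of_selection {E F : Type*} [MeasurableSpace E] [MeasurableSpace F]
    {L : Ω → E} {g : ℕ → Ω → F} (hL : Measurable L) (hg : ∀ n, Measurable (g n))
    (h : ∀ n, IndepFun L (g n) P) {C : ℕ → Set E} (hC : ∀ n, MeasurableSet (C n))
    {φ : F → ℝ≥0∞} (hφ : Measurable φ) {b : ℝ≥0∞} (hb : ∀ n, ∫⁻ ω, φ (g n ω) ∂P ≤ b)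
    {V : Set E} (hV : MeasurableSet V) {Ψ : Ω → ℝ≥0∞}
    (hΨ : ∀ n ω, L ω ∈ C n → Ψ ω ≤ φ (g n ω)) :
    ∫⁻ ω in L ⁻¹' (V ∩ ⋃ n, C n), Ψ ω ∂P ≤ b * P (L ⁻¹' (V ∩ ⋃ n, C n)) := by
  set D : ℕ → Set E := fun n => V ∩ disjointed C n
  have hD : ∀ n, MeasurableSet (D n) := fun n => hV.inter (.disjointed hC n)
  have hUD : V ∩ ⋃ n, C n = ⋃ n, D n := by
    rw [← Set.inter_iUnion, iUnion_disjointed]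
  have hdisj : Pairwise (Function.onFun Disjoint fun n => L ⁻¹' D n) := fun i j hij =>
    (((disjoint_disjointed C) hij).mono Set.inter_subset_right Set.inter_subset_right).preimage L
  rw [hUD, Set.preimage_iUnion, lintegral_iUnion (fun n => hL (hD n)) hdisj,
    measure_iUnion hdisj (fun n => hL (hD n)), ← ENNReal.tsum_mul_left]
  refine ENNReal.tsum_le_tsum fun n => ?_
  calc ∫⁻ ω in L ⁻¹' D n, Ψ ω ∂P ≤ ∫⁻ ω in L ⁻¹' D n, φ (g n ω) ∂P :=
        setLIntegral_mono' (hL (hD n)) fun ω hω => hΨ n ω (disjointed_subset C n hω.2)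
    _ = P (L ⁻¹' D n) * ∫⁻ ω, φ (g n ω) ∂P :=
        setLIntegral_preimage_indepFun hL (hg n) (h n) (hD n) hφ
    _ ≤ b * P (L ⁻¹' D n) := by
        rw [mul_comm]
        gcongr
        exact hb n

end Independence

/-! ### The capacity function -/

lemma capacity_mono : Monotone capacity := fun _ _ h =>
  EReal.toENNReal_le_toENNReal (ENNReal.log_le_log (add_le_add_right h 1))

lemma measurable_capacity : Measurable capacity :=
  (ENNReal.measurable_log.comp (measurable_const.add measurable_id)).ereal_toENNReal

lemma log_one_add_nonneg (x : ℝ≥0∞) : 0 ≤ ENNReal.log (1 + x) :=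
  ENNReal.zero_le_log_iff.2 le_self_add

@[simp]
lemma capacity_zero : capacity 0 = 0 := by simp [capacity]

lemma capacity_ofReal {x : ℝ} (hx : 0 ≤ x) :
    capacity (ENNReal.ofReal x) = ENNReal.ofReal (Real.log (1 + x)) := by
  rw [capacity, ← ENNReal.ofReal_one, ← ENNReal.ofReal_add zero_le_one hx,
    ENNReal.log_ofReal_of_pos (by linarith)]
  rfl

lemma capacity_le_self (x : ℝ≥0∞) : capacity x ≤ x := by
  rcases eq_or_ne x ∞ with rfl | hx
  · exact le_top
  · rw [← ENNReal.ofReal_toReal hx, capacity_ofReal ENNReal.toReal_nonneg]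
    refine ENNReal.ofReal_le_ofReal ?_
    have := Real.log_le_sub_one_of_pos (show 0 < 1 + x.toReal by positivity)
    linarith

lemma capacity_le_add_of_le {x y z : ℝ≥0∞} (h : 1 + z ≤ (1 + x) * (1 + y)) :
    capacity z ≤ capacity x + capacity y := by
  rw [capacity, capacity, capacity, ← EReal.toENNReal_add (log_one_add_nonneg x)
    (log_one_add_nonneg y), ← ENNReal.log_mul_add]
  exact EReal.toENNReal_le_toENNReal (ENNReal.log_le_log h)

lemma capacity_mul_le (x y : ℝ≥0∞) : capacity (x * y) ≤ capacity x + capacity y := by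
  refine capacity_le_add_of_le ?_
  rw [show (1 + x) * (1 + y) = (1 + x * y) + (x + y) by ring]
  exact le_self_add

lemma capacity_add_le (x y : ℝ≥0∞) : capacity (x + y) ≤ capacity x + capacity y := by
  refine capacity_le_add_of_le ?_
  rw [show (1 + x) * (1 + y) = (1 + (x + y)) + x * y by ring]
  exact le_self_add

lemma continuous_capacity : Continuous capacity :=
  EReal.continuous_toENNReal.comp (ENNReal.continuous_log.comp (continuous_const_add 1))

lemma capacity_tsum_le (f : ℕ → ℝ≥0∞) : capacity (∑' n, f n) ≤ ∑' n, capacity (f n) := by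
  have h1 : Tendsto (fun n => capacity (∑ i ∈ Finset.range n, f i)) atTop
      (𝓝 (capacity (∑' n, f n))) :=
    (continuous_capacity.tendsto _).comp (ENNReal.tendsto_nat_tsum f)
  refine le_of_tendsto h1 (Eventually.of_forall fun n => ?_)
  refine le_trans ?_ (ENNReal.sum_le_tsum (Finset.range n))
  induction n with
  | zero => simp
  | succ n ih =>
    rw [Finset.sum_range_succ, Finset.sum_range_succ]
    exact (capacity_add_le _ _).trans (by gcongr)

lemma capacity_rpow_le (x : ℝ≥0∞) {p : ℝ} (hp : 1 ≤ p) :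
    capacity (x ^ p) ≤ ENNReal.ofReal p * capacity x := by
  have h : 1 + x ^ p ≤ (1 + x) ^ p := by
    simpa using ENNReal.add_rpow_le_rpow_add 1 x hp
  have h2 : ENNReal.ofReal p * capacity x = (ENNReal.log ((1 + x) ^ p)).toENNReal := by
    rw [ENNReal.log_rpow, EReal.toENNReal_mul (by exact_mod_cast (zero_le_one.trans hp))]
    rfl
  rw [h2]
  exact EReal.toENNReal_le_toENNReal (ENNReal.log_le_log h)

lemma capacity_le_two_mul_sqrt (x : ℝ≥0∞) : capacity x ≤ 2 * x ^ (1 / 2 : ℝ) := by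
  have h : x = (x ^ (1 / 2 : ℝ)) ^ (2 : ℝ) := by
    rw [← ENNReal.rpow_mul]
    norm_num
  calc capacity x = capacity ((x ^ (1 / 2 : ℝ)) ^ (2 : ℝ)) := by rw [← h]
    _ ≤ ENNReal.ofReal 2 * capacity (x ^ (1 / 2 : ℝ)) := capacity_rpow_le _ (by norm_num)
    _ ≤ 2 * x ^ (1 / 2 : ℝ) := by
      rw [ENNReal.ofReal_ofNat]
      gcongr
      exact capacity_le_self _

lemma ofReal_log_le_capacity {x : ℝ} {y : ℝ≥0∞} (hx : 0 < x) (h : ENNReal.ofReal x ≤ y) :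
    ENNReal.ofReal (Real.log x) ≤ capacity y := by
  refine le_trans ?_ (capacity_mono h)
  rw [capacity_ofReal hx.le]
  exact ENNReal.ofReal_le_ofReal (Real.log_le_log hx (by linarith))

/-! ### Exponential fading -/

lemma lintegral_expMeasure_one {f : ℝ → ℝ≥0∞} (hf : Measurable f) :
    ∫⁻ x, f x ∂(expMeasure 1) = ∫⁻ x in Set.Ioi 0, ENNReal.ofReal (Real.exp (-x)) * f x := by
  rw [expMeasure, gammaMeasure, lintegral_withDensity_eq_lintegral_mul _
    (show Measurable (gammaPDF 1 1) from (measurable_gammaPDFReal 1 1).ennreal_ofReal) hf,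
    setLIntegral_congr Ioi_ae_eq_Ici,
    ← lintegral_indicator measurableSet_Ici]
  refine lintegral_congr fun x => ?_
  rw [Pi.mul_apply, gammaPDF, gammaPDFReal, Set.indicator_apply]
  by_cases hx : 0 ≤ x
  · simp [hx]
  · simp [hx]

lemma lintegral_expMeasure_rpow {s : ℝ} (hs : 0 < s) :
    ∫⁻ x, ENNReal.ofReal (x ^ (s - 1)) ∂(expMeasure 1) = ENNReal.ofReal (Real.Gamma s) := by
  rw [lintegral_expMeasure_one (by fun_prop), Real.Gamma_eq_integral hs,
    ofReal_integral_eq_lintegral_ofReal (Real.GammaIntegral_convergent hs)]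
  · refine setLIntegral_congr_fun measurableSet_Ioi fun x _ => ?_
    rw [← ENNReal.ofReal_mul (Real.exp_pos _).le]
  · filter_upwards [ae_restrict_mem measurableSet_Ioi] with x hx
    have : (0 : ℝ) < x := hx
    positivity

lemma lintegral_ofReal_expMeasure : ∫⁻ x, ENNReal.ofReal x ∂(expMeasure 1) = 1 := by
  have h := lintegral_expMeasure_rpow (s := 2) (by norm_num)
  norm_num at h
  exact h

lemma expMeasure_Iio_le (δ : ℝ) : expMeasure 1 (Set.Iio δ) ≤ ENNReal.ofReal δ := by
  rw [← lintegral_indicator_one measurableSet_Iio, lintegral_expMeasure_one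
    (measurable_one.indicator measurableSet_Iio)]
  calc ∫⁻ x in Set.Ioi (0 : ℝ), ENNReal.ofReal (Real.exp (-x)) * (Set.Iio δ).indicator 1 x
      ≤ ∫⁻ x in Set.Ioi (0 : ℝ), (Set.Iio δ).indicator 1 x := by
        refine setLIntegral_mono' measurableSet_Ioi fun x hx => ?_
        have hx' : (0 : ℝ) < x := hx
        refine mul_le_of_le_one_left zero_le (ENNReal.ofReal_le_one.2 ?_)
        exact Real.exp_le_one_iff.2 (by linarith)
    _ = ENNReal.ofReal δ := by
        rw [lintegral_indicator_one measurableSet_Iio, Measure.restrict_apply measurableSet_Iio,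
          Set.Iio_inter_Ioi, Real.volume_Ioo, sub_zero]

/-- The mean of the capacity at the inverse of an exponential variable is finite: the capacity is
at most twice the square root, and the inverse of the square root of an exponential variable
has mean `Γ (1 / 2) = √π ≤ 2`. -/
lemma lintegral_capacity_inv_expMeasure_le :
    ∫⁻ x, capacity (ENNReal.ofReal x)⁻¹ ∂(expMeasure 1) ≤ 4 := by
  have hm : Measurable fun x : ℝ => capacity (ENNReal.ofReal x)⁻¹ :=
    measurable_capacity.comp (by fun_prop)
  have h := lintegral_expMeasure_rpow (s := 1 / 2) (by norm_num)
  rw [Real.Gamma_one_half_eq, lintegral_expMeasure_one (by fun_prop)] at h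
  rw [lintegral_expMeasure_one hm]
  calc ∫⁻ x in Set.Ioi (0 : ℝ), ENNReal.ofReal (Real.exp (-x)) * capacity (ENNReal.ofReal x)⁻¹
      ≤ ∫⁻ x in Set.Ioi (0 : ℝ),
          2 * (ENNReal.ofReal (Real.exp (-x)) * ENNReal.ofReal (x ^ (1 / 2 - 1 : ℝ))) := by
        refine setLIntegral_mono' measurableSet_Ioi fun x hx => ?_
        have hx' : (0 : ℝ) < x := hx
        rw [mul_left_comm]
        gcongr
        refine (capacity_le_two_mul_sqrt _).trans_eq ?_
        rw [← ENNReal.ofReal_inv_of_pos hx', ENNReal.ofReal_rpow_of_pos (by positivity),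
          Real.inv_rpow hx'.le, ← Real.rpow_neg hx'.le]
        norm_num
    _ = 2 * ENNReal.ofReal √Real.pi := by
        rw [lintegral_const_mul _ (by fun_prop), h]
    _ ≤ 2 * ENNReal.ofReal 2 := by
        gcongr
        rw [Real.sqrt_le_left (by norm_num)]
        linarith [Real.pi_le_four]
    _ = 4 := by
        rw [ENNReal.ofReal_ofNat]
        norm_num

/-! ### Integrals over the plane -/

lemma lintegral_exp_neg_mul_sq {c : ℝ} (hc : 0 < c) :
    ∫⁻ y : Plane, ENNReal.ofReal (Real.exp (-(c * ‖y‖ ^ 2))) = ENNReal.ofReal (Real.pi / c) := by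
  have h1 := GaussianFourier.integral_rexp_neg_mul_sq_norm (V := Plane) hc
  simp only [finrank_euclideanSpace, Fintype.card_fin] at h1
  norm_num at h1
  rw [← h1, ofReal_integral_eq_lintegral_ofReal _
    (Eventually.of_forall fun _ => (Real.exp_pos _).le)]
  · by_contra hint
    rw [integral_undef hint] at h1
    have : 0 < Real.pi / c := by positivity
    linarith

lemma setLIntegral_exp_neg_mul_sq_le {c : ℝ} (hc : 0 < c) {R : ℝ} (hR : 0 ≤ R) :
    ∫⁻ y in {y : Plane | R ≤ ‖y‖}, ENNReal.ofReal (Real.exp (-(c * ‖y‖ ^ 2)))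
      ≤ ENNReal.ofReal (2 * Real.pi / c * Real.exp (-(c * R ^ 2 / 2))) := by
  calc ∫⁻ y in {y : Plane | R ≤ ‖y‖}, ENNReal.ofReal (Real.exp (-(c * ‖y‖ ^ 2)))
      ≤ ∫⁻ y in {y : Plane | R ≤ ‖y‖}, ENNReal.ofReal (Real.exp (-(c * R ^ 2 / 2)))
          * ENNReal.ofReal (Real.exp (-(c / 2 * ‖y‖ ^ 2))) := by
        refine setLIntegral_mono' (measurableSet_le measurable_const measurable_norm)
          fun y hy => ?_
        have hy' : R ≤ ‖y‖ := hy
        rw [← ENNReal.ofReal_mul (Real.exp_pos _).le, ← Real.exp_add]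
        gcongr
        nlinarith [mul_le_mul hy' hy' hR (norm_nonneg y)]
    _ ≤ ∫⁻ y : Plane, ENNReal.ofReal (Real.exp (-(c * R ^ 2 / 2)))
          * ENNReal.ofReal (Real.exp (-(c / 2 * ‖y‖ ^ 2))) := setLIntegral_le_lintegral _ _
    _ = _ := by
        rw [lintegral_const_mul _ (by fun_prop), lintegral_exp_neg_mul_sq (by positivity),
          ← ENNReal.ofReal_mul (Real.exp_pos _).le]
        congr 1
        field_simp

lemma lintegral_comp_smul (f : Plane → ℝ≥0∞) (hf : Measurable f) {s : ℝ} (hs : 0 < s) :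
    ∫⁻ y, f (s • y) = ENNReal.ofReal (s ^ 2)⁻¹ * ∫⁻ y, f y := by
  have h := Measure.map_addHaar_smul (volume : Measure Plane) hs.ne'
  rw [finrank_euclideanSpace, Fintype.card_fin, abs_of_pos (by positivity)] at h
  rw [← smul_eq_mul, ← lintegral_smul_measure, ← h, lintegral_map hf (measurable_const_smul s)]

/-- The integral of `‖y‖ ^ (-α)` outside the unit disk. -/
def tailConst (α : ℝ) : ℝ≥0∞ := ∫⁻ y : Plane, {y : Plane | 1 ≤ ‖y‖}.indicator (‖·‖ₑ ^ (-α)) y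

lemma enorm_rpow_neg_eq {α : ℝ} {y : Plane} (hy : 0 < ‖y‖) :
    ‖y‖ₑ ^ (-α) = ENNReal.ofReal (‖y‖ ^ (-α)) := by
  rw [← ofReal_norm, ENNReal.ofReal_rpow_of_pos hy]

lemma tailConst_lt_top {α : ℝ} (hα : 2 < α) : tailConst α < ∞ := by
  have h := finite_integral_one_add_norm (E := Plane) (μ := volume) (r := α)
    (by simpa using hα)
  refine lt_of_le_of_lt ?_ (ENNReal.mul_lt_top (ENNReal.ofReal_lt_top (r := 2 ^ α)) h)
  rw [← lintegral_const_mul _ (by fun_prop)]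
  refine lintegral_mono fun y => ?_
  by_cases hy : 1 ≤ ‖y‖
  · rw [Set.indicator_of_mem (by exact hy), enorm_rpow_neg_eq (by linarith),
      ← ENNReal.ofReal_mul (by positivity)]
    refine ENNReal.ofReal_le_ofReal ?_
    have h1 : (1 + ‖y‖) / 2 ≤ ‖y‖ := by linarith
    calc ‖y‖ ^ (-α) ≤ ((1 + ‖y‖) / 2) ^ (-α) :=
          Real.rpow_le_rpow_of_nonpos (by positivity) h1 (by linarith)
      _ = 2 ^ α * (1 + ‖y‖) ^ (-α) := by
        rw [Real.div_rpow (by positivity) (by norm_num), Real.rpow_neg zero_le_two]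
        field_simp
  · rw [Set.indicator_of_notMem (by exact hy)]
    exact zero_le

lemma setLIntegral_enorm_rpow_neg {α : ℝ} {R : ℝ} (hR : 0 < R) :
    ∫⁻ y in {y : Plane | R ≤ ‖y‖}, ‖y‖ₑ ^ (-α) = ENNReal.ofReal (R ^ (2 - α)) * tailConst α := by
  have hm : Measurable ({y : Plane | 1 ≤ ‖y‖}.indicator (‖·‖ₑ ^ (-α)) : Plane → ℝ≥0∞) :=
    (by fun_prop : Measurable fun y : Plane => ‖y‖ₑ ^ (-α)).indicator
      (measurableSet_le measurable_const measurable_norm)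
  have h := lintegral_comp_smul _ hm (inv_pos.2 hR)
  rw [← lintegral_indicator (measurableSet_le measurable_const measurable_norm)]
  have h1 : ∀ y : Plane, {y : Plane | R ≤ ‖y‖}.indicator (fun y => ‖y‖ₑ ^ (-α)) y
      = ENNReal.ofReal (R ^ (-α))
        * {y : Plane | 1 ≤ ‖y‖}.indicator (‖·‖ₑ ^ (-α)) (R⁻¹ • y) := by
    intro y
    have hn : ‖R⁻¹ • y‖ = R⁻¹ * ‖y‖ := by rw [norm_smul, Real.norm_of_nonneg (by positivity)]
    by_cases hy : R ≤ ‖y‖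
    · have hy1 : 1 ≤ ‖R⁻¹ • y‖ := by
        rw [hn, ← inv_mul_cancel₀ hR.ne']
        gcongr
      rw [Set.indicator_of_mem (by exact hy), Set.indicator_of_mem (by exact hy1)]
      rw [enorm_rpow_neg_eq (by linarith), enorm_rpow_neg_eq (by linarith),
        ← ENNReal.ofReal_mul (by positivity), hn, ← Real.mul_rpow hR.le (by positivity),
        mul_inv_cancel_left₀ hR.ne']
    · have hy1 : ¬ 1 ≤ ‖R⁻¹ • y‖ := by
        rw [hn, not_le, ← inv_mul_cancel₀ hR.ne']
        gcongr
        exact not_le.1 hy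
      rw [Set.indicator_of_notMem (by exact hy), Set.indicator_of_notMem (by exact hy1), mul_zero]
  simp_rw [h1]
  rw [lintegral_const_mul' _ _ ENNReal.ofReal_ne_top, h, ← mul_assoc,
    ← ENNReal.ofReal_mul (by positivity), tailConst]
  congr 2
  rw [sub_eq_add_neg, Real.rpow_add hR, Real.rpow_two, inv_pow, inv_inv, mul_comm]

/-- The mean capacity, over the unit exponential fading, of the signal received from a unit power
transmitter at `z` over unit noise. -/
def fadingCapacity (α : ℝ) (z : Plane) : ℝ≥0∞ :=
  ∫⁻ g, capacity (ENNReal.ofReal g * ‖z‖ₑ ^ (-α)) ∂(expMeasure 1)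

lemma measurable_fadingCapacity (α : ℝ) : Measurable (fadingCapacity α) := by
  have : IsProbabilityMeasure (expMeasure 1) := isProbabilityMeasure_expMeasure one_pos
  refine Measurable.lintegral_prod_right'
    (f := fun p : Plane × ℝ => capacity (ENNReal.ofReal p.2 * ‖p.1‖ₑ ^ (-α))) ?_
  exact measurable_capacity.comp (by fun_prop)

lemma setLIntegral_ball_enorm_inv_lt_top :
    ∫⁻ z in Metric.ball (0 : Plane) 1, ‖z‖ₑ⁻¹ < ∞ := by
  have h := integrableOn_ball_of_norm_le_rpow (E := Plane) (μ := volume) (r := 1) (α := 1)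
    (C := 1) (f := fun z : Plane => ‖z‖⁻¹) (by simp) (by simp)
    (Eventually.of_forall fun z => by simp [Real.rpow_neg_one])
    (by fun_prop)
  refine lt_of_le_of_lt (lintegral_mono_ae ?_) h.2
  have h0 : ∀ᵐ z : Plane, z ≠ 0 := by
    rw [ae_iff]
    simp
  filter_upwards [ae_restrict_of_ae h0] with z hz
  rw [enorm_inv (norm_ne_zero_iff.2 hz), enorm_norm]

/-- The mean capacity of a transmitter is integrable over the plane: near the origin, the path loss
only contributes logarithmically, and far away, the capacity is bounded by the power. -/
lemma lintegral_fadingCapacity_lt_top {α : ℝ} (hα : 2 < α) :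
    ∫⁻ z, fadingCapacity α z < ∞ := by
  have : IsProbabilityMeasure (expMeasure 1) := isProbabilityMeasure_expMeasure one_pos
  rw [← lintegral_add_compl _ (Metric.isOpen_ball (x := (0 : Plane)) (ε := 1)).measurableSet]
  refine ENNReal.add_lt_top.2 ⟨?_, ?_⟩
  · calc ∫⁻ z in Metric.ball 0 1, fadingCapacity α z
        ≤ ∫⁻ z in Metric.ball (0 : Plane) 1, (1 + ENNReal.ofReal α * ‖z‖ₑ⁻¹) := by
          refine lintegral_mono fun z => ?_
          calc fadingCapacity α z
              ≤ ∫⁻ g, (ENNReal.ofReal g + ENNReal.ofReal α * ‖z‖ₑ⁻¹) ∂(expMeasure 1) := by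
                refine lintegral_mono fun g => (capacity_mul_le _ _).trans ?_
                refine add_le_add (capacity_le_self _) ?_
                rw [ENNReal.rpow_neg, ← ENNReal.inv_rpow]
                refine (capacity_rpow_le _ (by linarith)).trans ?_
                gcongr
                exact capacity_le_self _
            _ = 1 + ENNReal.ofReal α * ‖z‖ₑ⁻¹ := by
                rw [lintegral_add_left (by fun_prop), lintegral_ofReal_expMeasure]
                simp
      _ < ∞ := by
          rw [lintegral_add_left (by fun_prop), lintegral_const_mul _ (by fun_prop)]
          refine ENNReal.add_lt_top.2 ⟨?_, ENNReal.mul_lt_top ENNReal.ofReal_lt_top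
            setLIntegral_ball_enorm_inv_lt_top⟩
          simp
  · refine lt_of_le_of_lt ?_ (tailConst_lt_top hα)
    have hset : (Metric.ball (0 : Plane) 1)ᶜ = {y : Plane | 1 ≤ ‖y‖} := by
      ext y
      simp
    rw [hset, tailConst, lintegral_indicator (measurableSet_le measurable_const measurable_norm)]
    refine lintegral_mono fun z => ?_
    calc fadingCapacity α z
        ≤ ∫⁻ g, ENNReal.ofReal g * ‖z‖ₑ ^ (-α) ∂(expMeasure 1) :=
          lintegral_mono fun g => capacity_le_self _
      _ = ‖z‖ₑ ^ (-α) := by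
          rw [lintegral_mul_const _ (by fun_prop), lintegral_ofReal_expMeasure, one_mul]

/-! ### Independence and Campbell sums in the network -/

lemma lintegral_comp_exp {Ω : Type*} [MeasurableSpace Ω] {P : Measure Ω} {g : Ω → ℝ}
    (hg : HasLaw g (expMeasure 1) P) {φ : ℝ → ℝ≥0∞} (hφ : Measurable φ) :
    ∫⁻ ω, φ (g ω) ∂P = ∫⁻ x, φ x ∂(expMeasure 1) :=
  hg.lintegral_comp hφ.aemeasurable

lemma measure_lt_le_of_exp {Ω : Type*} [MeasurableSpace Ω] {P : Measure Ω} {g : Ω → ℝ}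
    (hg : HasLaw g (expMeasure 1) P) (δ : ℝ) : P {ω | g ω < δ} ≤ ENNReal.ofReal δ :=
  (hg.measure_eq (p := fun x => x < δ) measurableSet_Iio).trans_le (expMeasure_Iio_le δ)

lemma measurableSet_associated {E : Type*} [MeasurableSpace E] {ι : Type*} [Countable ι]
    {x : E → ι → Plane} {y : E → Plane} (hx : ∀ i, Measurable fun e => x e i)
    (hy : Measurable y) (i : ι) : MeasurableSet {e | Associated (x e) (y e) i} := by
  simp only [Associated, Set.ofPred_forall]
  exact .iInter fun j => measurableSet_le (hy.dist (hx i)) (hy.dist (hx j))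

namespace Network

variable {Ω : Type*} [MeasurableSpace Ω] {P : Measure Ω} {lamB lamU : ℝ}

/-- The locations of all base stations and of all users. -/
def locations (N : Network P lamB lamU) (ω : Ω) : (ℕ → Plane) × (ℕ → Plane) :=
  (fun n => N.bs n ω, fun m => N.user m ω)

/-- Everything except the fading: the locations and the scheduling priorities. -/
def config (N : Network P lamB lamU) (ω : Ω) : ((ℕ → Plane) × (ℕ → Plane)) × (ℕ → ℝ) :=
  (N.locations ω, fun m => N.priority m ω)

lemma measurable_bs (N : Network P lamB lamU) : Measurable fun ω n => N.bs n ω :=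
  measurable_pi_lambda _ N.bs_poisson.measurable

lemma measurable_user (N : Network P lamB lamU) : Measurable fun ω m => N.user m ω :=
  measurable_pi_lambda _ N.user_poisson.measurable

lemma measurable_locations (N : Network P lamB lamU) : Measurable N.locations :=
  N.measurable_bs.prodMk N.measurable_user

lemma measurable_config (N : Network P lamB lamU) : Measurable N.config :=
  N.measurable_locations.prodMk (measurable_pi_lambda _ N.measurable_priority)

lemma indepFun_user_bs (N : Network P lamB lamU) (m : ℕ) :
    IndepFun (N.user m) (fun ω n => N.bs n ω) P :=
  (N.indep_bs_user.comp measurable_id (measurable_pi_apply m)).symm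

lemma indepFun_locations_bsFading (N : Network P lamB lamU) (n : ℕ) :
    IndepFun N.locations (N.bsFading n) P :=
  N.indep_locations_marks.comp measurable_id (measurable_pi_apply (Sum.inl n))

lemma indepFun_locations_userFading (N : Network P lamB lamU) (m : ℕ) :
    IndepFun N.locations (N.userFading m) P :=
  N.indep_locations_marks.comp measurable_id (measurable_pi_apply (Sum.inr (Sum.inl m)))

lemma indepFun_priority_userFading (N : Network P lamB lamU) (m : ℕ) :
    IndepFun (fun ω k => N.priority k ω) (N.userFading m) P := by
  set f := Sum.elim N.bsFading (Sum.elim N.userFading N.priority)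
  have hf : ∀ i, Measurable (f i) := by
    rintro (n | n | n)
    · exact N.measurable_bsFading n
    · exact N.measurable_userFading n
    · exact N.measurable_priority n
  have h := indep_iSup_of_disjoint (fun i => (hf i).comap_le) N.indep_marks.iIndep
    (S := Set.range fun k => Sum.inr (Sum.inr k)) (T := {Sum.inr (Sum.inl m)})
    (by simp)
  refine indep_of_indep_of_le_left (indep_of_indep_of_le_right h ?_) ?_
  · simp only [Set.mem_singleton_iff, iSup_iSup_eq_left]
    exact le_rfl
  · rw [MeasurableSpace.pi, MeasurableSpace.comap_iSup]
    refine iSup_le fun k => ?_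
    rw [MeasurableSpace.comap_comp]
    exact le_iSup₂_of_le (f := fun i _ => MeasurableSpace.comap (f i) _)
      (Sum.inr (Sum.inr k)) ⟨k, rfl⟩ le_rfl

variable [IsProbabilityMeasure P]

lemma indepFun_config_userFading (N : Network P lamB lamU) (m : ℕ) :
    IndepFun N.config (N.userFading m) P := by
  refine indepFun_prodMk_of_indepFun N.measurable_locations
    (measurable_pi_lambda _ N.measurable_priority) (N.measurable_userFading m) ?_
    (N.indepFun_priority_userFading m)
  exact N.indep_locations_marks.comp (φ := id)
    (ψ := fun x : ℕ ⊕ ℕ ⊕ ℕ → ℝ => ((fun k => x (Sum.inr (Sum.inr k))), x (Sum.inr (Sum.inl m))))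
    measurable_id (by fun_prop)

/-- A bound for the mean number of users `y` beyond distance `R` with no base station within
distance `θ * ‖y‖`. -/
lemma tsum_measure_void_le (N : Network P lamB lamU) (hB : 0 < lamB) (hU : 0 < lamU) {θ R : ℝ}
    (hθ : 0 < θ) (hR : 0 ≤ R) :
    ∑' m, P {ω | R ≤ ‖N.user m ω‖ ∧ ∀ n, θ * ‖N.user m ω‖ ≤ dist (N.user m ω) (N.bs n ω)}
      ≤ ENNReal.ofReal (2 * lamU / (lamB * θ ^ 2)
        * Real.exp (-(lamB * (Real.pi * θ ^ 2) * R ^ 2 / 2))) := by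
  have hC : MeasurableSet {p : Plane × (ℕ → Plane) | R ≤ ‖p.1‖ ∧
      ∀ n, θ * ‖p.1‖ ≤ dist p.1 (p.2 n)} := by
    rw [Set.ofPred_and, Set.ofPred_forall]
    exact (measurableSet_le (by fun_prop) (by fun_prop)).inter
      (.iInter fun n => measurableSet_le (by fun_prop) (by fun_prop))
  have h := N.user_poisson.tsum_lintegral_indepFun N.measurable_bs N.indepFun_user_bs
    (measurable_one.indicator hC)
  have hpi := Real.pi_pos
  calc _ = ∑' m, ∫⁻ ω, {p : Plane × (ℕ → Plane) | R ≤ ‖p.1‖ ∧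
        ∀ n, θ * ‖p.1‖ ≤ dist p.1 (p.2 n)}.indicator 1 (N.user m ω, fun n => N.bs n ω) ∂P := by
        refine tsum_congr fun m => ?_
        exact (lintegral_indicator_one
          (((N.user_poisson.measurable m).prodMk N.measurable_bs) hC)).symm
    _ = ENNReal.ofReal lamU * ∫⁻ y in {y : Plane | R ≤ ‖y‖},
          ENNReal.ofReal (Real.exp (-(lamB * (Real.pi * θ ^ 2) * ‖y‖ ^ 2))) := by
        rw [h, ← lintegral_indicator (measurableSet_le measurable_const measurable_norm)]
        congr 1
        refine lintegral_congr fun y => ?_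
        have hsec : ∫⁻ ω, {p : Plane × (ℕ → Plane) | R ≤ ‖p.1‖ ∧
            ∀ n, θ * ‖p.1‖ ≤ dist p.1 (p.2 n)}.indicator 1 (y, fun n => N.bs n ω) ∂P
            = P {ω | R ≤ ‖y‖ ∧ ∀ n, θ * ‖y‖ ≤ dist y (N.bs n ω)} :=
          lintegral_indicator_one ((measurable_const.prodMk N.measurable_bs) hC)
        rw [hsec]
        by_cases hy : R ≤ ‖y‖
        · rw [Set.indicator_of_mem (by exact hy)]
          simp only [hy, true_and]
          rw [N.bs_poisson.measure_forall_le_dist hB.le y (by positivity)]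
          ring_nf
        · rw [Set.indicator_of_notMem (by exact hy)]
          simp [hy]
    _ ≤ ENNReal.ofReal lamU * ENNReal.ofReal (2 * Real.pi / (lamB * (Real.pi * θ ^ 2))
          * Real.exp (-(lamB * (Real.pi * θ ^ 2) * R ^ 2 / 2))) := by
        gcongr
        exact setLIntegral_exp_neg_mul_sq_le (by positivity) hR
    _ = _ := by
        rw [← ENNReal.ofReal_mul hU.le]
        congr 1
        field_simp

/-- Some user `y` beyond distance `R` has no base station within distance `‖y‖ / 2`. -/
def farUser (N : Network P lamB lamU) (R : ℝ) : Set Ω :=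
  {ω | ∃ m, R ≤ ‖N.user m ω‖ ∧ ∀ n, 2⁻¹ * ‖N.user m ω‖ ≤ dist (N.user m ω) (N.bs n ω)}

lemma measure_farUser_le (N : Network P lamB lamU) (hB : 0 < lamB) (hU : 0 < lamU) {R : ℝ}
    (hR : 0 ≤ R) :
    P (N.farUser R) ≤ ENNReal.ofReal (8 * (lamU / lamB)
      * Real.exp (-(lamB * Real.pi * R ^ 2 / 8))) := by
  rw [farUser, Set.ofPred_exists]
  refine (measure_iUnion_le _).trans ((N.tsum_measure_void_le hB hU (θ := 2⁻¹)
    (by norm_num) hR).trans_eq ?_)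
  congr 1
  have : lamB * (Real.pi * 2⁻¹ ^ 2) * R ^ 2 / 2 = lamB * Real.pi * R ^ 2 / 8 := by ring
  rw [this]
  congr 1
  field_simp
  norm_num

end Network

lemma enorm_smul_rpow_neg (α : ℝ) {s : ℝ} (hs : 0 < s) (y : Plane) :
    ‖s • y‖ₑ ^ (-α) = ENNReal.ofReal (s ^ (-α)) * ‖y‖ₑ ^ (-α) := by
  rw [enorm_smul, Real.enorm_of_nonneg hs.le, ← ENNReal.ofReal_rpow_of_pos hs]
  have h0 : ENNReal.ofReal s ≠ 0 := by simpa using hs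
  by_cases hy : ‖y‖ₑ = 0
  · rcases lt_trichotomy (-α) 0 with h | h | h
    · rw [hy, mul_zero, ENNReal.zero_rpow_of_neg h, ENNReal.mul_top]
      rw [ENNReal.ofReal_rpow_of_pos hs, Ne, ENNReal.ofReal_eq_zero, not_le]
      positivity
    · rw [h]
      simp
    · rw [hy, mul_zero, ENNReal.zero_rpow_of_pos h, mul_zero]
  · exact ENNReal.mul_rpow_of_ne_zero h0 hy _

lemma receivedPower_eq (α p g : ℝ) (z : Plane) :
    receivedPower α p g z = ENNReal.ofReal p * (ENNReal.ofReal g * ‖z‖ₑ ^ (-α)) := by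
  rw [receivedPower, edist_zero_right, mul_assoc]

/-- The capacities of all transmitters of a Poisson process, each one on its own and measured
against the noise level `s ^ α`, have a finite mean sum. This bounds the contribution of the
signal, whichever transmitters carry it. -/
lemma tsum_lintegral_capacity {Ω : Type*} [MeasurableSpace Ω] {P : Measure Ω}
    [IsProbabilityMeasure P] {lam : ℝ} {Y : ℕ → Ω → Plane} (hY : IsPoissonProcess P lam Y)
    {g : ℕ → Ω → ℝ} (hgm : ∀ m, Measurable (g m)) (hg : ∀ m, HasLaw (g m) (expMeasure 1) P)
    (hYg : ∀ m, IndepFun (Y m) (g m) P) (α : ℝ) {s : ℝ} (hs : 0 < s) :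
    ∑' m, ∫⁻ ω, capacity (ENNReal.ofReal (g m ω) * ‖s • Y m ω‖ₑ ^ (-α)) ∂P
      = ENNReal.ofReal lam * (ENNReal.ofReal (s ^ 2)⁻¹ * ∫⁻ z, fadingCapacity α z) := by
  rw [← lintegral_comp_smul _ (measurable_fadingCapacity α) hs,
    ← hY.tsum_lintegral (f := fun y => fadingCapacity α (s • y))
      ((measurable_fadingCapacity α).comp (measurable_const_smul s))]
  refine tsum_congr fun m => ?_
  have hm : Measurable fun p : Plane × ℝ =>
      capacity (ENNReal.ofReal p.2 * ‖s • p.1‖ₑ ^ (-α)) :=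
    measurable_capacity.comp (by fun_prop)
  rw [lintegral_indepFun (hY.measurable m) (hgm m) (hYg m) hm,
    lintegral_map _ (hY.measurable m)]
  · refine lintegral_congr fun ω => ?_
    exact lintegral_comp_exp (hg m) (hm.comp measurable_prodMk_left)
  · exact Measurable.lintegral_prod_right' (f := fun p : Plane × Ω =>
      capacity (ENNReal.ofReal (g m p.2) * ‖s • p.1‖ₑ ^ (-α)))
      (measurable_capacity.comp (by have := hgm m; fun_prop))

lemma capacity_rpow_le_sqrt {α : ℝ} (hα : 1 ≤ α) (k : ℕ) :
    capacity (ENNReal.ofReal (6 * k) ^ α) ≤ ENNReal.ofReal (6 * α * √k) := by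
  refine (capacity_rpow_le _ hα).trans ?_
  have h : capacity (ENNReal.ofReal (6 * k)) ≤ ENNReal.ofReal (6 * √k) := by
    refine (capacity_le_two_mul_sqrt _).trans ?_
    rw [ENNReal.ofReal_rpow_of_nonneg (by positivity) (by norm_num), ← Real.sqrt_eq_rpow,
      ← ENNReal.ofReal_ofNat 2, ← ENNReal.ofReal_mul (by norm_num)]
    refine ENNReal.ofReal_le_ofReal ?_
    have h6 : √(6 : ℝ) ≤ 3 := Real.sqrt_le_iff.2 (by norm_num)
    rw [Real.sqrt_mul (by norm_num)]
    nlinarith [Real.sqrt_nonneg (k : ℝ)]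
  calc ENNReal.ofReal α * capacity (ENNReal.ofReal (6 * k))
      ≤ ENNReal.ofReal α * ENNReal.ofReal (6 * √k) := by gcongr
    _ = _ := by
      rw [← ENNReal.ofReal_mul (by linarith)]
      ring_nf

/-- The logarithmic moment of the inverse interference `J⁻¹`. Suppose that, with exponentially small
failure probability in `k`, an interferer at (scaled) distance at most `6 * k` can be selected
regardless of the fading. Then the capacity at `J⁻¹` is integrable over any event `L ⁻¹' V` that
does not depend on the fading. The cutoff `k₀` is free: with interferers within
distance `6 * k₀`, the bound is proportional to the probability of the event, and the remainder
is exponentially small in `k₀`. -/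
lemma setLIntegral_capacity_inv_le {Ω : Type*} [MeasurableSpace Ω] {P : Measure Ω}
    {E : Type*} [MeasurableSpace E] {L : Ω → E} (hL : Measurable L) {g : ℕ → Ω → ℝ}
    (hgm : ∀ n, Measurable (g n)) (hg : ∀ n, HasLaw (g n) (expMeasure 1) P)
    (hLg : ∀ n, IndepFun L (g n) P) {α : ℝ} (hα : 1 ≤ α) {J : Ω → ℝ≥0∞}
    {C : ℕ → ℕ → Set E} (hC : ∀ k n, MeasurableSet (C k n))
    (hJ : ∀ k n ω, L ω ∈ C k n →
      ENNReal.ofReal (g n ω) * ENNReal.ofReal (6 * k) ^ (-α) ≤ J ω)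
    (htail : ∀ k : ℕ, 1 ≤ k →
      P (L ⁻¹' (⋃ n, C k n)ᶜ) ≤ ENNReal.ofReal (3 * Real.exp (-(2 * k))))
    {V : Set E} (hV : MeasurableSet V) {k₀ : ℕ} (hk₀ : 1 ≤ k₀) :
    ∫⁻ ω in L ⁻¹' V, capacity (J ω)⁻¹ ∂P
      ≤ ENNReal.ofReal (4 + 6 * α * √k₀) * P (L ⁻¹' V)
        + ENNReal.ofReal (6 * (4 + 6 * α) * Real.exp (-k₀)) := by
  set U : ℕ → Set E := fun k => ⋃ n, C k n with hU
  have hUm : ∀ k, MeasurableSet (U k) := fun k => .iUnion (hC k)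
  have hα0 : (0 : ℝ) < α := by linarith
  -- the bound over events on which an interferer within distance `6 * k` can be selected
  have hsel : ∀ (k : ℕ), 1 ≤ k → ∀ W : Set E, MeasurableSet W →
      ∫⁻ ω in L ⁻¹' (W ∩ U k), capacity (J ω)⁻¹ ∂P
        ≤ ENNReal.ofReal (4 + 6 * α * √k) * P (L ⁻¹' (W ∩ U k)) := by
    intro k hk W hW
    refine setLIntegral_le_of_selection hL hgm hLg (hC k)
      (φ := fun x => capacity (ENNReal.ofReal x)⁻¹ + ENNReal.ofReal (6 * α * √k)) ?_ ?_ hW ?_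
    · exact (measurable_capacity.comp (by fun_prop)).add_const _
    · intro n
      have hm : Measurable fun x : ℝ => capacity (ENNReal.ofReal x)⁻¹ :=
        measurable_capacity.comp (by fun_prop)
      rw [lintegral_comp_exp (hg n) (hm.add_const _), lintegral_add_left hm]
      have : IsProbabilityMeasure (expMeasure 1) := isProbabilityMeasure_expMeasure one_pos
      rw [lintegral_const, measure_univ, mul_one, ENNReal.ofReal_add (by norm_num) (by positivity)]
      gcongr
      rw [ENNReal.ofReal_ofNat]
      exact lintegral_capacity_inv_expMeasure_le
    · intro n ω hω
      have h1 : (J ω)⁻¹ ≤ (ENNReal.ofReal (g n ω))⁻¹ * ENNReal.ofReal (6 * k) ^ α := by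
        refine (ENNReal.inv_le_inv.2 (hJ k n ω hω)).trans_eq ?_
        have hk0 : ENNReal.ofReal (6 * k) ≠ 0 := by
          have : (0 : ℝ) < k := by exact_mod_cast hk
          rw [Ne, ENNReal.ofReal_eq_zero, not_le]
          positivity
        rw [ENNReal.mul_inv, ENNReal.rpow_neg, inv_inv]
        · exact Or.inr (ENNReal.rpow_ne_top_of_ne_zero hk0 ENNReal.ofReal_ne_top)
        · exact Or.inl ENNReal.ofReal_ne_top
      refine (capacity_mono h1).trans ((capacity_mul_le _ _).trans ?_)
      gcongr
      exact capacity_rpow_le_sqrt hα k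
  have hnull : P (L ⁻¹' ⋂ j : ℕ, (U (k₀ + j))ᶜ) = 0 := by
    refine le_antisymm (ge_of_tendsto' (x := atTop)
      (f := fun j : ℕ => ENNReal.ofReal (3 * Real.exp (-(2 * ((k₀ + j : ℕ) : ℝ)))))
        ?_ fun j => ?_) zero_le
    · rw [← ENNReal.ofReal_zero, ← mul_zero (3 : ℝ)]
      have h1 : Tendsto (fun j : ℕ => ((k₀ + j : ℕ) : ℝ)) atTop atTop :=
        tendsto_natCast_atTop_atTop.comp
          (tendsto_atTop_mono (fun j => Nat.le_add_left j k₀) tendsto_id)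
      exact ENNReal.tendsto_ofReal (Tendsto.const_mul 3
        (Real.tendsto_exp_neg_atTop_nhds_zero.comp (Tendsto.const_mul_atTop two_pos h1)))
    · exact (measure_mono (Set.preimage_mono (Set.iInter_subset _ j))).trans
        (htail _ (by omega))
  have hcover : L ⁻¹' V ⊆ L ⁻¹' (V ∩ U k₀) ∪ ((⋃ j : ℕ, L ⁻¹' ((U (k₀ + j))ᶜ ∩ U (k₀ + j + 1)))
      ∪ L ⁻¹' ⋂ j : ℕ, (U (k₀ + j))ᶜ) := by
    intro ω hω
    by_cases h0 : L ω ∈ U k₀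
    · exact Or.inl ⟨hω, h0⟩
    right
    by_cases hall : ∀ j : ℕ, L ω ∉ U (k₀ + j)
    · exact Or.inr (Set.mem_iInter.2 hall)
    · push Not at hall
      classical
      left
      have hne : Nat.find hall ≠ 0 := by
        intro h
        have := Nat.find_spec hall
        rw [h] at this
        exact h0 this
      obtain ⟨i, hi⟩ := Nat.exists_eq_succ_of_ne_zero hne
      refine Set.mem_iUnion.2 ⟨i, Nat.find_min hall (m := i) (by omega), ?_⟩
      have := Nat.find_spec hall
      rwa [hi] at this
  refine (lintegral_mono_set hcover).trans ((lintegral_union_le _ _ _).trans ?_)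
  refine add_le_add ((hsel k₀ hk₀ V hV).trans (by gcongr; exact Set.inter_subset_left)) ?_
  refine (lintegral_union_le _ _ _).trans ?_
  rw [setLIntegral_measure_zero _ _ hnull, add_zero]
  refine (lintegral_iUnion_le _ _).trans ?_
  have hterm : ∀ j : ℕ, ∫⁻ ω in L ⁻¹' ((U (k₀ + j))ᶜ ∩ U (k₀ + j + 1)), capacity (J ω)⁻¹ ∂P
      ≤ ENNReal.ofReal (3 * (4 + 6 * α) * Real.exp (-k₀)) * ENNReal.ofReal (Real.exp (-j)) := by
    intro j
    refine (hsel (k₀ + j + 1) (by omega) _ (hUm _).compl).trans ?_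
    refine (mul_le_mul_right ((measure_mono (Set.preimage_mono Set.inter_subset_left)).trans
      (htail (k₀ + j) (by omega))) _).trans ?_
    rw [← ENNReal.ofReal_mul (by positivity), ← ENNReal.ofReal_mul (by positivity)]
    refine ENNReal.ofReal_le_ofReal ?_
    set x : ℝ := ((k₀ + j : ℕ) : ℝ) with hx
    have hx0 : 0 ≤ x := Nat.cast_nonneg _
    have h1 : √((k₀ + j + 1 : ℕ) : ℝ) ≤ Real.exp x := by
      have h2 : (((k₀ + j + 1 : ℕ) : ℝ)) = x + 1 := by rw [hx]; push_cast; ring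
      rw [h2, Real.sqrt_le_left (Real.exp_pos x).le]
      nlinarith [Real.add_one_le_exp x]
    have h3 : Real.exp (-(2 * x)) = Real.exp (-x) * Real.exp (-x) := by
      rw [← Real.exp_add]; ring_nf
    have h4 : Real.exp (-k₀) * Real.exp (-j) = Real.exp (-x) := by
      rw [← Real.exp_add, hx]; push_cast; ring_nf
    have h5 : Real.exp x * Real.exp (-x) = 1 := by rw [← Real.exp_add]; simp
    have h6 : 1 ≤ Real.exp x := Real.one_le_exp hx0
    rw [h3, mul_assoc _ (Real.exp (-k₀)), h4]
    have h7 : 4 + 6 * α * √((k₀ + j + 1 : ℕ) : ℝ) ≤ (4 + 6 * α) * Real.exp x := by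
      nlinarith [mul_le_mul_of_nonneg_left h1 hα0.le]
    calc (4 + 6 * α * √((k₀ + j + 1 : ℕ) : ℝ)) * (3 * (Real.exp (-x) * Real.exp (-x)))
        ≤ ((4 + 6 * α) * Real.exp x) * (3 * (Real.exp (-x) * Real.exp (-x))) := by gcongr
      _ = 3 * (4 + 6 * α) * Real.exp (-x) * (Real.exp x * Real.exp (-x)) := by ring
      _ = _ := by rw [h5, mul_one]
  refine (ENNReal.tsum_le_tsum hterm).trans ?_
  rw [ENNReal.tsum_mul_left]
  refine (mul_le_mul_right tsum_ofReal_exp_neg_le _).trans_eq ?_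
  rw [← ENNReal.ofReal_ofNat 2, ← ENNReal.ofReal_mul (by positivity)]
  ring_nf

/-! ### The normalized signal-to-interference ratio -/

/-- Total power received at the origin, in units in which distances are multiplied by `s`, from the
unit power transmitters at `z n` with fading powers `g n`, for `n ∈ A`. -/
def scaledPower (α s : ℝ) (g : ℕ → ℝ) (z : ℕ → Plane) (A : Set ℕ) : ℝ≥0∞ :=
  ∑' n : A, ENNReal.ofReal (g n) * ‖s • z n‖ₑ ^ (-α)

lemma tsum_receivedPower_div (α : ℝ) {p lam mu : ℝ} (hp : 0 < p) (hlam : 0 < lam) (hmu : 0 < mu)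
    (g : ℕ → ℝ) (z : ℕ → Plane) (A B : Set ℕ) :
    (∑' n : A, receivedPower α p (g n) (z n)) / (∑' n : B, receivedPower α p (g n) (z n))
      = ENNReal.ofReal ((lam / mu) ^ (α / 2))
        * (scaledPower α √lam g z A * (scaledPower α √mu g z B)⁻¹) := by
  have hs := Real.sqrt_pos.2 hlam
  have ht := Real.sqrt_pos.2 hmu
  have h (s : ℝ) (hs : 0 < s) (A : Set ℕ) : scaledPower α s g z A
      = ENNReal.ofReal (s ^ (-α)) * ∑' n : A, ENNReal.ofReal (g n) * ‖z n‖ₑ ^ (-α) := by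
    rw [scaledPower, ← ENNReal.tsum_mul_left]
    refine tsum_congr fun n => ?_
    rw [enorm_smul_rpow_neg α hs, mul_left_comm]
  have hne (s : ℝ) (hs : 0 < s) : ENNReal.ofReal (s ^ (-α)) ≠ 0 := by
    rw [Ne, ENNReal.ofReal_eq_zero, not_le]
    positivity
  simp_rw [receivedPower_eq, ENNReal.tsum_mul_left]
  rw [ENNReal.mul_div_mul_left _ _ (by simpa using hp) ENNReal.ofReal_ne_top, h _ hs, h _ ht,
    ENNReal.mul_inv (Or.inl (hne _ ht)) (Or.inl ENNReal.ofReal_ne_top), div_eq_mul_inv]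
  set S := ∑' n : A, ENNReal.ofReal (g n) * ‖z n‖ₑ ^ (-α)
  set I := ∑' n : B, ENNReal.ofReal (g n) * ‖z n‖ₑ ^ (-α)
  have hone : ENNReal.ofReal ((lam / mu) ^ (α / 2)) * ENNReal.ofReal (√lam ^ (-α))
      * (ENNReal.ofReal (√mu ^ (-α)))⁻¹ = 1 := by
    rw [← ENNReal.ofReal_inv_of_pos (by positivity), ← ENNReal.ofReal_mul (by positivity),
      ← ENNReal.ofReal_mul (by positivity), ← ENNReal.ofReal_one]
    congr 1
    rw [Real.sqrt_eq_rpow, Real.sqrt_eq_rpow, ← Real.rpow_mul hlam.le, ← Real.rpow_mul hmu.le,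
      Real.div_rpow hlam.le hmu.le, show 1 / 2 * -α = -(α / 2) by ring, Real.rpow_neg hlam.le,
      Real.rpow_neg hmu.le]
    have := (Real.rpow_pos_of_pos hlam (α / 2)).ne'
    have := (Real.rpow_pos_of_pos hmu (α / 2)).ne'
    field_simp
  calc S * I⁻¹ = (ENNReal.ofReal ((lam / mu) ^ (α / 2)) * ENNReal.ofReal (√lam ^ (-α))
      * (ENNReal.ofReal (√mu ^ (-α)))⁻¹) * (S * I⁻¹) := by rw [hone, one_mul]
    _ = _ := by ring

lemma capacity_scaledPower_le (α s : ℝ) (g : ℕ → ℝ) (z : ℕ → Plane) (A : Set ℕ) :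
    capacity (scaledPower α s g z A)
      ≤ ∑' n, capacity (ENNReal.ofReal (g n) * ‖s • z n‖ₑ ^ (-α)) :=
  (capacity_mono (ENNReal.tsum_comp_le_tsum_of_injective Subtype.val_injective _)).trans
    (capacity_tsum_le _)

lemma le_scaledPower {α s : ℝ} (hα : 0 ≤ α) (hs : 0 ≤ s) {g : ℕ → ℝ} {z : ℕ → Plane}
    {A : Set ℕ} {n : ℕ} (hn : n ∈ A) {d : ℝ} (hd : s * ‖z n‖ ≤ d) :
    ENNReal.ofReal (g n) * ENNReal.ofReal d ^ (-α) ≤ scaledPower α s g z A := by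
  refine le_trans ?_ (ENNReal.le_tsum (⟨n, hn⟩ : A))
  refine mul_le_mul' le_rfl ?_
  rw [ENNReal.rpow_neg, ENNReal.rpow_neg]
  refine ENNReal.inv_le_inv.2 (ENNReal.rpow_le_rpow ?_ hα)
  rw [← ofReal_norm, norm_smul, Real.norm_of_nonneg hs]
  exact ENNReal.ofReal_le_ofReal hd

lemma le_capacity_of_bounds {x s j : ℝ} {S J : ℝ≥0∞} (hx : 0 < x) (hs : 0 < s) (hj : 0 < j)
    (hS : ENNReal.ofReal s ≤ S) (hJ : J ≤ ENNReal.ofReal j) :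
    ENNReal.ofReal (Real.log (x * (s / j))) ≤ capacity (ENNReal.ofReal x * (S * J⁻¹)) := by
  refine ofReal_log_le_capacity (by positivity) ?_
  rw [ENNReal.ofReal_mul hx.le, div_eq_mul_inv, ENNReal.ofReal_mul hs.le,
    ENNReal.ofReal_inv_of_pos hj]
  gcongr

section Bounds

variable {Ω : Type*} [MeasurableSpace Ω] {P : Measure Ω} [IsProbabilityMeasure P]

/-- Splitting of the mean capacity on an event into the contributions of the deterministic
factor, of the signal and of the interference. -/
lemma setLIntegral_capacity_le {lam α s : ℝ} (hs : 0 < s) {Y : ℕ → Ω → Plane}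
    (hY : IsPoissonProcess P lam Y) {g : ℕ → Ω → ℝ} (hgm : ∀ m, Measurable (g m))
    (hg : ∀ m, HasLaw (g m) (expMeasure 1) P) (hYg : ∀ m, IndepFun (Y m) (g m) P)
    (A : Ω → Set ℕ) (x : ℝ≥0∞) (J : Ω → ℝ≥0∞) (V : Set Ω) :
    ∫⁻ ω in V, capacity (x * (scaledPower α s (fun n => g n ω) (fun n => Y n ω) (A ω)
        * (J ω)⁻¹)) ∂P
      ≤ capacity x * P V
        + ENNReal.ofReal lam * (ENNReal.ofReal (s ^ 2)⁻¹ * ∫⁻ z, fadingCapacity α z)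
        + ∫⁻ ω in V, capacity (J ω)⁻¹ ∂P := by
  have hm (n : ℕ) : Measurable fun ω =>
      capacity (ENNReal.ofReal (g n ω) * ‖s • Y n ω‖ₑ ^ (-α)) := by
    have := hgm n
    have := hY.measurable n
    exact measurable_capacity.comp (by fun_prop)
  calc ∫⁻ ω in V, capacity (x * (scaledPower α s (fun n => g n ω) (fun n => Y n ω) (A ω)
        * (J ω)⁻¹)) ∂P
      ≤ ∫⁻ ω in V, (capacity x + ∑' n, capacity (ENNReal.ofReal (g n ω) * ‖s • Y n ω‖ₑ ^ (-α))
          + capacity (J ω)⁻¹) ∂P := by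
        refine lintegral_mono fun ω => ?_
        refine (capacity_mul_le _ _).trans ?_
        rw [add_assoc]
        gcongr
        exact (capacity_mul_le _ _).trans (by gcongr; exact capacity_scaledPower_le _ _ _ _ _)
    _ = capacity x * P V
          + ∑' n, ∫⁻ ω in V, capacity (ENNReal.ofReal (g n ω) * ‖s • Y n ω‖ₑ ^ (-α)) ∂P
          + ∫⁻ ω in V, capacity (J ω)⁻¹ ∂P := by
        have hsum : Measurable fun ω => capacity x
            + ∑' n, capacity (ENNReal.ofReal (g n ω) * ‖s • Y n ω‖ₑ ^ (-α)) :=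
          measurable_const.add (Measurable.tsum hm)
        rw [lintegral_add_left hsum,
          lintegral_add_left measurable_const, setLIntegral_const,
          lintegral_tsum fun n => (hm n).aemeasurable]
    _ ≤ _ := by
        rw [← tsum_lintegral_capacity hY hgm hg hYg α hs]
        gcongr
        exact Measure.restrict_le_self

omit [IsProbabilityMeasure P] in
lemma lintegral_fading_mul {E : Type*} [MeasurableSpace E] {L : Ω → E} (hL : Measurable L)
    {g : Ω → ℝ} (hgm : Measurable g) (hg : HasLaw g (expMeasure 1) P) (hLg : IndepFun L g P)
    {h : E → ℝ≥0∞} (hh : Measurable h) :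
    ∫⁻ ω, ENNReal.ofReal (g ω) * h (L ω) ∂P = ∫⁻ ω, h (L ω) ∂P := by
  have := lintegral_mul_eq_lintegral_mul_lintegral_of_indepFun
    (f := ENNReal.ofReal ∘ g) (g := h ∘ L) (μ := P)
    (ENNReal.measurable_ofReal.comp hgm) (hh.comp hL)
    (hLg.symm.comp ENNReal.measurable_ofReal hh)
  refine this.trans ?_
  have h1 : ∫⁻ ω, (ENNReal.ofReal ∘ g) ω ∂P = 1 :=
    (lintegral_comp_exp hg ENNReal.measurable_ofReal).trans lintegral_ofReal_expMeasure
  rw [h1, one_mul]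
  rfl

lemma mul_one_sub_le_lintegral {f : Ω → ℝ≥0∞} {T : Set Ω} {c δ : ℝ≥0∞} (hf : ∀ ω, ω ∉ T → c ≤ f ω)
    (hT : P T ≤ δ) : c * (1 - δ) ≤ ∫⁻ ω, f ω ∂P := by
  have hm := measurableSet_toMeasurable P T
  calc c * (1 - δ) ≤ c * P (toMeasurable P T)ᶜ := by
        rw [prob_compl_eq_one_sub hm, measure_toMeasurable]
        gcongr
    _ = ∫⁻ _ in (toMeasurable P T)ᶜ, c ∂P := (setLIntegral_const _ _).symm
    _ ≤ ∫⁻ ω in (toMeasurable P T)ᶜ, f ω ∂P :=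
        setLIntegral_mono' hm.compl fun ω hω => hf ω fun h => hω (subset_toMeasurable P T h)
    _ ≤ ∫⁻ ω, f ω ∂P := setLIntegral_le_lintegral _ _

omit [IsProbabilityMeasure P] in
lemma IsPoissonProcess.measure_annulus_void {lam : ℝ} {Y : ℕ → Ω → Plane}
    (hY : IsPoissonProcess P lam Y) (hlam : 0 ≤ lam) {r : ℝ} (hr : 0 ≤ r) :
    P {ω | ∀ m, Y m ω ∉ Metric.ball 0 (2 * r) \ Metric.ball 0 r}
      = ENNReal.ofReal (Real.exp (-(lam * (3 * Real.pi * r ^ 2)))) := by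
  have hfin : volume (Metric.ball (0 : Plane) (2 * r) \ Metric.ball 0 r) ≠ ∞ :=
    ne_top_of_le_ne_top measure_ball_lt_top.ne (measure_mono Set.sdiff_subset)
  rw [hY.measure_forall_notMem hlam (Metric.isOpen_ball.measurableSet.diff
    Metric.isOpen_ball.measurableSet) hfin, measure_sdiff (Metric.ball_subset_ball (by linarith))
    Metric.isOpen_ball.measurableSet.nullMeasurableSet measure_ball_lt_top.ne,
    volume_ball _ (by linarith), volume_ball _ hr, ← ENNReal.ofReal_sub _ (by positivity),
    ENNReal.toReal_ofReal]
  · ring_nf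
  · have := Real.pi_pos
    nlinarith [mul_nonneg this.le (sq_nonneg r)]

end Bounds

namespace Network

/-! ### Upper bound for the downlink -/

variable {Ω : Type*} [MeasurableSpace Ω] {P : Measure Ω} {lamB lamU : ℝ}

/-- The base stations that interfere in the downlink when the base stations are at `p.1` and the
users at `p.2`. -/
def dlInterferer (p : (ℕ → Plane) × (ℕ → Plane)) : Set ℕ :=
  {n | ¬ Associated p.1 0 n ∧ ∃ m, Associated p.1 (p.2 m) n}

lemma measurableSet_mem_dlInterferer (n : ℕ) :
    MeasurableSet {p : (ℕ → Plane) × (ℕ → Plane) | n ∈ dlInterferer p} := by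
  change MeasurableSet {p : (ℕ → Plane) × (ℕ → Plane) |
    ¬ Associated p.1 0 n ∧ ∃ m, Associated p.1 (p.2 m) n}
  rw [Set.ofPred_and, Set.ofPred_exists]
  refine (measurableSet_associated (x := Prod.fst) (by fun_prop)
    measurable_const n).compl.inter (.iUnion fun m => ?_)
  exact measurableSet_associated (x := Prod.fst)
    (y := fun p : (ℕ → Plane) × (ℕ → Plane) => p.2 m) (by fun_prop)
    (by fun_prop) n

/-- The normalized interference in the downlink. -/
def dlScaledInterference (N : Network P lamB lamU) (α : ℝ) (ω : Ω) : ℝ≥0∞ :=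
  scaledPower α √lamU (fun n => N.bsFading n ω) (fun n => N.bs n ω) (dlInterferer (N.locations ω))

lemma dlSE_eq (N : Network P lamB lamU) (hB : 0 < lamB) (hU : 0 < lamU) (α : ℝ) {p : ℝ}
    (hp : 0 < p) :
    N.dlSE α p = ∫⁻ ω, capacity (ENNReal.ofReal ((lamB / lamU) ^ (α / 2))
      * (scaledPower α √lamB (fun n => N.bsFading n ω) (fun n => N.bs n ω)
        {n | Associated (fun k => N.bs k ω) 0 n} * (N.dlScaledInterference α ω)⁻¹)) ∂P := by
  refine lintegral_congr fun ω => congrArg capacity ?_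
  exact tsum_receivedPower_div α hp hB hU (fun n => N.bsFading n ω) (fun n => N.bs n ω) _ _

/-- A user has a base station closer than half of its own distance to the origin unless it
is a far user; the nearest one is then about as far from the origin as the user. -/
lemma norm_le_of_associated (N : Network P lamB lamU) {R : ℝ} {ω : Ω} (hfar : ω ∉ N.farUser R)
    {m : ℕ} (hm : R ≤ ‖N.user m ω‖) {n : ℕ}
    (hn : Associated (fun k => N.bs k ω) (N.user m ω) n) :
    dist (N.user m ω) (N.bs n ω) < 2⁻¹ * ‖N.user m ω‖ ∧
      2⁻¹ * ‖N.user m ω‖ < ‖N.bs n ω‖ ∧ ‖N.bs n ω‖ < 3 / 2 * ‖N.user m ω‖ := by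
  have h : ∃ j, dist (N.user m ω) (N.bs j ω) < 2⁻¹ * ‖N.user m ω‖ := by
    by_contra! h
    exact hfar ⟨m, hm, h⟩
  obtain ⟨j, hj⟩ := h
  have h1 : dist (N.user m ω) (N.bs n ω) < 2⁻¹ * ‖N.user m ω‖ := (hn j).trans_lt hj
  have h2 := dist_triangle (N.user m ω) (N.bs n ω) 0
  have h3 := dist_triangle_left (N.bs n ω) 0 (N.user m ω)
  rw [dist_zero_right, dist_zero_right] at h2 h3
  exact ⟨h1, by linarith, by linarith⟩

variable [IsProbabilityMeasure P]

lemma ratio_mul_sq {lamB lamU : ℝ} (hU : 0 < lamU) (k : ℝ) :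
    lamB * (k / √lamU) ^ 2 = lamB / lamU * k ^ 2 := by
  rw [div_pow, Real.sq_sqrt hU.le]
  ring

/-- Up to an exponentially small probability, there is a user at scaled distance between `k` and
`2 * k`, and no far user beyond scaled distance `k`. -/
lemma measure_annulus_void_union_farUser_le (N : Network P lamB lamU) (hB : 0 < lamB)
    (hU : 0 < lamU) (hρ : 16 ≤ lamB / lamU) {k : ℕ} (hk : 1 ≤ k) :
    P ({ω | ∀ m, N.user m ω ∉ Metric.ball 0 (2 * (k / √lamU)) \ Metric.ball 0 (k / √lamU)}
        ∪ N.farUser (k / √lamU)) ≤ ENNReal.ofReal (2 * Real.exp (-(2 * k))) := by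
  have hk' : (1 : ℝ) ≤ k := by exact_mod_cast hk
  have hsU := Real.sqrt_pos.2 hU
  have hpi := Real.pi_gt_three
  have hUr : lamU * (k / √lamU) ^ 2 = k ^ 2 := by
    rw [ratio_mul_sq hU, div_self hU.ne', one_mul]
  have hBk : 16 * (k : ℝ) ^ 2 ≤ lamB * (k / √lamU) ^ 2 := by rw [ratio_mul_sq hU]; gcongr
  set r : ℝ := k / √lamU
  have hr0 : 0 < r := by positivity
  have hkk : (k : ℝ) ≤ k ^ 2 := by nlinarith
  have h1 : P {ω | ∀ m, N.user m ω ∉ Metric.ball 0 (2 * r) \ Metric.ball 0 r}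
      ≤ ENNReal.ofReal (Real.exp (-(2 * k))) := by
    rw [N.user_poisson.measure_annulus_void hU.le hr0.le]
    refine ENNReal.ofReal_le_ofReal (Real.exp_le_exp.2 ?_)
    rw [show lamU * (3 * Real.pi * r ^ 2) = 3 * Real.pi * (lamU * r ^ 2) by ring, hUr]
    nlinarith
  have h2 : P (N.farUser r) ≤ ENNReal.ofReal (Real.exp (-(2 * k))) := by
    refine (N.measure_farUser_le hB hU hr0.le).trans (ENNReal.ofReal_le_ofReal ?_)
    have h3 : 8 * (lamU / lamB) ≤ 1 := by
      rw [le_div_iff₀ hU] at hρ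
      rw [← mul_div_assoc, div_le_one hB]
      linarith
    have h4 : Real.exp (-(lamB * Real.pi * r ^ 2 / 8)) ≤ Real.exp (-(2 * k)) := by
      refine Real.exp_le_exp.2 ?_
      rw [show lamB * Real.pi * r ^ 2 / 8 = Real.pi / 8 * (lamB * r ^ 2) by ring]
      nlinarith
    calc 8 * (lamU / lamB) * Real.exp (-(lamB * Real.pi * r ^ 2 / 8))
        ≤ 1 * Real.exp (-(2 * k)) := by gcongr
      _ = _ := one_mul _
  refine (measure_union_le _ _).trans ((add_le_add h1 h2).trans_eq ?_)
  rw [← ENNReal.ofReal_add (by positivity) (by positivity)]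
  ring_nf

/-- Up to an exponentially small probability, there is an interfering base station within scaled
distance `6 * k`: the nearest base station of a user at scaled distance between `k` and `2 * k`. -/
lemma measure_forall_dlInterferer_le (N : Network P lamB lamU) (hB : 0 < lamB) (hU : 0 < lamU)
    (hρ : 16 ≤ lamB / lamU) {k : ℕ} (hk : 1 ≤ k) :
    P (N.locations ⁻¹' (⋃ n, {p : (ℕ → Plane) × (ℕ → Plane) |
      n ∈ dlInterferer p ∧ √lamU * ‖p.1 n‖ ≤ 6 * k})ᶜ)
      ≤ ENNReal.ofReal (3 * Real.exp (-(2 * k))) := by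
  have hk' : (1 : ℝ) ≤ k := by exact_mod_cast hk
  have hsU := Real.sqrt_pos.2 hU
  have hpi := Real.pi_gt_three
  set r : ℝ := k / √lamU with hr
  have hr0 : 0 < r := by positivity
  have hr1 : √lamU * r = k := by rw [hr]; field_simp
  have hBr : lamB * r ^ 2 = lamB / lamU * k ^ 2 := ratio_mul_sq hU k
  have hkk : (k : ℝ) ≤ k ^ 2 := by nlinarith
  have hBk : 16 * (k : ℝ) ^ 2 ≤ lamB * r ^ 2 := by rw [hBr]; gcongr
  have hsub : N.locations ⁻¹' (⋃ n, {p : (ℕ → Plane) × (ℕ → Plane) |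
      n ∈ dlInterferer p ∧ √lamU * ‖p.1 n‖ ≤ 6 * k})ᶜ
      ⊆ {ω | ∀ m, N.user m ω ∉ Metric.ball 0 (2 * r) \ Metric.ball 0 r} ∪ N.farUser r ∪
        ({ω | ∀ n, r / 2 ≤ dist 0 (N.bs n ω)} ∪
          {ω | ∀ R : ℝ, {n | N.bs n ω ∈ Metric.closedBall 0 R}.Finite}ᶜ) := by
    intro ω hω
    by_contra hc
    simp only [Set.mem_union, not_or, Set.mem_ofPred_eq, Set.mem_compl_iff, not_not,
      not_forall, not_le] at hc
    obtain ⟨⟨⟨m, hm⟩, hfar⟩, ⟨j, hj⟩, hfin⟩ := hc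
    refine hω ?_
    replace hfin : ∀ R : ℝ, {n | N.bs n ω ∈ Metric.closedBall 0 R}.Finite := by
      simpa only [not_exists, not_not] using hfin
    have hm1 : ‖N.user m ω‖ < 2 * r := by simpa using hm.1
    have hm2 : r ≤ ‖N.user m ω‖ := by simpa using hm.2
    obtain ⟨n, hn⟩ := exists_associated (x := fun k => N.bs k ω) hfin (N.user m ω) 0
    obtain ⟨h1, h2, h3⟩ := N.norm_le_of_associated hfar hm2 hn
    refine Set.mem_iUnion.2 ⟨n, ⟨fun h0 => ?_, m, hn⟩, ?_⟩
    · have := h0 j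
      simp only [locations, dist_zero_left] at this hj
      linarith
    · calc √lamU * ‖N.bs n ω‖ ≤ √lamU * (3 * r) := by gcongr; linarith
        _ = 3 * k := by rw [← hr1]; ring
        _ ≤ 6 * k := by linarith
  have h3 : P {ω | ∀ n, r / 2 ≤ dist 0 (N.bs n ω)} ≤ ENNReal.ofReal (Real.exp (-(2 * k))) := by
    rw [N.bs_poisson.measure_forall_le_dist hB.le 0 (by positivity)]
    refine ENNReal.ofReal_le_ofReal (Real.exp_le_exp.2 ?_)
    rw [show lamB * (Real.pi * (r / 2) ^ 2) = Real.pi / 4 * (lamB * r ^ 2) by ring]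
    nlinarith
  have h4 : P {ω | ∀ R : ℝ, {n | N.bs n ω ∈ Metric.closedBall 0 R}.Finite}ᶜ = 0 :=
    N.bs_poisson.ae_finite_closedBall
  refine (measure_mono hsub).trans ((measure_union_le _ _).trans ((add_le_add
    (N.measure_annulus_void_union_farUser_le hB hU hρ hk)
    ((measure_union_le _ _).trans (add_le_add h3 h4.le))).trans_eq ?_))
  rw [add_zero, ← ENNReal.ofReal_add (by positivity) (by positivity)]
  ring_nf

lemma dlSE_le (N : Network P lamB lamU) (hB : 0 < lamB) (hU : 0 < lamU)
    (hρ : 16 ≤ lamB / lamU) {α : ℝ} (hα : 2 < α) {p : ℝ} (hp : 0 < p) {k₀ : ℕ} (hk₀ : 1 ≤ k₀) :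
    N.dlSE α p ≤ capacity (ENNReal.ofReal ((lamB / lamU) ^ (α / 2)))
      + (∫⁻ z, fadingCapacity α z) + (ENNReal.ofReal (4 + 6 * α * √k₀)
        + ENNReal.ofReal (6 * (4 + 6 * α) * Real.exp (-k₀))) := by
  rw [N.dlSE_eq hB hU α hp]
  have h1 := setLIntegral_capacity_le (α := α) (Real.sqrt_pos.2 hB) N.bs_poisson
    N.measurable_bsFading N.bsFading_law (fun m => (N.indepFun_locations_bsFading m).comp
      (φ := fun p : (ℕ → Plane) × (ℕ → Plane) => p.1 m) (ψ := id) (by fun_prop) measurable_id)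
    (fun ω => {n | Associated (fun k => N.bs k ω) 0 n})
    (ENNReal.ofReal ((lamB / lamU) ^ (α / 2))) (N.dlScaledInterference α) Set.univ
  have h2 := setLIntegral_capacity_inv_le N.measurable_locations N.measurable_bsFading
    N.bsFading_law N.indepFun_locations_bsFading (by linarith) (J := N.dlScaledInterference α)
    (C := fun k n => {p : (ℕ → Plane) × (ℕ → Plane) | n ∈ dlInterferer p ∧ √lamU * ‖p.1 n‖ ≤ 6 * k})
    (fun k n => (measurableSet_mem_dlInterferer n).inter
      (measurableSet_le (f := fun p : (ℕ → Plane) × (ℕ → Plane) => √lamU * ‖p.1 n‖)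
        (by fun_prop) measurable_const))
    (fun k n ω hω => le_scaledPower (by linarith) (Real.sqrt_nonneg _) hω.1 hω.2)
    (fun k hk => N.measure_forall_dlInterferer_le hB hU hρ hk)
    MeasurableSet.univ hk₀
  rw [Set.preimage_univ] at h2
  simp only [Measure.restrict_univ, measure_univ, mul_one] at h1 h2
  refine h1.trans ?_
  rw [← mul_assoc, ← ENNReal.ofReal_mul hB.le, Real.sq_sqrt hB.le, mul_inv_cancel₀ hB.ne',
    ENNReal.ofReal_one, one_mul]
  gcongr

end Network

/-! ### Lower bound for the downlink -/

lemma mul_setLIntegral_scaled_tail {α mu R : ℝ} (hmu : 0 < mu) (hR : 0 < R) :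
    ENNReal.ofReal mu * ∫⁻ y in {y : Plane | R ≤ ‖y‖}, ‖√mu • y‖ₑ ^ (-α)
      = ENNReal.ofReal ((√mu * R) ^ (2 - α)) * tailConst α := by
  have ht := Real.sqrt_pos.2 hmu
  simp_rw [enorm_smul_rpow_neg α ht]
  rw [lintegral_const_mul' _ _ ENNReal.ofReal_ne_top, setLIntegral_enorm_rpow_neg hR, ← mul_assoc,
    ← mul_assoc, ← ENNReal.ofReal_mul hmu.le, ← ENNReal.ofReal_mul (by positivity)]
  congr 2
  rw [Real.mul_rpow ht.le hR.le, sub_eq_add_neg, Real.rpow_add ht, Real.rpow_two,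
    Real.sq_sqrt hmu.le]

lemma exp_neg_le_inv {x : ℝ} (hx : 0 < x) : Real.exp (-x) ≤ x⁻¹ := by
  rw [Real.exp_neg]
  exact inv_anti₀ hx (by linarith [Real.add_one_le_exp x])

namespace Network

variable {Ω : Type*} [MeasurableSpace Ω] {P : Measure Ω} {lamB lamU : ℝ}

/-- An upper bound for the interference in the downlink in the absence of far users and of users
within distance `R`: each pair of a user and its base station contributes, with the location of the
base station replaced by half of that of the user. -/
def dlPairInterference (N : Network P lamB lamU) (α R : ℝ) (ω : Ω) : ℝ≥0∞ :=
  ∑' n, ENNReal.ofReal (N.bsFading n ω) * ∑' m,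
    {q : Plane × (ℕ → Plane) | R ≤ ‖q.1‖ ∧ Associated q.2 q.1 n}.indicator
      (fun q => ENNReal.ofReal (2 ^ α) * ‖√lamU • q.1‖ₑ ^ (-α)) (N.user m ω, fun k => N.bs k ω)

lemma dlScaledInterference_le (N : Network P lamB lamU) {α R : ℝ} (hα : 0 ≤ α) (hU : 0 < lamU)
    {ω : Ω} (hR : ∀ m, R ≤ ‖N.user m ω‖) (hfar : ω ∉ N.farUser R) :
    N.dlScaledInterference α ω ≤ N.dlPairInterference α R ω := by
  refine le_trans ?_ (ENNReal.tsum_comp_le_tsum_of_injective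
    (Subtype.val_injective (p := fun n => n ∈ dlInterferer (N.locations ω))) _)
  refine ENNReal.tsum_le_tsum fun ⟨n, hn⟩ => ?_
  obtain ⟨-, m, hm⟩ := hn
  refine mul_le_mul' le_rfl (le_trans ?_ (ENNReal.le_tsum m))
  have hmem : (N.user m ω, fun k => N.bs k ω) ∈
      {q : Plane × (ℕ → Plane) | R ≤ ‖q.1‖ ∧ Associated q.2 q.1 n} := ⟨hR m, hm⟩
  rw [Set.indicator_of_mem hmem]
  obtain ⟨-, h2, -⟩ := N.norm_le_of_associated hfar (hR m) hm
  have h3 : ENNReal.ofReal (2 ^ α) = ENNReal.ofReal (2⁻¹ ^ (-α)) := by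
    rw [Real.inv_rpow zero_le_two, Real.rpow_neg zero_le_two, inv_inv]
  rw [h3, ← enorm_smul_rpow_neg α (by norm_num), ENNReal.rpow_neg, ENNReal.rpow_neg]
  refine ENNReal.inv_le_inv.2 (ENNReal.rpow_le_rpow ?_ hα)
  rw [← ofReal_norm, ← ofReal_norm]
  refine ENNReal.ofReal_le_ofReal ?_
  rw [norm_smul, norm_smul, norm_smul, Real.norm_of_nonneg (Real.sqrt_nonneg _),
    Real.norm_of_nonneg (by norm_num)]
  have := Real.sqrt_pos.2 hU
  nlinarith

variable [IsProbabilityMeasure P]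

lemma lintegral_dlPairInterference_le (N : Network P lamB lamU) (hB : 0 < lamB) (hU : 0 < lamU)
    {α R : ℝ} (hR : 0 < R) :
    ∫⁻ ω, N.dlPairInterference α R ω ∂P
      ≤ ENNReal.ofReal (2 * 2 ^ α * (√lamU * R) ^ (2 - α)) * tailConst α := by
  set S : ℕ → Set (Plane × (ℕ → Plane)) := fun n => {q | R ≤ ‖q.1‖ ∧ Associated q.2 q.1 n}
  have hS : ∀ n, MeasurableSet (S n) := fun n =>
    (measurableSet_le measurable_const (measurable_fst.norm)).inter
      (measurableSet_associated (x := Prod.snd) (by fun_prop) measurable_fst n)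
  set w : Plane → ℝ≥0∞ := fun y => ENNReal.ofReal (2 ^ α) * ‖√lamU • y‖ₑ ^ (-α)
  have hw : Measurable w := by fun_prop
  set F : ℕ → Plane × (ℕ → Plane) → ℝ≥0∞ := fun n => (S n).indicator (fun q => w q.1)
  have hF : ∀ n, Measurable (F n) := fun n => (hw.comp measurable_fst).indicator (hS n)
  set h : ℕ → (ℕ → Plane) × (ℕ → Plane) → ℝ≥0∞ := fun n p => ∑' m, F n (p.2 m, p.1)
  have hh : ∀ n, Measurable (h n) := fun n => Measurable.tsum fun m =>
    (hF n).comp (by fun_prop)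
  have hsec : ∀ y, ∑' n, ∫⁻ ω, F n (y, fun k => N.bs k ω) ∂P
      ≤ 2 * {y : Plane | R ≤ ‖y‖}.indicator w y := by
    intro y
    by_cases hy : R ≤ ‖y‖
    · rw [Set.indicator_of_mem (by exact hy)]
      have h1 : ∀ n, ∫⁻ ω, F n (y, fun k => N.bs k ω) ∂P
          = P {ω | Associated (fun k => N.bs k ω) y n} * w y := by
        intro n
        have hm : MeasurableSet {ω | Associated (fun k => N.bs k ω) y n} :=
          measurableSet_associated N.bs_poisson.measurable measurable_const n
        rw [mul_comm, ← lintegral_indicator_const hm]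
        refine lintegral_congr fun ω => ?_
        by_cases hA : Associated (fun k => N.bs k ω) y n
        · rw [Set.indicator_of_mem (by exact hA)]
          exact Set.indicator_of_mem (by exact ⟨hy, hA⟩) _
        · rw [Set.indicator_of_notMem (by exact hA)]
          exact Set.indicator_of_notMem (fun h => hA h.2) _
      simp_rw [h1]
      rw [ENNReal.tsum_mul_right]
      gcongr
      exact N.bs_poisson.tsum_measure_associated_le hB y
    · have h1 : ∀ n ω, F n (y, fun k => N.bs k ω) = 0 := by
        intro n ω
        simp [F, S, hy]
      simp [h1]
  calc ∫⁻ ω, N.dlPairInterference α R ω ∂P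
      = ∑' n, ∫⁻ ω, ENNReal.ofReal (N.bsFading n ω) * h n (N.locations ω) ∂P :=
        lintegral_tsum fun n => ((ENNReal.measurable_ofReal.comp (N.measurable_bsFading n)).mul
          ((hh n).comp N.measurable_locations)).aemeasurable
    _ = ∑' n, ∑' m, ∫⁻ ω, F n (N.user m ω, fun k => N.bs k ω) ∂P := by
        refine tsum_congr fun n => ?_
        rw [lintegral_fading_mul N.measurable_locations (N.measurable_bsFading n)
          (N.bsFading_law n) (N.indepFun_locations_bsFading n) (hh n)]
        exact lintegral_tsum fun m => ((hF n).comp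
          ((N.user_poisson.measurable m).prodMk N.measurable_bs)).aemeasurable
    _ = ∑' n, ENNReal.ofReal lamU * ∫⁻ y, ∫⁻ ω, F n (y, fun k => N.bs k ω) ∂P :=
        tsum_congr fun n => N.user_poisson.tsum_lintegral_indepFun N.measurable_bs
          N.indepFun_user_bs (hF n)
    _ = ENNReal.ofReal lamU * ∫⁻ y, ∑' n, ∫⁻ ω, F n (y, fun k => N.bs k ω) ∂P := by
        rw [ENNReal.tsum_mul_left, lintegral_tsum fun n => ?_]
        exact (Measurable.lintegral_prod_right'
          (f := fun p : Plane × Ω => F n (p.1, fun k => N.bs k p.2))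
          ((hF n).comp (measurable_fst.prodMk
            (N.measurable_bs.comp measurable_snd)))).aemeasurable
    _ ≤ ENNReal.ofReal lamU * ∫⁻ y, 2 * {y : Plane | R ≤ ‖y‖}.indicator w y := by
        gcongr
        exact hsec _
    _ = ENNReal.ofReal (2 * 2 ^ α) * (ENNReal.ofReal lamU
          * ∫⁻ y in {y : Plane | R ≤ ‖y‖}, ‖√lamU • y‖ₑ ^ (-α)) := by
        rw [lintegral_const_mul' _ _ (by norm_num),
          lintegral_indicator (measurableSet_le measurable_const measurable_norm),
          lintegral_const_mul' _ _ ENNReal.ofReal_ne_top, ENNReal.ofReal_mul zero_le_two,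
          ENNReal.ofReal_ofNat]
        ring
    _ = _ := by
        rw [mul_setLIntegral_scaled_tail hU hR, ← mul_assoc, ← ENNReal.ofReal_mul (by positivity)]

lemma measure_exists_norm_lt_le {lam : ℝ} {Y : ℕ → Ω → Plane} (hY : IsPoissonProcess P lam Y)
    (hlam : 0 ≤ lam) {r : ℝ} (hr : 0 ≤ r) :
    P {ω | ∃ m, ‖Y m ω‖ < r} ≤ ENNReal.ofReal (lam * (Real.pi * r ^ 2)) := by
  have h := hY.measure_exists_mem_le (A := Metric.ball 0 r) Metric.isOpen_ball.measurableSet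
  simp only [mem_ball_zero_iff] at h
  rwa [volume_ball 0 hr, ← ENNReal.ofReal_mul hlam] at h

/-- The lower bound for the downlink. The parameter `K` measures how far, up to a factor, the
distances and the interference may be from their typical orders. -/
lemma le_dlSE (N : Network P lamB lamU) (hB : 0 < lamB) (hU : 0 < lamU) {α : ℝ} (hα : 2 < α)
    {p : ℝ} (hp : 0 < p) {K : ℝ} (hK : 1 ≤ K) (hKρ : K ≤ lamB / lamU) :
    ENNReal.ofReal (Real.log ((lamB / lamU) ^ (α / 2) * (K ^ (-(1 + α)) / K ^ α)))
      * (1 - ENNReal.ofReal ((15 + 2 * 2 ^ α * (tailConst α).toReal) / K)) ≤ N.dlSE α p := by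
  have hpi := Real.pi_gt_three
  have hpi4 := Real.pi_le_four
  have hK0 : 0 < K := by linarith
  have hsB := Real.sqrt_pos.2 hB
  have hsU := Real.sqrt_pos.2 hU
  set r : ℝ := K / √lamB with hr
  have hr0 : 0 < r := by positivity
  set R : ℝ := 1 / (K * √lamU) with hR
  have hR0 : 0 < R := by positivity
  have hUR : √lamU * R = K⁻¹ := by rw [hR]; field_simp
  have hUR2 : lamU * R ^ 2 = K⁻¹ ^ 2 := by rw [← hUR, mul_pow, Real.sq_sqrt hU.le]
  have hBr : √lamB * r = K := by rw [hr]; field_simp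
  have hBr2 : lamB * r ^ 2 = K ^ 2 := by rw [← hBr, mul_pow, Real.sq_sqrt hB.le]
  have hKinv : K⁻¹ ≤ 1 := inv_le_one_of_one_le₀ hK
  have hKinv0 : 0 < K⁻¹ := by positivity
  -- no base station at a distance of the typical order
  set T₁ : Set Ω := {ω | ∀ n, r ≤ dist 0 (N.bs n ω)}
  have h1 : P T₁ ≤ ENNReal.ofReal (1 / K) := by
    rw [N.bs_poisson.measure_forall_le_dist hB.le 0 hr0.le]
    refine ENNReal.ofReal_le_ofReal ?_
    rw [show lamB * (Real.pi * r ^ 2) = Real.pi * (lamB * r ^ 2) by ring, hBr2]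
    refine (exp_neg_le_inv (by positivity)).trans ?_
    rw [← one_div]
    gcongr
    nlinarith
  -- weak fading of the signal
  set T₂ : Set Ω := {ω | ∃ n, Associated (fun k => N.bs k ω) 0 n ∧ N.bsFading n ω < K⁻¹}
  have h2 : P T₂ ≤ ENNReal.ofReal (2 / K) := by
    have hle : ∀ n, P {ω | Associated (fun k => N.bs k ω) 0 n ∧ N.bsFading n ω < K⁻¹}
        ≤ P {ω | Associated (fun k => N.bs k ω) 0 n} * ENNReal.ofReal K⁻¹ := by
      intro n
      have hC : MeasurableSet {q : (ℕ → Plane) × (ℕ → Plane) | Associated q.1 0 n} :=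
        measurableSet_associated (x := Prod.fst) (by fun_prop) measurable_const n
      have := (N.indepFun_locations_bsFading n).measure_inter_preimage_eq_mul _ _ hC
        (measurableSet_Iio (a := K⁻¹))
      refine this.le.trans ?_
      exact mul_le_mul' le_rfl (measure_lt_le_of_exp (N.bsFading_law n) _)
    rw [show T₂ = ⋃ n, {ω | Associated (fun k => N.bs k ω) 0 n ∧ N.bsFading n ω < K⁻¹} from
      Set.ofPred_exists _]
    refine (measure_iUnion_le _).trans ((ENNReal.tsum_le_tsum hle).trans ?_)
    rw [ENNReal.tsum_mul_right]
    refine (mul_le_mul' (N.bs_poisson.tsum_measure_associated_le hB 0) le_rfl).trans_eq ?_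
    rw [← ENNReal.ofReal_ofNat 2, ← ENNReal.ofReal_mul zero_le_two, div_eq_mul_inv]
  -- a user that is too close
  set T₃ : Set Ω := {ω | ∃ m, ‖N.user m ω‖ < R}
  have h3 : P T₃ ≤ ENNReal.ofReal (4 / K) := by
    refine (measure_exists_norm_lt_le N.user_poisson hU.le hR0.le).trans
      (ENNReal.ofReal_le_ofReal ?_)
    rw [show lamU * (Real.pi * R ^ 2) = Real.pi * (lamU * R ^ 2) by ring, hUR2, div_eq_mul_inv]
    nlinarith
  -- a user without base station nearby
  have h4 : P (N.farUser R) ≤ ENNReal.ofReal (8 / K) := by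
    refine (N.measure_farUser_le hB hU hR0.le).trans (ENNReal.ofReal_le_ofReal ?_)
    have h5 : Real.exp (-(lamB * Real.pi * R ^ 2 / 8)) ≤ 1 :=
      Real.exp_le_one_iff.2 (by rw [neg_nonpos]; positivity)
    have h6 : lamU / lamB ≤ 1 / K := by
      rw [div_le_div_iff₀ hB hK0, one_mul]
      rw [le_div_iff₀ hU] at hKρ
      linarith
    calc 8 * (lamU / lamB) * Real.exp (-(lamB * Real.pi * R ^ 2 / 8))
        ≤ 8 * (1 / K) * 1 := by gcongr
      _ = _ := by ring
  -- large interference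
  set T₅ : Set Ω := {ω | ENNReal.ofReal (K ^ α) ≤ N.dlPairInterference α R ω}
  have h5 : P T₅ ≤ ENNReal.ofReal (2 * 2 ^ α * (tailConst α).toReal / K) := by
    have hKα : 0 < K ^ α := by positivity
    have hmarkov := meas_ge_le_lintegral_div (μ := P) (f := N.dlPairInterference α R)
      (ε := ENNReal.ofReal (K ^ α)) ?_ (by simpa using hKα) ENNReal.ofReal_ne_top
    · refine hmarkov.trans (ENNReal.div_le_of_le_mul ?_)
      refine (N.lintegral_dlPairInterference_le hB hU hR0).trans ?_
      rw [← ENNReal.ofReal_toReal (tailConst_lt_top hα).ne, ← ENNReal.ofReal_mul (by positivity),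
        ← ENNReal.ofReal_mul (by positivity), ENNReal.toReal_ofReal ENNReal.toReal_nonneg]
      refine ENNReal.ofReal_le_ofReal ?_
      have h6 : (√lamU * R) ^ (2 - α) ≤ 1 / K * K ^ α := by
        rw [hUR, Real.inv_rpow hK0.le, ← Real.rpow_neg hK0.le, one_div, ← Real.rpow_neg_one,
          ← Real.rpow_add hK0]
        exact Real.rpow_le_rpow_of_exponent_le hK (by linarith)
      calc 2 * 2 ^ α * (√lamU * R) ^ (2 - α) * (tailConst α).toReal
          ≤ 2 * 2 ^ α * (1 / K * K ^ α) * (tailConst α).toReal := by gcongr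
        _ = _ := by ring
    · refine (Measurable.tsum fun n => ?_).aemeasurable
      refine (ENNReal.measurable_ofReal.comp (N.measurable_bsFading n)).mul
        (Measurable.tsum fun m => ?_)
      refine Measurable.comp (g := {q : Plane × (ℕ → Plane) |
        R ≤ ‖q.1‖ ∧ Associated q.2 q.1 n}.indicator
        (fun q => ENNReal.ofReal (2 ^ α) * ‖√lamU • q.1‖ₑ ^ (-α))) ?_
        ((N.user_poisson.measurable m).prodMk N.measurable_bs)
      exact Measurable.indicator (by fun_prop)
        ((measurableSet_le measurable_const (measurable_fst.norm)).inter
          (measurableSet_associated (x := Prod.snd) (by fun_prop) measurable_fst n))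
  set T₆ : Set Ω := {ω | ∀ R : ℝ, {n | N.bs n ω ∈ Metric.closedBall 0 R}.Finite}ᶜ
  have h6 : P T₆ = 0 := N.bs_poisson.ae_finite_closedBall
  rw [N.dlSE_eq hB hU α hp]
  refine mul_one_sub_le_lintegral (T := T₁ ∪ (T₂ ∪ (T₃ ∪ (N.farUser R ∪ (T₅ ∪ T₆))))) ?_ ?_
  · intro ω hω
    simp only [Set.mem_union, not_or] at hω
    obtain ⟨hω1, hω2, hω3, hω4, hω5, hω6⟩ := hω
    have hfin : ∀ R : ℝ, {n | N.bs n ω ∈ Metric.closedBall 0 R}.Finite := not_not.1 hω6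
    have hex : ∃ j, dist 0 (N.bs j ω) < r := by
      by_contra! h
      exact hω1 h
    obtain ⟨j, hj⟩ := hex
    obtain ⟨n, hn⟩ := exists_associated (x := fun k => N.bs k ω) hfin 0 0
    have hg : K⁻¹ ≤ N.bsFading n ω := not_lt.1 fun h => hω2 ⟨n, hn, h⟩
    have hd : ‖N.bs n ω‖ < r := by
      have := (hn j).trans_lt hj
      rwa [dist_zero_left] at this
    refine le_capacity_of_bounds (by positivity) (by positivity) (by positivity) ?_
      ((N.dlScaledInterference_le (by linarith) hU
        (fun m => not_lt.1 fun h => hω3 ⟨m, h⟩) hω4).trans (not_le.1 hω5).le)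
    refine le_trans ?_ (le_scaledPower (n := n) (d := K) (by linarith) hsB.le hn
      (by rw [← hBr]; gcongr))
    rw [neg_add, Real.rpow_add hK0, Real.rpow_neg_one, ENNReal.ofReal_mul (by positivity),
      ENNReal.ofReal_rpow_of_pos hK0]
    gcongr
  · refine (measure_union_le _ _).trans ((add_le_add h1 ((measure_union_le _ _).trans
      (add_le_add h2 ((measure_union_le _ _).trans (add_le_add h3 ((measure_union_le _ _).trans
        (add_le_add h4 ((measure_union_le _ _).trans (add_le_add h5 h6.le))))))))).trans_eq ?_)
    have hT := ENNReal.toReal_nonneg (a := tailConst α)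
    rw [add_zero, ← ENNReal.ofReal_add (by positivity) (by positivity),
      ← ENNReal.ofReal_add (by positivity) (by positivity),
      ← ENNReal.ofReal_add (by positivity) (by positivity),
      ← ENNReal.ofReal_add (by positivity) (by positivity)]
    congr 1
    ring

end Network

/-! ### Upper bound for the uplink -/

lemma measurableSet_scheduled {E : Type*} [MeasurableSpace E] {ι : Type*} [Countable ι]
    {x : E → ι → Plane} {y : E → ℕ → Plane} {u : E → ℕ → ℝ}
    (hx : ∀ i, Measurable fun e => x e i) (hy : ∀ m, Measurable fun e => y e m)
    (hu : ∀ m, Measurable fun e => u e m) (i : ι) (m : ℕ) :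
    MeasurableSet {e | Scheduled (x e) (y e) (u e) i m} := by
  have h (m' : ℕ) : Measurable fun e => Associated (x e) (y e m') i :=
    measurableSet_setOfPred.1 (measurableSet_associated hx (hy m') i)
  refine measurableSet_setOfPred.2 ((h m).and (Measurable.forall fun m' => (h m').imp ?_))
  exact measurableSet_setOfPred.1 (measurableSet_le (hu m) (hu m'))

namespace Network

/-- The base stations at `x`, together with the typical one at the origin. -/
def withTypical (x : ℕ → Plane) (i : Option ℕ) : Plane := i.elim 0 x

variable {Ω : Type*} [MeasurableSpace Ω] {P : Measure Ω} {lamB lamU : ℝ}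

lemma ulBs_eq (N : Network P lamB lamU) (ω : Ω) :
    N.ulBs ω = withTypical fun n => N.bs n ω := by
  ext1 i
  cases i <;> rfl

lemma measurable_withTypical {E : Type*} [MeasurableSpace E] {x : E → ℕ → Plane}
    (hx : ∀ n, Measurable fun e => x e n) (i : Option ℕ) :
    Measurable fun e => withTypical (x e) i := by
  cases i with
  | none => exact measurable_const
  | some n => exact hx n

lemma associated_none_iff (N : Network P lamB lamU) (ω : Ω) (y : Plane) :
    Associated (N.ulBs ω) y none ↔ ∀ n, ‖y‖ ≤ dist y (N.bs n ω) := by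
  simp [Associated, Option.forall, ulBs]

lemma associated_some_iff (N : Network P lamB lamU) (ω : Ω) (y : Plane) (n : ℕ) :
    Associated (N.ulBs ω) y (some n) ↔
      dist y (N.bs n ω) ≤ ‖y‖ ∧ Associated (fun k => N.bs k ω) y n := by
  simp [Associated, Option.forall, ulBs]

/-- The users that are scheduled by the base stations other than the typical one, as a function of
the locations and the priorities. -/
def ulInterferer (q : ((ℕ → Plane) × (ℕ → Plane)) × (ℕ → ℝ)) : Set ℕ :=
  {m | ∃ n : ℕ, Scheduled (withTypical q.1.1) q.1.2 q.2 (some n) m}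

lemma measurableSet_mem_ulInterferer (m : ℕ) :
    MeasurableSet {q : ((ℕ → Plane) × (ℕ → Plane)) × (ℕ → ℝ) | m ∈ ulInterferer q} := by
  change MeasurableSet {q : ((ℕ → Plane) × (ℕ → Plane)) × (ℕ → ℝ) |
    ∃ n : ℕ, Scheduled (withTypical q.1.1) q.1.2 q.2 (some n) m}
  rw [Set.ofPred_exists]
  exact .iUnion fun n => measurableSet_scheduled
    (x := fun q : ((ℕ → Plane) × (ℕ → Plane)) × (ℕ → ℝ) => withTypical q.1.1)
    (y := fun q => q.1.2) (u := fun q => q.2)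
    (measurable_withTypical
      (x := fun q : ((ℕ → Plane) × (ℕ → Plane)) × (ℕ → ℝ) => q.1.1) (by fun_prop))
    (by fun_prop) (by fun_prop) (some n) m

lemma mem_ulInterferer_config (N : Network P lamB lamU) (ω : Ω) (m : ℕ) :
    m ∈ ulInterferer (N.config ω) ↔ ∃ n : ℕ, N.ulScheduled ω (some n) m := by
  simp only [ulScheduled, ulBs_eq]
  rfl

/-- The normalized interference in the uplink. -/
def ulScaledInterference (N : Network P lamB lamU) (α : ℝ) (ω : Ω) : ℝ≥0∞ :=
  scaledPower α √lamU (fun n => N.userFading n ω) (fun n => N.user n ω)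
    (ulInterferer (N.config ω))

lemma ulSE_eq (N : Network P lamB lamU) (hB : 0 < lamB) (hU : 0 < lamU) (α : ℝ) {p : ℝ}
    (hp : 0 < p) :
    N.ulSE α p = ∫⁻ ω, capacity (ENNReal.ofReal ((lamB / lamU) ^ (α / 2))
      * (scaledPower α √lamB (fun n => N.userFading n ω) (fun n => N.user n ω)
        {m | N.ulScheduled ω none m} * (N.ulScaledInterference α ω)⁻¹))
        ∂(ProbabilityTheory.cond P N.ulActive) := by
  refine lintegral_congr fun ω => congrArg capacity ?_
  refine (tsum_receivedPower_div α hp hB hU (fun n => N.userFading n ω) (fun n => N.user n ω)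
    {m | N.ulScheduled ω none m} {m | ∃ n : ℕ, N.ulScheduled ω (some n) m}).trans ?_
  have : {m | ∃ n : ℕ, N.ulScheduled ω (some n) m} = ulInterferer (N.config ω) := by
    ext m
    exact (N.mem_ulInterferer_config ω m).symm
  rw [this, ulScaledInterference]

/-- The event that the typical base station is active, as a set of configurations. -/
def activeConfig : Set (((ℕ → Plane) × (ℕ → Plane)) × (ℕ → ℝ)) :=
  {q | ∃ m, Associated (withTypical q.1.1) (q.1.2 m) none}

lemma measurableSet_activeConfig : MeasurableSet activeConfig := by
  rw [activeConfig, Set.ofPred_exists]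
  exact .iUnion fun m => measurableSet_associated
    (x := fun q : ((ℕ → Plane) × (ℕ → Plane)) × (ℕ → ℝ) => withTypical q.1.1)
    (y := fun q => q.1.2 m)
    (measurable_withTypical
      (x := fun q : ((ℕ → Plane) × (ℕ → Plane)) × (ℕ → ℝ) => q.1.1) (by fun_prop))
        (by fun_prop) none

lemma ulActive_eq (N : Network P lamB lamU) : N.ulActive = N.config ⁻¹' activeConfig := by
  ext ω
  simp only [ulActive, ulBs_eq]
  rfl

lemma measurableSet_ulActive (N : Network P lamB lamU) : MeasurableSet N.ulActive := by
  rw [ulActive_eq]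
  exact N.measurable_config measurableSet_activeConfig

variable [IsProbabilityMeasure P]

/-- The typical base station is active with probability at least of order `lamU / lamB`: it
suffices that some user is within distance `1 / √lamB`, and no other base station within twice
this distance. -/
lemma le_measure_ulActive (N : Network P lamB lamU) (hB : 0 < lamB) (hU : 0 < lamU)
    (hρ : 16 ≤ lamB / lamU) :
    ENNReal.ofReal (Real.exp (-(4 * Real.pi)) * (lamU / lamB)) ≤ P N.ulActive := by
  have hpi := Real.pi_gt_three
  have hpi4 := Real.pi_le_four
  set r : ℝ := (√lamB)⁻¹
  have hsB := Real.sqrt_pos.2 hB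
  have hr0 : 0 < r := by positivity
  have hr2 : r ^ 2 = lamB⁻¹ := by rw [inv_pow, Real.sq_sqrt hB.le]
  set S : Set (ℕ → Plane) := {y | ∀ m, y m ∉ Metric.ball (0 : Plane) r}
  have hS : MeasurableSet S := by
    change MeasurableSet {y : ℕ → Plane | ∀ m, y m ∉ Metric.ball (0 : Plane) r}
    rw [Set.ofPred_forall]
    exact .iInter fun m => (measurable_pi_apply m Metric.isOpen_ball.measurableSet).compl
  set T : Set (ℕ → Plane) := {x | ∀ n, 2 * r ≤ dist 0 (x n)}
  have hT : MeasurableSet T := by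
    change MeasurableSet {x : ℕ → Plane | ∀ n, 2 * r ≤ dist 0 (x n)}
    rw [Set.ofPred_forall]
    exact .iInter fun n => measurableSet_le measurable_const (by fun_prop)
  have hind := N.indep_bs_user.measure_inter_preimage_eq_mul _ _ hT hS.compl
  have h1 : P ((fun ω n => N.bs n ω) ⁻¹' T) = ENNReal.ofReal (Real.exp (-(4 * Real.pi))) := by
    refine (N.bs_poisson.measure_forall_le_dist hB.le 0 (by positivity)).trans ?_
    rw [mul_pow, hr2]
    congr 3
    field_simp
    norm_num
  have h2 : ENNReal.ofReal (lamU / lamB) ≤ P ((fun ω m => N.user m ω) ⁻¹' Sᶜ) := by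
    rw [Set.preimage_compl, prob_compl_eq_one_sub (N.measurable_user hS)]
    have h3 : P ((fun ω m => N.user m ω) ⁻¹' S)
        = ENNReal.ofReal (Real.exp (-(lamU / lamB * Real.pi))) := by
      refine (N.user_poisson.measure_forall_notMem hU.le (A := Metric.ball 0 r)
        Metric.isOpen_ball.measurableSet measure_ball_lt_top.ne).trans ?_
      rw [volume_ball 0 hr0.le, ENNReal.toReal_ofReal (by positivity), hr2]
      congr 3
      field_simp
    rw [h3, ← ENNReal.ofReal_one, ← ENNReal.ofReal_sub _ (Real.exp_pos _).le]
    refine ENNReal.ofReal_le_ofReal ?_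
    have h4 : lamU / lamB ≤ 1 / 16 := by
      rw [le_div_iff₀ hU] at hρ
      rw [div_le_iff₀ hB]
      linarith
    have h5 : 0 < lamU / lamB := by positivity
    set x := lamU / lamB
    have h6 : Real.exp (-(x * Real.pi)) ≤ (1 + x * Real.pi)⁻¹ := by
      rw [Real.exp_neg]
      exact inv_anti₀ (by positivity) (by linarith [Real.add_one_le_exp (x * Real.pi)])
    have h7 : (1 + x * Real.pi)⁻¹ ≤ 1 - x := by
      rw [inv_le_iff_one_le_mul₀ (by positivity)]
      nlinarith [mul_pos h5 h5]
    linarith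
  calc ENNReal.ofReal (Real.exp (-(4 * Real.pi)) * (lamU / lamB))
      ≤ P ((fun ω n => N.bs n ω) ⁻¹' T) * P ((fun ω m => N.user m ω) ⁻¹' Sᶜ) := by
        rw [ENNReal.ofReal_mul (Real.exp_pos _).le, h1]
        gcongr
    _ = P ((fun ω n => N.bs n ω) ⁻¹' T ∩ (fun ω m => N.user m ω) ⁻¹' Sᶜ) := hind.symm
    _ ≤ P N.ulActive := by
        refine measure_mono fun ω hω => ?_
        obtain ⟨hω1, hω2⟩ := hω
        have hω1' : ∀ n, 2 * r ≤ dist 0 (N.bs n ω) := hω1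
        have hω2' : ¬ ∀ m, N.user m ω ∉ Metric.ball (0 : Plane) r := hω2
        push Not at hω2'
        obtain ⟨m, hm⟩ := hω2'
        rw [mem_ball_zero_iff] at hm
        refine ⟨m, (N.associated_none_iff ω _).2 fun n => ?_⟩
        have := dist_triangle_left 0 (N.bs n ω) (N.user m ω)
        rw [dist_zero_right] at this
        linarith [hω1' n]

lemma inv_measure_ulActive_mul_le (N : Network P lamB lamU) (hB : 0 < lamB) (hU : 0 < lamU)
    (hρ : 16 ≤ lamB / lamU) (c : ℝ) :
    (P N.ulActive)⁻¹ * ENNReal.ofReal (c * (lamU / lamB))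
      ≤ ENNReal.ofReal (Real.exp (4 * Real.pi) * c) := by
  have hpos : 0 < Real.exp (-(4 * Real.pi)) * (lamU / lamB) := by positivity
  calc (P N.ulActive)⁻¹ * ENNReal.ofReal (c * (lamU / lamB))
      ≤ (ENNReal.ofReal (Real.exp (-(4 * Real.pi)) * (lamU / lamB)))⁻¹
          * ENNReal.ofReal (c * (lamU / lamB)) := by
        gcongr
        exact N.le_measure_ulActive hB hU hρ
    _ = _ := by
        rw [← ENNReal.ofReal_inv_of_pos hpos, ← ENNReal.ofReal_mul (by positivity)]
        congr 1
        rw [Real.exp_neg]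
        field_simp

/-- Up to an exponentially small probability, there is an interfering user within scaled
distance `6 * k`: the nearest base station of a user at scaled distance between `k` and `2 * k`
schedules one of its users. -/
lemma measure_forall_ulInterferer_le (N : Network P lamB lamU) (hB : 0 < lamB) (hU : 0 < lamU)
    (hρ : 16 ≤ lamB / lamU) {k : ℕ} (hk : 1 ≤ k) :
    P (N.config ⁻¹' (⋃ m, {q : ((ℕ → Plane) × (ℕ → Plane)) × (ℕ → ℝ) |
      m ∈ ulInterferer q ∧ √lamU * ‖q.1.2 m‖ ≤ 6 * k})ᶜ)
      ≤ ENNReal.ofReal (3 * Real.exp (-(2 * k))) := by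
  have hk' : (1 : ℝ) ≤ k := by exact_mod_cast hk
  have hsU := Real.sqrt_pos.2 hU
  set r : ℝ := k / √lamU with hr
  have hr0 : 0 < r := by positivity
  have hr1 : √lamU * r = k := by rw [hr]; field_simp
  have hsub : N.config ⁻¹' (⋃ m, {q : ((ℕ → Plane) × (ℕ → Plane)) × (ℕ → ℝ) |
      m ∈ ulInterferer q ∧ √lamU * ‖q.1.2 m‖ ≤ 6 * k})ᶜ
      ⊆ {ω | ∀ m, N.user m ω ∉ Metric.ball 0 (2 * r) \ Metric.ball 0 r} ∪ N.farUser r ∪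
        ({ω | ∀ R : ℝ, {n | N.bs n ω ∈ Metric.closedBall 0 R}.Finite}ᶜ ∪
          {ω | ∀ R : ℝ, {m | N.user m ω ∈ Metric.closedBall 0 R}.Finite}ᶜ) := by
    intro ω hω
    by_contra hc
    rw [Set.mem_union, Set.mem_union, Set.mem_union, not_or, not_or, not_or] at hc
    obtain ⟨⟨hm, hfar⟩, hfinB, hfinU⟩ := hc
    replace hm : ¬ ∀ m, N.user m ω ∉ Metric.ball 0 (2 * r) \ Metric.ball 0 r := hm
    replace hfinB : ∀ R : ℝ, {n | N.bs n ω ∈ Metric.closedBall 0 R}.Finite := not_not.1 hfinB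
    replace hfinU : ∀ R : ℝ, {m | N.user m ω ∈ Metric.closedBall 0 R}.Finite := not_not.1 hfinU
    push Not at hm
    obtain ⟨m, hm⟩ := hm
    have hm1 : ‖N.user m ω‖ < 2 * r := by simpa using hm.1
    have hm2 : r ≤ ‖N.user m ω‖ := by simpa using hm.2
    obtain ⟨n, hn⟩ := exists_associated (x := fun k => N.bs k ω) hfinB (N.user m ω) 0
    obtain ⟨h1, h2, h3⟩ := N.norm_le_of_associated hfar hm2 hn
    have hcell : ∀ m', Associated (N.ulBs ω) (N.user m' ω) (some n) → ‖N.user m' ω‖ ≤ 6 * r := by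
      intro m' hm'
      by_cases h : r ≤ ‖N.user m' ω‖
      · obtain ⟨-, h4, -⟩ :=
          N.norm_le_of_associated hfar h ((N.associated_some_iff ω _ n).1 hm').2
        linarith
      · linarith
    have hmn : Associated (N.ulBs ω) (N.user m ω) (some n) :=
      (N.associated_some_iff ω _ n).2 ⟨by linarith [norm_nonneg (N.user m ω)], hn⟩
    obtain ⟨m', hm', hmin⟩ := Set.exists_min_image
      {m' | Associated (N.ulBs ω) (N.user m' ω) (some n)} (fun k => N.priority k ω)
      ((hfinU (6 * r)).subset fun m' hm' => mem_closedBall_zero_iff.2 (hcell m' hm')) ⟨m, hmn⟩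
    refine hω (Set.mem_iUnion.2 ⟨m', (N.mem_ulInterferer_config ω m').2 ⟨n, hm', hmin⟩, ?_⟩)
    calc √lamU * ‖N.user m' ω‖ ≤ √lamU * (6 * r) := by gcongr; exact hcell m' hm'
      _ = 6 * k := by rw [← hr1]; ring
  have h1 : P {ω | ∀ R : ℝ, {n | N.bs n ω ∈ Metric.closedBall 0 R}.Finite}ᶜ = 0 :=
    N.bs_poisson.ae_finite_closedBall
  have h2 : P {ω | ∀ R : ℝ, {m | N.user m ω ∈ Metric.closedBall 0 R}.Finite}ᶜ = 0 :=
    N.user_poisson.ae_finite_closedBall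
  refine (measure_mono hsub).trans ((measure_union_le _ _).trans ((add_le_add
    (N.measure_annulus_void_union_farUser_le hB hU hρ hk)
    ((measure_union_le _ _).trans (add_le_add h1.le h2.le))).trans ?_))
  rw [add_zero, add_zero]
  exact ENNReal.ofReal_le_ofReal (by linarith [Real.exp_pos (-(2 * k : ℝ))])

lemma ulSE_le (N : Network P lamB lamU) (hB : 0 < lamB) (hU : 0 < lamU)
    (hρ : 16 ≤ lamB / lamU) {α : ℝ} (hα : 2 < α) {p : ℝ} (hp : 0 < p) {k₀ : ℕ} (hk₀ : 1 ≤ k₀)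
    (hk₀ρ : Real.exp (-k₀) ≤ lamU / lamB) :
    N.ulSE α p ≤ capacity (ENNReal.ofReal ((lamB / lamU) ^ (α / 2)))
      + ENNReal.ofReal (Real.exp (4 * Real.pi)) * (∫⁻ z, fadingCapacity α z)
      + (ENNReal.ofReal (4 + 6 * α * √k₀)
        + ENNReal.ofReal (Real.exp (4 * Real.pi) * (6 * (4 + 6 * α)))) := by
  rw [N.ulSE_eq hB hU α hp, ProbabilityTheory.cond, lintegral_smul_measure, smul_eq_mul]
  have h1 := setLIntegral_capacity_le (α := α) (Real.sqrt_pos.2 hB) N.user_poisson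
    N.measurable_userFading N.userFading_law (fun m => (N.indepFun_locations_userFading m).comp
      (φ := fun p : (ℕ → Plane) × (ℕ → Plane) => p.2 m) (ψ := id) (by fun_prop) measurable_id)
    (fun ω => {m | N.ulScheduled ω none m})
    (ENNReal.ofReal ((lamB / lamU) ^ (α / 2))) (N.ulScaledInterference α) N.ulActive
  have h2 := setLIntegral_capacity_inv_le N.measurable_config N.measurable_userFading
    N.userFading_law N.indepFun_config_userFading (by linarith) (J := N.ulScaledInterference α)
    (C := fun k m => {q : ((ℕ → Plane) × (ℕ → Plane)) × (ℕ → ℝ) |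
      m ∈ ulInterferer q ∧ √lamU * ‖q.1.2 m‖ ≤ 6 * k})
    (fun k m => (measurableSet_mem_ulInterferer m).inter
      (measurableSet_le (f := fun q : ((ℕ → Plane) × (ℕ → Plane)) × (ℕ → ℝ) => √lamU * ‖q.1.2 m‖)
        (by fun_prop) measurable_const))
    (fun k m ω hω => le_scaledPower (by linarith) (Real.sqrt_nonneg _) hω.1 hω.2)
    (fun k hk => N.measure_forall_ulInterferer_le hB hU hρ hk)
    measurableSet_activeConfig hk₀
  rw [← ulActive_eq] at h2
  have hA0 : P N.ulActive ≠ 0 := by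
    refine ne_of_gt (lt_of_lt_of_le (ENNReal.ofReal_pos.2 ?_) (N.le_measure_ulActive hB hU hρ))
    positivity
  have hinv : (P N.ulActive)⁻¹ * P N.ulActive = 1 :=
    ENNReal.inv_mul_cancel hA0 (measure_ne_top _ _)
  set x := capacity (ENNReal.ofReal ((lamB / lamU) ^ (α / 2)))
  set F := ∫⁻ z, fadingCapacity α z
  set c := ENNReal.ofReal (4 + 6 * α * √k₀)
  have h3 : ENNReal.ofReal lamU * (ENNReal.ofReal (√lamB ^ 2)⁻¹ * F)
      = ENNReal.ofReal (1 * (lamU / lamB)) * F := by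
    rw [← mul_assoc, ← ENNReal.ofReal_mul hU.le, Real.sq_sqrt hB.le, one_mul, div_eq_mul_inv]
  have h4 : ENNReal.ofReal (6 * (4 + 6 * α) * Real.exp (-k₀))
      ≤ ENNReal.ofReal (6 * (4 + 6 * α) * (lamU / lamB)) :=
    ENNReal.ofReal_le_ofReal (by gcongr)
  calc _ ≤ (P N.ulActive)⁻¹ * (x * P N.ulActive + ENNReal.ofReal (1 * (lamU / lamB)) * F
        + (c * P N.ulActive + ENNReal.ofReal (6 * (4 + 6 * α) * (lamU / lamB)))) := by
        rw [← h3]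
        gcongr
        exact h1.trans (add_le_add le_rfl (h2.trans (add_le_add le_rfl h4)))
    _ = x * ((P N.ulActive)⁻¹ * P N.ulActive)
        + (P N.ulActive)⁻¹ * ENNReal.ofReal (1 * (lamU / lamB)) * F
        + (c * ((P N.ulActive)⁻¹ * P N.ulActive)
          + (P N.ulActive)⁻¹ * ENNReal.ofReal (6 * (4 + 6 * α) * (lamU / lamB))) := by ring
    _ ≤ _ := by
        rw [hinv, mul_one, mul_one]
        gcongr
        · refine (N.inv_measure_ulActive_mul_le hB hU hρ 1).trans_eq ?_
          rw [mul_one]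
        · exact N.inv_measure_ulActive_mul_le hB hU hρ _

end Network

/-! ### Lower bound for the uplink -/

namespace Network

variable {Ω : Type*} [MeasurableSpace Ω] {P : Measure Ω} {lamB lamU : ℝ}

/-- The normalized power received from all users beyond both distances `R` and `s`. -/
def userPowerBeyond (N : Network P lamB lamU) (α R s : ℝ) (ω : Ω) : ℝ≥0∞ :=
  ∑' m, ENNReal.ofReal (N.userFading m ω) * {y : Plane | R ≤ ‖y‖ ∧ s ≤ ‖y‖}.indicator
    (fun y => ‖√lamU • y‖ₑ ^ (-α)) (N.user m ω)

lemma measurable_userPowerBeyond (N : Network P lamB lamU) (α R s : ℝ) :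
    Measurable (N.userPowerBeyond α R s) := by
  refine Measurable.tsum fun m =>
    (ENNReal.measurable_ofReal.comp (N.measurable_userFading m)).mul ?_
  have hD : MeasurableSet {y : Plane | R ≤ ‖y‖ ∧ s ≤ ‖y‖} :=
    (measurableSet_le measurable_const measurable_norm).inter
      (measurableSet_le measurable_const measurable_norm)
  exact ((by fun_prop : Measurable fun y : Plane => ‖√lamU • y‖ₑ ^ (-α)).indicator hD).comp
    (N.user_poisson.measurable m)

/-- Some user is within distance `s`. -/
def userWithin (N : Network P lamB lamU) (s : ℝ) : Set Ω := {ω | ∃ m, ‖N.user m ω‖ < s}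

lemma userWithin_eq (N : Network P lamB lamU) (s : ℝ) :
    N.userWithin s = pointCount N.user (Metric.ball 0 s) ⁻¹' {0}ᶜ := by
  rw [Set.preimage_compl, pointCount_preimage_zero]
  ext ω
  simp [userWithin]

lemma measurableSet_userWithin (N : Network P lamB lamU) (s : ℝ) :
    MeasurableSet (N.userWithin s) := by
  rw [userWithin_eq]
  exact N.user_poisson.measurable_pointCount Metric.isOpen_ball.measurableSet .of_discrete

/-- The presence of a user within distance `s` does not affect the mean power received from the
users beyond. -/
lemma setLIntegral_userPowerBeyond_le (N : Network P lamB lamU) (hU : 0 < lamU) (α : ℝ)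
    {R : ℝ} (hR : 0 < R) (s : ℝ) :
    ∫⁻ ω in N.userWithin s, N.userPowerBeyond α R s ω ∂P
      ≤ P (N.userWithin s) * (ENNReal.ofReal ((√lamU * R) ^ (2 - α)) * tailConst α) := by
  set D : Set Plane := {y | R ≤ ‖y‖ ∧ s ≤ ‖y‖}
  have hD : MeasurableSet D := (measurableSet_le measurable_const measurable_norm).inter
    (measurableSet_le measurable_const measurable_norm)
  set w : Plane → ℝ≥0∞ := fun y => ‖√lamU • y‖ₑ ^ (-α)
  have hw : Measurable (D.indicator w) :=
    (by fun_prop : Measurable fun y : Plane => ‖√lamU • y‖ₑ ^ (-α)).indicator hD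
  set C : Set ((ℕ → Plane) × (ℕ → Plane)) := {p | ∃ m, ‖p.2 m‖ < s}
  have hC : MeasurableSet C := by
    change MeasurableSet {p : (ℕ → Plane) × (ℕ → Plane) | ∃ m, ‖p.2 m‖ < s}
    rw [Set.ofPred_exists]
    exact .iUnion fun m => measurableSet_lt
      (f := fun p : (ℕ → Plane) × (ℕ → Plane) => ‖p.2 m‖) (by fun_prop) measurable_const
  have hH := N.measurableSet_userWithin s
  have hterm (m : ℕ) :
      ∫⁻ ω in N.userWithin s, ENNReal.ofReal (N.userFading m ω) * D.indicator w (N.user m ω) ∂P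
        = ∫⁻ ω in N.userWithin s, D.indicator w (N.user m ω) ∂P := by
    rw [← lintegral_indicator hH, ← lintegral_indicator hH]
    have h := lintegral_fading_mul N.measurable_locations (N.measurable_userFading m)
      (N.userFading_law m) (N.indepFun_locations_userFading m)
      (h := C.indicator fun p => D.indicator w (p.2 m))
      (Measurable.indicator (hw.comp (by fun_prop)) hC)
    refine Eq.trans (lintegral_congr fun ω => ?_) (h.trans (lintegral_congr fun ω => ?_))
    · by_cases hω : ω ∈ N.userWithin s
      · have hω' : N.locations ω ∈ C := hω
        rw [Set.indicator_of_mem hω, Set.indicator_of_mem hω']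
        rfl
      · have hω' : N.locations ω ∉ C := hω
        rw [Set.indicator_of_notMem hω, Set.indicator_of_notMem hω', mul_zero]
    · rfl
  calc ∫⁻ ω in N.userWithin s, N.userPowerBeyond α R s ω ∂P
      = ∑' m, ∫⁻ ω in N.userWithin s,
          ENNReal.ofReal (N.userFading m ω) * D.indicator w (N.user m ω) ∂P :=
        lintegral_tsum fun m => ((ENNReal.measurable_ofReal.comp (N.measurable_userFading m)).mul
          (hw.comp (N.user_poisson.measurable m))).aemeasurable
    _ = ∑' m, ∫⁻ ω in N.userWithin s, D.indicator w (N.user m ω) ∂P := tsum_congr hterm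
    _ = P (N.userWithin s) * ENNReal.ofReal lamU * ∫⁻ y, D.indicator w y := by
        rw [userWithin_eq]
        refine N.user_poisson.tsum_setLIntegral_compl Metric.isOpen_ball.measurableSet
          measure_ball_lt_top.ne _ hw fun y hy => Set.indicator_of_notMem (fun h => ?_) _
        rw [mem_ball_zero_iff] at hy
        exact absurd h.2 (not_le.2 hy)
    _ ≤ P (N.userWithin s) * ENNReal.ofReal lamU * ∫⁻ y in {y : Plane | R ≤ ‖y‖}, w y := by
        rw [lintegral_indicator hD]
        gcongr
        exact fun y hy => hy.1
    _ = _ := by rw [mul_assoc, mul_setLIntegral_scaled_tail hU hR]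

/-- The presence of a user within distance `s` does not affect the mean number of users beyond. -/
lemma measure_userWithin_inter_le (N : Network P lamB lamU) (hU : 0 < lamU) {R s : ℝ}
    (hR : 0 ≤ R) :
    P (N.userWithin s ∩ {ω | ∃ m, s ≤ ‖N.user m ω‖ ∧ ‖N.user m ω‖ < R})
      ≤ P (N.userWithin s) * ENNReal.ofReal (lamU * (Real.pi * R ^ 2)) := by
  set D : Set Plane := {y | s ≤ ‖y‖ ∧ ‖y‖ < R}
  have hD : MeasurableSet D := (measurableSet_le measurable_const measurable_norm).inter
    (measurableSet_lt measurable_norm measurable_const)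
  have hH := N.measurableSet_userWithin s
  have hDvol : volume D ≤ ENNReal.ofReal (Real.pi * R ^ 2) := by
    rw [← volume_ball 0 hR]
    exact measure_mono fun y hy => mem_ball_zero_iff.2 hy.2
  calc P (N.userWithin s ∩ {ω | ∃ m, s ≤ ‖N.user m ω‖ ∧ ‖N.user m ω‖ < R})
      = P.restrict (N.userWithin s) (⋃ m, {ω | N.user m ω ∈ D}) := by
        rw [Measure.restrict_apply' hH, Set.inter_comm, ← Set.ofPred_exists]
        rfl
    _ ≤ ∑' m, P.restrict (N.userWithin s) {ω | N.user m ω ∈ D} := measure_iUnion_le _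
    _ = ∑' m, ∫⁻ ω in N.userWithin s, D.indicator 1 (N.user m ω) ∂P :=
        tsum_congr fun m => (lintegral_indicator_one (N.user_poisson.measurable m hD :
          MeasurableSet {ω | N.user m ω ∈ D})).symm
    _ = P (N.userWithin s) * ENNReal.ofReal lamU * ∫⁻ y, D.indicator 1 y := by
        rw [userWithin_eq]
        refine N.user_poisson.tsum_setLIntegral_compl Metric.isOpen_ball.measurableSet
          measure_ball_lt_top.ne _ (measurable_one.indicator hD)
          fun y hy => Set.indicator_of_notMem (fun h => ?_) _
        rw [mem_ball_zero_iff] at hy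
        exact absurd h.1 (not_le.2 hy)
    _ ≤ _ := by
        rw [lintegral_indicator_one hD, ENNReal.ofReal_mul hU.le, mul_assoc]
        gcongr

variable [IsProbabilityMeasure P]

/-- Almost surely, no user has the same distance to the origin and to a base station. -/
lemma measure_tie (N : Network P lamB lamU) :
    P {ω | ∃ m n, dist (N.user m ω) (N.bs n ω) = ‖N.user m ω‖} = 0 := by
  rw [Set.ofPred_exists, measure_iUnion_null_iff]
  intro m
  rw [Set.ofPred_exists, measure_iUnion_null_iff]
  intro n
  have hD : MeasurableSet {q : Plane × (ℕ → Plane) | dist q.1 (q.2 n) = ‖q.1‖} :=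
    measurableSet_eq_fun (by fun_prop) (by fun_prop)
  have h := lintegral_indepFun (N.user_poisson.measurable m) N.measurable_bs
    (N.indepFun_user_bs m) (measurable_one.indicator hD)
  have h1 : ∫⁻ ω, {q : Plane × (ℕ → Plane) | dist q.1 (q.2 n) = ‖q.1‖}.indicator 1
      (N.user m ω, fun n => N.bs n ω) ∂P
      = P {ω | dist (N.user m ω) (N.bs n ω) = ‖N.user m ω‖} :=
    lintegral_indicator_one (((N.user_poisson.measurable m).prodMk N.measurable_bs) hD)
  rw [← h1, h]
  refine lintegral_eq_zero_of_ae_eq_zero (Eventually.of_forall fun y => ?_)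
  have h2 : ∫⁻ ω, {q : Plane × (ℕ → Plane) | dist q.1 (q.2 n) = ‖q.1‖}.indicator 1
      (y, fun n => N.bs n ω) ∂P = P {ω | N.bs n ω ∈ Metric.sphere y ‖y‖} := by
    simp_rw [Metric.mem_sphere, dist_comm _ y]
    exact lintegral_indicator_one ((measurable_const.prodMk N.measurable_bs) hD)
  have h3 := N.bs_poisson.tsum_measure_mem (A := Metric.sphere y ‖y‖)
    Metric.isClosed_sphere.measurableSet
  rw [Measure.addHaar_sphere, mul_zero, ENNReal.tsum_eq_zero] at h3
  exact h2.trans (h3 n)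

/-- The lower bound for the uplink. As the typical base station is active with a probability of
order `lamU / lamB`, the exceptional events have to be negligible even compared to this. Apart from
distances and fading of untypical order for the users of the typical base station, they all
involve a second user, besides the one close to the typical base station. -/
lemma le_ulSE (N : Network P lamB lamU) (hB : 0 < lamB) (hU : 0 < lamU)
    (hρ : 16 ≤ lamB / lamU) {α : ℝ} (hα : 2 < α)
    {p : ℝ} (hp : 0 < p) {K : ℝ} (hK : 1 ≤ K) (hKρ : K ^ 5 ≤ lamB / lamU) :
    ENNReal.ofReal (Real.log ((lamB / lamU) ^ (α / 2) * (K ^ (-(1 + α)) / K ^ (3 + 2 * α))))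
      * (1 - ENNReal.ofReal
        (Real.exp (4 * Real.pi) * ((36 + 4 * (tailConst α).toReal) / K))) ≤ N.ulSE α p := by
  have hpi := Real.pi_gt_three
  have hpi4 := Real.pi_le_four
  have hK0 : 0 < K := by linarith
  have hsB := Real.sqrt_pos.2 hB
  have hsU := Real.sqrt_pos.2 hU
  have hKinv : K⁻¹ ≤ 1 := inv_le_one_of_one_le₀ hK
  have hKinv0 : 0 < K⁻¹ := by positivity
  set ι : ℝ := lamU / lamB with hι
  have hι0 : 0 < ι := by positivity
  have hιK : ι * K ^ 5 ≤ 1 := by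
    rw [hι, div_mul_eq_mul_div, div_le_one hB, mul_comm]
    exact (le_div_iff₀ hU).1 hKρ
  set s : ℝ := K / √lamB with hs
  have hs0 : 0 < s := by positivity
  have hBs : √lamB * s = K := by rw [hs]; field_simp
  have hBs2 : lamB * s ^ 2 = K ^ 2 := by rw [← hBs, mul_pow, Real.sq_sqrt hB.le]
  have hUs2 : lamU * s ^ 2 = ι * K ^ 2 := by
    rw [← hBs2, hι]
    field_simp
  set R : ℝ := (K ^ 2)⁻¹ / √lamU with hR
  have hR0 : 0 < R := by positivity
  have hUR : √lamU * R = (K ^ 2)⁻¹ := by rw [hR]; field_simp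
  have hUR2 : lamU * R ^ 2 = (K⁻¹) ^ 4 := by
    have : lamU * R ^ 2 = (√lamU * R) ^ 2 := by rw [mul_pow, Real.sq_sqrt hU.le]
    rw [this, hUR, inv_pow, inv_pow, ← pow_mul]
  have hT := ENNReal.toReal_nonneg (a := tailConst α)
  have hH : P (N.userWithin s) ≤ ENNReal.ofReal (4 * ι * K ^ 2) := by
    refine (measure_exists_norm_lt_le N.user_poisson hU.le hs0.le).trans
      (ENNReal.ofReal_le_ofReal ?_)
    rw [show lamU * (Real.pi * s ^ 2) = Real.pi * (lamU * s ^ 2) by ring, hUs2]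
    have : 0 ≤ ι * K ^ 2 := by positivity
    nlinarith
  -- a user of the typical base station that is too far
  set T₁ : Set Ω := {ω | ∃ m, s ≤ ‖N.user m ω‖ ∧
    ∀ n, 1 * ‖N.user m ω‖ ≤ dist (N.user m ω) (N.bs n ω)}
  have h1 : P T₁ ≤ ENNReal.ofReal (ι * (2 / K)) := by
    rw [show T₁ = ⋃ m, {ω | s ≤ ‖N.user m ω‖ ∧
      ∀ n, 1 * ‖N.user m ω‖ ≤ dist (N.user m ω) (N.bs n ω)} from Set.ofPred_exists _]
    refine (measure_iUnion_le _).trans ((N.tsum_measure_void_le hB hU one_pos hs0.le).trans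
      (ENNReal.ofReal_le_ofReal ?_))
    have h2 : Real.exp (-(lamB * (Real.pi * 1 ^ 2) * s ^ 2 / 2)) ≤ K⁻¹ := by
      rw [show lamB * (Real.pi * 1 ^ 2) * s ^ 2 / 2 = Real.pi / 2 * (lamB * s ^ 2) by ring, hBs2]
      refine (exp_neg_le_inv (by positivity)).trans (inv_anti₀ hK0 ?_)
      nlinarith
    calc 2 * lamU / (lamB * 1 ^ 2) * Real.exp (-(lamB * (Real.pi * 1 ^ 2) * s ^ 2 / 2))
        ≤ 2 * lamU / (lamB * 1 ^ 2) * K⁻¹ := by gcongr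
      _ = ι * (2 / K) := by rw [hι]; field_simp
  -- a user of the typical base station with weak fading
  set T₂ : Set Ω := {ω | ∃ m, (∀ n, ‖N.user m ω‖ ≤ dist (N.user m ω) (N.bs n ω)) ∧
    N.userFading m ω < K⁻¹}
  have h2 : P T₂ ≤ ENNReal.ofReal (ι * (2 / K)) := by
    have hle : ∀ m, P {ω | (∀ n, ‖N.user m ω‖ ≤ dist (N.user m ω) (N.bs n ω)) ∧
        N.userFading m ω < K⁻¹}
        ≤ P {ω | 0 ≤ ‖N.user m ω‖ ∧ ∀ n, 1 * ‖N.user m ω‖ ≤ dist (N.user m ω) (N.bs n ω)}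
          * ENNReal.ofReal K⁻¹ := by
      intro m
      have hC : MeasurableSet {q : (ℕ → Plane) × (ℕ → Plane) |
          ∀ n, ‖q.2 m‖ ≤ dist (q.2 m) (q.1 n)} := by
        rw [Set.ofPred_forall]
        exact .iInter fun n => measurableSet_le
          (f := fun q : (ℕ → Plane) × (ℕ → Plane) => ‖q.2 m‖)
          (g := fun q : (ℕ → Plane) × (ℕ → Plane) => dist (q.2 m) (q.1 n))
          (by fun_prop) (by fun_prop)
      have := (N.indepFun_locations_userFading m).measure_inter_preimage_eq_mul _ _ hC
        (measurableSet_Iio (a := K⁻¹))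
      refine this.le.trans (mul_le_mul' ?_ (measure_lt_le_of_exp (N.userFading_law m) _))
      refine measure_mono fun ω hω => ⟨norm_nonneg _, fun n => ?_⟩
      rw [one_mul]
      exact hω n
    rw [show T₂ = ⋃ m, {ω | (∀ n, ‖N.user m ω‖ ≤ dist (N.user m ω) (N.bs n ω)) ∧
      N.userFading m ω < K⁻¹} from Set.ofPred_exists _]
    refine (measure_iUnion_le _).trans ((ENNReal.tsum_le_tsum hle).trans ?_)
    rw [ENNReal.tsum_mul_right]
    refine (mul_le_mul' (N.tsum_measure_void_le hB hU one_pos le_rfl) le_rfl).trans ?_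
    rw [← ENNReal.ofReal_mul (by positivity)]
    refine ENNReal.ofReal_le_ofReal (le_of_eq ?_)
    simp only [hι]
    norm_num
    field_simp
  -- two users close to the typical base station
  set T₃ : Set Ω := {ω | ∃ m n, m ≠ n ∧ N.user m ω ∈ Metric.ball 0 s ∧
    N.user n ω ∈ Metric.ball 0 s}
  have h3 : P T₃ ≤ ENNReal.ofReal (ι * (16 / K)) := by
    refine (N.user_poisson.measure_two_mem_le Metric.isOpen_ball.measurableSet
      measure_ball_lt_top.ne).trans ?_
    rw [volume_ball 0 hs0.le, ← ENNReal.ofReal_mul hU.le, ← ENNReal.ofReal_pow (by positivity)]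
    refine ENNReal.ofReal_le_ofReal ?_
    rw [show lamU * (Real.pi * s ^ 2) = Real.pi * (lamU * s ^ 2) by ring, hUs2]
    have h4 : ι * K ^ 4 ≤ 1 / K := by
      rw [le_div_iff₀ hK0]
      linarith [hιK, show ι * K ^ 4 * K = ι * K ^ 5 by ring]
    calc (Real.pi * (ι * K ^ 2)) ^ 2 = Real.pi ^ 2 * (ι * (ι * K ^ 4)) := by ring
      _ ≤ 4 ^ 2 * (ι * (1 / K)) := by gcongr
      _ = ι * (16 / K) := by ring
  -- a user close to the typical base station, and one at an intermediate distance
  set T₄ : Set Ω := N.userWithin s ∩ {ω | ∃ m, s ≤ ‖N.user m ω‖ ∧ ‖N.user m ω‖ < R}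
  have h4 : P T₄ ≤ ENNReal.ofReal (ι * (16 / K)) := by
    refine (N.measure_userWithin_inter_le hU hR0.le).trans ((mul_le_mul' hH le_rfl).trans ?_)
    rw [← ENNReal.ofReal_mul (by positivity)]
    refine ENNReal.ofReal_le_ofReal ?_
    rw [show lamU * (Real.pi * R ^ 2) = Real.pi * (lamU * R ^ 2) by ring, hUR2]
    have h5 : K⁻¹ ^ 2 ≤ K⁻¹ := by nlinarith
    calc 4 * ι * K ^ 2 * (Real.pi * K⁻¹ ^ 4) = 4 * ι * Real.pi * K⁻¹ ^ 2 := by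
          field_simp
      _ ≤ 4 * ι * 4 * K⁻¹ := by gcongr
      _ = ι * (16 / K) := by rw [div_eq_mul_inv]; ring
  -- a user close to the typical base station, and large interference
  set T₅ : Set Ω := N.userWithin s ∩
    {ω | ENNReal.ofReal (K ^ (3 + 2 * α)) ≤ N.userPowerBeyond α R s ω}
  have h5 : P T₅ ≤ ENNReal.ofReal (ι * (4 * (tailConst α).toReal / K)) := by
    have hKα : 0 < K ^ (3 + 2 * α) := by positivity
    have hmarkov := meas_ge_le_lintegral_div (μ := P.restrict (N.userWithin s))
      (f := N.userPowerBeyond α R s) (ε := ENNReal.ofReal (K ^ (3 + 2 * α)))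
      (N.measurable_userPowerBeyond α R s).aemeasurable (by simpa using hKα)
      ENNReal.ofReal_ne_top
    rw [Measure.restrict_apply' (N.measurableSet_userWithin s), Set.inter_comm] at hmarkov
    refine hmarkov.trans (ENNReal.div_le_of_le_mul ?_)
    refine (N.setLIntegral_userPowerBeyond_le hU α hR0 s).trans ((mul_le_mul' hH le_rfl).trans ?_)
    rw [← ENNReal.ofReal_toReal (tailConst_lt_top hα).ne, ← ENNReal.ofReal_mul (by positivity),
      ← ENNReal.ofReal_mul (by positivity), ← ENNReal.ofReal_mul (by positivity),
      ENNReal.toReal_ofReal ENNReal.toReal_nonneg]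
    refine ENNReal.ofReal_le_ofReal ?_
    have h6 : K ^ 2 * (√lamU * R) ^ (2 - α) ≤ K⁻¹ * K ^ (3 + 2 * α) := by
      have h7 : (√lamU * R) ^ (2 - α) = K ^ (2 * α - 4) := by
        rw [hUR, ← Real.rpow_two, ← Real.rpow_neg hK0.le, ← Real.rpow_mul hK0.le]
        ring_nf
      rw [h7, ← Real.rpow_two, ← Real.rpow_neg_one, ← Real.rpow_add hK0, ← Real.rpow_add hK0]
      exact Real.rpow_le_rpow_of_exponent_le hK (by linarith)
    calc 4 * ι * K ^ 2 * ((√lamU * R) ^ (2 - α) * (tailConst α).toReal)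
        = 4 * ι * (K ^ 2 * (√lamU * R) ^ (2 - α)) * (tailConst α).toReal := by ring
      _ ≤ 4 * ι * (K⁻¹ * K ^ (3 + 2 * α)) * (tailConst α).toReal := by gcongr
      _ = _ := by rw [div_eq_mul_inv]; ring
  set T₆ : Set Ω := {ω | ∃ m n, dist (N.user m ω) (N.bs n ω) = ‖N.user m ω‖}
  have h6 : P T₆ = 0 := N.measure_tie
  set T : Set Ω := T₁ ∪ (T₂ ∪ (T₃ ∪ (T₄ ∪ (T₅ ∪ T₆))))
  have hPT : P T ≤ ENNReal.ofReal ((36 + 4 * (tailConst α).toReal) / K * ι) := by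
    refine (measure_union_le _ _).trans ((add_le_add h1 ((measure_union_le _ _).trans
      (add_le_add h2 ((measure_union_le _ _).trans (add_le_add h3 ((measure_union_le _ _).trans
        (add_le_add h4 ((measure_union_le _ _).trans (add_le_add h5 h6.le))))))))).trans_eq ?_)
    rw [add_zero, ← ENNReal.ofReal_add (by positivity) (by positivity),
      ← ENNReal.ofReal_add (by positivity) (by positivity),
      ← ENNReal.ofReal_add (by positivity) (by positivity),
      ← ENNReal.ofReal_add (by positivity) (by positivity)]
    congr 1
    ring
  have hA0 : P N.ulActive ≠ 0 :=
    ne_of_gt (lt_of_lt_of_le (ENNReal.ofReal_pos.2 (by positivity))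
      (N.le_measure_ulActive hB hU hρ))
  have hAm := N.measurableSet_ulActive
  have := cond_isProbabilityMeasure hA0
  rw [N.ulSE_eq hB hU α hp]
  refine mul_one_sub_le_lintegral (P := ProbabilityTheory.cond P N.ulActive)
    (T := T ∪ N.ulActiveᶜ) ?_ ?_
  · intro ω hω
    simp only [T, Set.mem_union, not_or, Set.mem_compl_iff, not_not] at hω
    obtain ⟨⟨hω1, hω2, hω3, hω4, hω5, hω6⟩, m₀, hm₀⟩ := hω
    have hcell : ∀ m, Associated (N.ulBs ω) (N.user m ω) none → ‖N.user m ω‖ < s := by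
      intro m hm
      by_contra! h
      exact hω1 ⟨m, h, fun n => by rw [one_mul]; exact (N.associated_none_iff ω _).1 hm n⟩
    have hsm₀ := hcell m₀ hm₀
    have huniq : ∀ m, m ≠ m₀ → s ≤ ‖N.user m ω‖ := by
      intro m hm
      by_contra! h
      exact hω3 ⟨m, m₀, hm, mem_ball_zero_iff.2 h, mem_ball_zero_iff.2 hsm₀⟩
    have hsched : N.ulScheduled ω none m₀ := by
      refine ⟨hm₀, fun m hm => ?_⟩
      by_cases h : m = m₀
      · rw [h]
      · exact absurd (hcell m hm) (not_lt.2 (huniq m h))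
    have hwithin : ω ∈ N.userWithin s := ⟨m₀, hsm₀⟩
    have hg : K⁻¹ ≤ N.userFading m₀ ω :=
      not_lt.1 fun h => hω2 ⟨m₀, (N.associated_none_iff ω _).1 hm₀, h⟩
    have hJ : N.ulScaledInterference α ω ≤ N.userPowerBeyond α R s ω := by
      refine le_trans ?_ (ENNReal.tsum_comp_le_tsum_of_injective
        (Subtype.val_injective (p := fun m => m ∈ ulInterferer (N.config ω))) _)
      refine ENNReal.tsum_le_tsum fun ⟨m, hm⟩ => ?_
      obtain ⟨n, hn, -⟩ := (N.mem_ulInterferer_config ω m).1 hm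
      have hmm₀ : m ≠ m₀ := by
        rintro rfl
        exact hω6 ⟨m, n, le_antisymm ((N.associated_some_iff ω _ n).1 hn).1
          ((N.associated_none_iff ω _).1 hm₀ n)⟩
      have hms := huniq m hmm₀
      have hmR : R ≤ ‖N.user m ω‖ := not_lt.1 fun h => hω4 ⟨hwithin, m, hms, h⟩
      rw [Set.indicator_of_mem (by exact ⟨hmR, hms⟩)]
    refine le_capacity_of_bounds (by positivity) (by positivity) (by positivity) ?_
      (hJ.trans (not_le.1 fun h => hω5 ⟨hwithin, h⟩).le)
    refine le_trans ?_ (le_scaledPower (n := m₀) (d := K) (by linarith) hsB.le hsched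
      (by rw [← hBs]; gcongr))
    rw [neg_add, Real.rpow_add hK0, Real.rpow_neg_one, ENNReal.ofReal_mul (by positivity),
      ENNReal.ofReal_rpow_of_pos hK0]
    gcongr
  · refine (measure_union_le _ _).trans ?_
    rw [cond_apply hAm, cond_apply hAm, Set.inter_compl_self, measure_empty, mul_zero, add_zero]
    calc (P N.ulActive)⁻¹ * P (N.ulActive ∩ T)
        ≤ (P N.ulActive)⁻¹ * ENNReal.ofReal ((36 + 4 * (tailConst α).toReal) / K * ι) := by
          gcongr
          exact (measure_mono Set.inter_subset_right).trans hPT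
      _ ≤ _ := N.inv_measure_ulActive_mul_le hB hU hρ _

end Network

/-! ### The asymptotics -/

/-- Bounds by `a * log ρ` up to a term of order `√(log ρ)` above, and a term of order
`log (log ρ)` and a factor `1 - O(1 / log ρ)` below, determine the asymptotics. -/
lemma tendsto_div_log_of_bounds {ι : Type*} {l : Filter ι} {ρ : ι → ℝ} (hρ : Tendsto ρ l atTop)
    {f : ι → ℝ≥0∞} {a b c C D : ℝ} (ha : 0 < a)
    (hub : ∀ᶠ i in l, f i ≤ ENNReal.ofReal (a * Real.log (ρ i) + C + b * √(Real.log (ρ i))))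
    (hlb : ∀ᶠ i in l, ENNReal.ofReal (a * Real.log (ρ i) - c * Real.log (Real.log (ρ i)))
      * (1 - ENNReal.ofReal (D / Real.log (ρ i))) ≤ f i) :
    Tendsto (fun i => f i / ENNReal.ofReal (a * Real.log (ρ i))) l (𝓝 1) := by
  have hx : Tendsto (fun i => Real.log (ρ i)) l atTop := Real.tendsto_log_atTop.comp hρ
  have hinv : Tendsto (fun x : ℝ => x⁻¹) atTop (𝓝 0) := tendsto_inv_atTop_zero
  have hsqrt : Tendsto (fun x : ℝ => √x / x) atTop (𝓝 0) := by
    simp_rw [Real.sqrt_div_self', one_div]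
    exact tendsto_inv_atTop_zero.comp Real.tendsto_sqrt_atTop
  have hlog : Tendsto (fun x : ℝ => Real.log x / x) atTop (𝓝 0) := by
    simpa using Real.tendsto_pow_log_div_mul_add_atTop 1 0 1 one_ne_zero
  have hu : Tendsto (fun x : ℝ => ENNReal.ofReal ((a * x + C + b * √x) / (a * x))) atTop
      (𝓝 1) := by
    rw [← ENNReal.ofReal_one]
    refine ENNReal.tendsto_ofReal ?_
    have h : Tendsto (fun x : ℝ => 1 + C / a * x⁻¹ + b / a * (√x / x)) atTop
        (𝓝 (1 + C / a * 0 + b / a * 0)) :=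
      (tendsto_const_nhds.add (hinv.const_mul _)).add (hsqrt.const_mul _)
    rw [mul_zero, mul_zero, add_zero, add_zero] at h
    refine h.congr' ?_
    filter_upwards [eventually_gt_atTop 0] with x hx
    field_simp
  have hl : Tendsto (fun x : ℝ => ENNReal.ofReal ((a * x - c * Real.log x) / (a * x))
      * (1 - ENNReal.ofReal (D / x))) atTop (𝓝 1) := by
    have h1 : Tendsto (fun x : ℝ => ENNReal.ofReal ((a * x - c * Real.log x) / (a * x))) atTop
        (𝓝 1) := by
      rw [← ENNReal.ofReal_one]
      refine ENNReal.tendsto_ofReal ?_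
      have h : Tendsto (fun x : ℝ => 1 - c / a * (Real.log x / x)) atTop (𝓝 (1 - c / a * 0)) :=
        tendsto_const_nhds.sub (hlog.const_mul _)
      rw [mul_zero, sub_zero] at h
      refine h.congr' ?_
      filter_upwards [eventually_gt_atTop 0] with x hx
      field_simp
    have h2 : Tendsto (fun x : ℝ => 1 - ENNReal.ofReal (D / x)) atTop (𝓝 1) := by
      have h : Tendsto (fun x : ℝ => ENNReal.ofReal (D / x)) atTop (𝓝 0) := by
        rw [← ENNReal.ofReal_zero]
        exact ENNReal.tendsto_ofReal (tendsto_const_nhds.div_atTop tendsto_id)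
      have h3 := ENNReal.Tendsto.sub (tendsto_const_nhds (x := (1 : ℝ≥0∞))) h
        (Or.inl ENNReal.one_ne_top)
      rwa [tsub_zero] at h3
    have h3 := ENNReal.Tendsto.mul h1 (Or.inl one_ne_zero) h2 (Or.inl one_ne_zero)
    rwa [mul_one] at h3
  refine tendsto_of_tendsto_of_tendsto_of_le_of_le' (hl.comp hx) (hu.comp hx) ?_ ?_
  · filter_upwards [hlb, hx.eventually_gt_atTop 0] with i hi h0
    have h1 : 0 < a * Real.log (ρ i) := by positivity
    refine le_trans (le_of_eq ?_) (ENNReal.div_le_div_right hi _)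
    simp only [Function.comp_apply]
    rw [ENNReal.ofReal_div_of_pos h1, ENNReal.mul_div_right_comm]
  · filter_upwards [hub, hx.eventually_gt_atTop 0] with i hi h0
    have h1 : 0 < a * Real.log (ρ i) := by positivity
    refine (ENNReal.div_le_div_right hi _).trans (le_of_eq ?_)
    simp only [Function.comp_apply]
    rw [ENNReal.ofReal_div_of_pos h1]

lemma capacity_rpow_le_log {α ρ : ℝ} (hα : 0 ≤ α) (hρ : 1 ≤ ρ) :
    capacity (ENNReal.ofReal (ρ ^ (α / 2))) ≤ ENNReal.ofReal (1 + α / 2 * Real.log ρ) := by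
  have h1 : 1 ≤ ρ ^ (α / 2) := Real.one_le_rpow hρ (by positivity)
  rw [capacity_ofReal (by positivity)]
  refine ENNReal.ofReal_le_ofReal ?_
  calc Real.log (1 + ρ ^ (α / 2)) ≤ Real.log (2 * ρ ^ (α / 2)) :=
        Real.log_le_log (by positivity) (by linarith)
    _ = Real.log 2 + α / 2 * Real.log ρ := by
        rw [Real.log_mul two_ne_zero (by positivity), Real.log_rpow (by positivity)]
    _ ≤ 1 + α / 2 * Real.log ρ := by linarith [Real.log_two_lt_d9]

lemma one_le_log_of_le {ρ : ℝ} (hρ : 16 ≤ ρ) : 1 ≤ Real.log ρ := by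
  rw [Real.le_log_iff_exp_le (by linarith)]
  linarith [Real.exp_one_lt_d9]

lemma sqrt_ceil_le {x : ℝ} (hx : 1 ≤ x) : √(⌈x⌉₊ : ℝ) ≤ 2 * √x := by
  have h := (Nat.ceil_lt_add_one (by linarith : 0 ≤ x)).le
  calc √(⌈x⌉₊ : ℝ) ≤ √(2 ^ 2 * x) := Real.sqrt_le_sqrt (by linarith)
    _ = 2 * √x := by rw [Real.sqrt_mul (by norm_num), Real.sqrt_sq (by norm_num)]

lemma exp_neg_ceil_log_le {ρ : ℝ} (hρ : 0 < ρ) : Real.exp (-⌈Real.log ρ⌉₊) ≤ ρ⁻¹ := by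
  rw [Real.exp_neg]
  refine inv_anti₀ hρ ?_
  calc ρ = Real.exp (Real.log ρ) := (Real.exp_log hρ).symm
    _ ≤ _ := Real.exp_le_exp.2 (Nat.le_ceil _)

/-- The logarithm of the lower bound for the ratio of signal and interference. -/
lemma sub_log_le_log {α β ρ K : ℝ} (hρ : 0 < ρ) (hK : 1 ≤ K) (hβ : β ≤ 3 + 2 * α) :
    α / 2 * Real.log ρ - (4 + 3 * α) * Real.log K
      ≤ Real.log (ρ ^ (α / 2) * (K ^ (-(1 + α)) / K ^ β)) := by
  have hK0 : 0 < K := by linarith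
  have h := Real.log_nonneg hK
  rw [Real.log_mul (by positivity) (by positivity), Real.log_div (by positivity) (by positivity),
    Real.log_rpow hρ, Real.log_rpow hK0, Real.log_rpow hK0]
  nlinarith

namespace Network

variable {Ω : Type*} [MeasurableSpace Ω] {P : Measure Ω} [IsProbabilityMeasure P]
  {lamB lamU : ℝ}

/-- The constant term in the upper bounds for the spectral efficiencies. -/
def upperConst (α : ℝ) : ℝ :=
  1 + Real.exp (4 * Real.pi) * (∫⁻ z, fadingCapacity α z).toReal
    + (4 + Real.exp (4 * Real.pi) * (6 * (4 + 6 * α)))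

lemma ofReal_upper_bound {α ρ : ℝ} (hα : 2 < α) (hρ : 16 ≤ ρ) :
    capacity (ENNReal.ofReal (ρ ^ (α / 2)))
      + ENNReal.ofReal (Real.exp (4 * Real.pi)) * (∫⁻ z, fadingCapacity α z)
      + (ENNReal.ofReal (4 + 6 * α * √(⌈Real.log ρ⌉₊ : ℝ))
        + ENNReal.ofReal (Real.exp (4 * Real.pi) * (6 * (4 + 6 * α))))
      ≤ ENNReal.ofReal (α / 2 * Real.log ρ + upperConst α + 12 * α * √(Real.log ρ)) := by
  have hL := one_le_log_of_le hρ
  have hF := ENNReal.toReal_nonneg (a := ∫⁻ z, fadingCapacity α z)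
  rw [← ENNReal.ofReal_toReal (lintegral_fadingCapacity_lt_top hα).ne,
    ← ENNReal.ofReal_mul (by positivity)]
  refine (add_le_add (add_le_add (capacity_rpow_le_log (by linarith) (by linarith)) le_rfl)
    le_rfl).trans ?_
  rw [← ENNReal.ofReal_add (by positivity) (by positivity),
    ← ENNReal.ofReal_add (by positivity) (by positivity),
    ← ENNReal.ofReal_add (by positivity) (by positivity)]
  refine ENNReal.ofReal_le_ofReal ?_
  have h := mul_le_mul_of_nonneg_left (sqrt_ceil_le hL) (show 0 ≤ 6 * α by linarith)
  rw [upperConst]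
  linarith

lemma ulSE_le_log (N : Network P lamB lamU) (hB : 0 < lamB) (hU : 0 < lamU)
    (hρ : 16 ≤ lamB / lamU) {α : ℝ} (hα : 2 < α) {p : ℝ} (hp : 0 < p) :
    N.ulSE α p ≤ ENNReal.ofReal (α / 2 * Real.log (lamB / lamU) + upperConst α
      + 12 * α * √(Real.log (lamB / lamU))) := by
  refine le_trans ?_ (ofReal_upper_bound hα hρ)
  refine N.ulSE_le hB hU hρ hα hp (Nat.one_le_ceil_iff.2 ?_) ?_
  · linarith [one_le_log_of_le hρ]
  · exact (exp_neg_ceil_log_le (by positivity)).trans_eq (inv_div _ _)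

lemma dlSE_le_log (N : Network P lamB lamU) (hB : 0 < lamB) (hU : 0 < lamU)
    (hρ : 16 ≤ lamB / lamU) {α : ℝ} (hα : 2 < α) {p : ℝ} (hp : 0 < p) :
    N.dlSE α p ≤ ENNReal.ofReal (α / 2 * Real.log (lamB / lamU) + upperConst α
      + 12 * α * √(Real.log (lamB / lamU))) := by
  refine le_trans ?_ (ofReal_upper_bound hα hρ)
  refine (N.dlSE_le hB hU hρ hα hp (k₀ := ⌈Real.log (lamB / lamU)⌉₊)
    (Nat.one_le_ceil_iff.2 (by linarith [one_le_log_of_le hρ]))).trans ?_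
  have h1 : 1 ≤ Real.exp (4 * Real.pi) := Real.one_le_exp (by positivity)
  have h2 : Real.exp (-(⌈Real.log (lamB / lamU)⌉₊ : ℝ)) ≤ 1 :=
    Real.exp_le_one_iff.2 (neg_nonpos.2 (Nat.cast_nonneg _))
  refine add_le_add (add_le_add le_rfl ?_) (add_le_add le_rfl (ENNReal.ofReal_le_ofReal ?_))
  · refine le_mul_of_one_le_left zero_le ?_
    rw [← ENNReal.ofReal_one]
    exact ENNReal.ofReal_le_ofReal h1
  · have : (0 : ℝ) ≤ 6 * (4 + 6 * α) := by linarith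
    nlinarith

lemma log_le_dlSE (N : Network P lamB lamU) (hB : 0 < lamB) (hU : 0 < lamU) {α : ℝ} (hα : 2 < α)
    {p : ℝ} (hp : 0 < p) (hL : 1 ≤ Real.log (lamB / lamU)) :
    ENNReal.ofReal (α / 2 * Real.log (lamB / lamU)
        - (4 + 3 * α) * Real.log (Real.log (lamB / lamU)))
      * (1 - ENNReal.ofReal ((15 + 2 * 2 ^ α * (tailConst α).toReal) / Real.log (lamB / lamU)))
      ≤ N.dlSE α p := by
  have hρ : 0 < lamB / lamU := by positivity
  refine le_trans ?_ (N.le_dlSE hB hU hα hp hL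
    ((Real.log_le_sub_one_of_pos hρ).trans (by linarith)))
  gcongr
  exact sub_log_le_log hρ hL (by linarith)

lemma log_le_ulSE (N : Network P lamB lamU) (hB : 0 < lamB) (hU : 0 < lamU)
    (hρ : 16 ≤ lamB / lamU) {α : ℝ} (hα : 2 < α) {p : ℝ} (hp : 0 < p)
    (hL : Real.log (lamB / lamU) ^ 5 ≤ lamB / lamU) :
    ENNReal.ofReal (α / 2 * Real.log (lamB / lamU)
        - (4 + 3 * α) * Real.log (Real.log (lamB / lamU)))
      * (1 - ENNReal.ofReal (Real.exp (4 * Real.pi) * (36 + 4 * (tailConst α).toReal)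
        / Real.log (lamB / lamU))) ≤ N.ulSE α p := by
  have hL1 := one_le_log_of_le hρ
  refine le_trans ?_ (N.le_ulSE hB hU hρ hα hp hL1 hL)
  rw [mul_div_assoc]
  gcongr
  exact sub_log_le_log (by positivity) hL1 le_rfl

end Network

end CellularNetwork

end

/-- Along any family of networks whose base-station-to-user density ratio tends to infinity, the
downlink and uplink spectral efficiencies are both asymptotically equivalent to
`(α / 2) * log (lamB / lamU)`, and to each other. -/
theorem theorem1 {ι : Type*} (l : Filter ι) (α : ℝ) (hα : 2 < α)
    (lamB lamU pD pU : ι → ℝ)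
    (hlamB : ∀ i, 0 < lamB i) (hlamU : ∀ i, 0 < lamU i)
    (hpD : ∀ i, 0 < pD i) (hpU : ∀ i, 0 < pU i)
    (hratio : Tendsto (fun i => lamB i / lamU i) l atTop)
    {Ω : ι → Type*} [∀ i, MeasurableSpace (Ω i)] (P : ∀ i, Measure (Ω i))
    [∀ i, IsProbabilityMeasure (P i)]
    (N : ∀ i, CellularNetwork.Network (P i) (lamB i) (lamU i)) :
    Tendsto (fun i => (N i).dlSE α (pD i) /
        ENNReal.ofReal (α / 2 * Real.log (lamB i / lamU i))) l (𝓝 1) ∧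
      Tendsto (fun i => (N i).ulSE α (pU i) /
        ENNReal.ofReal (α / 2 * Real.log (lamB i / lamU i))) l (𝓝 1) ∧
      Tendsto (fun i => (N i).ulSE α (pU i) / (N i).dlSE α (pD i)) l (𝓝 1) := by
  have h16 : ∀ᶠ i in l, 16 ≤ lamB i / lamU i := hratio.eventually_ge_atTop 16
  have hpow : ∀ᶠ i in l, Real.log (lamB i / lamU i) ^ 5 ≤ lamB i / lamU i := by
    have h := hratio.eventually ((Real.isLittleO_pow_log_id_atTop (n := 5)).bound one_pos)
    filter_upwards [h, h16] with i hi hi16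
    rw [one_mul, id, Real.norm_of_nonneg (by linarith : 0 ≤ lamB i / lamU i)] at hi
    exact (le_abs_self _).trans hi
  have hdl := CellularNetwork.tendsto_div_log_of_bounds hratio
    (f := fun i => (N i).dlSE α (pD i)) (a := α / 2) (by linarith)
    (h16.mono fun i hi => (N i).dlSE_le_log (hlamB i) (hlamU i) hi hα (hpD i))
    (h16.mono fun i hi => (N i).log_le_dlSE (hlamB i) (hlamU i) hα (hpD i)
      (CellularNetwork.one_le_log_of_le hi))
  have hul := CellularNetwork.tendsto_div_log_of_bounds hratio
    (f := fun i => (N i).ulSE α (pU i)) (a := α / 2) (by linarith)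
    (h16.mono fun i hi => (N i).ulSE_le_log (hlamB i) (hlamU i) hi hα (hpU i))
    ((h16.and hpow).mono fun i hi => (N i).log_le_ulSE (hlamB i) (hlamU i) hi.1 hα (hpU i) hi.2)
  refine ⟨hdl, hul, ?_⟩
  have h := ENNReal.Tendsto.div hul (Or.inl one_ne_zero) hdl (Or.inl ENNReal.one_ne_top)
  rw [div_one] at h
  refine h.congr' ?_
  filter_upwards [h16] with i hi
  have hL : 0 < α / 2 * Real.log (lamB i / lamU i) :=
    mul_pos (by linarith) (by linarith [CellularNetwork.one_le_log_of_le hi])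
  rw [div_eq_mul_inv ((N i).ulSE α (pU i)), div_eq_mul_inv ((N i).dlSE α (pD i))]
  exact ENNReal.mul_div_mul_right _ _ (ENNReal.inv_ne_zero.2 ENNReal.ofReal_ne_top)
    (ENNReal.inv_ne_top.2 (ENNReal.ofReal_pos.2 hL).ne')
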